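/- **Theorem.** The evaluation problem for queries in $E_1$, parameterized by the size of the query, is in W[P]. Here the notions are as follows. *Expressions.* Regular expressions with binding (REWBs) over letters $a$ and variables $x$ are given by $r ::= \varepsilon \mid a \mid a[c] \mid r+r \mid r\cdot r \mid r^* \mid a{\downarrow_x}(r)$, where $c$ is a Boolean combination of conditions $x^{=}$, $x^{\neq}$. Let $\mathcal D$ be a countably infinite set of data values. For a partial valuation $\nu$ of the variables in $\mathcal D$ that is defined on the free variables of $r$, the data language $L(r,\nu)$, a set of finite words of pairs (letter, data value), is defined as usual: $L(a,\nu)$ consists of the words $\binom ad$ with $d\in\mathcal D$; $L(a[c],\nu)$ of those where $d,\nu\models c$ (with $d,\nu\models x^{=}$ iff $\nu(x)=d$); $\varepsilon$, $+$, $\cdot$, $^*$ are the regular operations; and $L(a{\downarrow_x}(r),\nu)=\bigcup_{d\in\mathcal D}\{\binom ad\}\cdot L(r,\nu[x\to d])$. The class $F_0$ consists of the REWBs without binding operator, and $E_1$ is generated by $E_1 ::= F_0 \mid E_1+E_1 \mid E_1\cdot E_1 \mid a{\downarrow_x}(E_1)$. *Problem.* An instance of the evaluation problem for $E_1$ consists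 of a data graph $G$ (a finite vertex set $V$ and a finite set of edges, each a quadruple of a source vertex, a letter, a data value and a target vertex), an expression $e$ in $E_1$, a partial valuation $\nu$ defined on the free variables of $e$, and two vertices $u,v$. The question is whether there is a path in $G$ from $u$ to $v$ whose sequence of labels is a data word in $L(e,\nu)$. The instance is encoded as a binary string (with letters, variables and data values, which are natural numbers, written in binary), and the parameter is the size of $e$, that is, its number of symbols. *W[P].* An FPT reduction from a parameterized problem $Q$ to a parameterized problem $Q'$ maps each instance $(x,k)$ of $Q$ to an instance $(x',k')$ of $Q'$ such that $(x,k)\in Q$ iff $(x',k')\in Q'$, such that $k'\le g(k)$ for some computable $g:\mathbb N\to\mathbb N$, and such that $(x',k')$ is computed from $(x,k)$ by a Turing machine in at most $f(k)\,|x|^{c}$ steps, for some computable $f:\mathbb N\to\mathbb N$ and some constant $c$. W[P] is the class of all parameterized problems that have an FPT reduction to parameterized weighted circuit satisfiability: given a Boolean circuit and the parameter $k$, is there a satisfying assignment that sets exactly $k$ inputs to true? -/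

import Mathlib

namespace DataQuery

/-! ### Regular expressions with binding -/

/-- Boolean combinations of the atomic conditions `x^=` and `x^≠`. -/
inductive Cond (Var : Type) : Type
  | eq (x : Var)
  | ne (x : Var)
  | and (c₁ c₂ : Cond Var)
  | or (c₁ c₂ : Cond Var)
  | not (c : Cond Var)

/-- Satisfaction of a condition by a data value `d` under a partial valuation `ν`. -/
def Cond.Sat {Var D : Type} (d : D) (ν : Var → Option D) : Cond Var → Prop
  | .eq x => ν x = some d
  | .ne x => ν x ≠ some d
  | .and c₁ c₂ => c₁.Sat d ν ∧ c₂.Sat d ν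
  | .or c₁ c₂ => c₁.Sat d ν ∨ c₂.Sat d ν
  | .not c => ¬ c.Sat d ν

/-- Variables occurring in a condition. -/
def Cond.vars {Var : Type} : Cond Var → Set Var
  | .eq x => {x}
  | .ne x => {x}
  | .and c₁ c₂ => c₁.vars ∪ c₂.vars
  | .or c₁ c₂ => c₁.vars ∪ c₂.vars
  | .not c => c.vars

/-- Number of symbols of a condition. -/
def Cond.size {Var : Type} : Cond Var → ℕ
  | .eq _ => 1
  | .ne _ => 1
  | .and c₁ c₂ => 1 + c₁.size + c₂.size
  | .or c₁ c₂ => 1 + c₁.size + c₂.size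
  | .not c => 1 + c.size

/-- Regular expressions with binding (REWB) over the letters `Sig` and the variables `Var`. -/
inductive REWB (Sig Var : Type) : Type
  | eps
  | letter (a : Sig)
  | test (a : Sig) (c : Cond Var)
  | union (r s : REWB Sig Var)
  | concat (r s : REWB Sig Var)
  | star (r : REWB Sig Var)
  | bind (a : Sig) (x : Var) (r : REWB Sig Var)

/-- Free variables. -/
def REWB.fv {Sig Var : Type} : REWB Sig Var → Set Var
  | .eps => ∅
  | .letter _ => ∅
  | .test _ c => c.vars
  | .union r s => r.fv ∪ s.fv
  | .concat r s => r.fv ∪ s.fv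
  | .star r => r.fv
  | .bind _ x r => r.fv \ {x}

/-- Size of an expression: the number of its symbols. -/
def REWB.size {Sig Var : Type} : REWB Sig Var → ℕ
  | .eps => 1
  | .letter _ => 1
  | .test _ c => 1 + c.size
  | .union r s => 1 + r.size + s.size
  | .concat r s => 1 + r.size + s.size
  | .star r => 1 + r.size
  | .bind _ _ r => 1 + r.size

/-- The data language `L(r, ν)`; data words are finite words over `Sig × D`. -/
def REWB.lang {Sig Var D : Type} [DecidableEq Var] :
    REWB Sig Var → (Var → Option D) → Language (Sig × D)
  | .eps, _ => 1
  | .letter a, _ => {w | ∃ d : D, w = [(a, d)]}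
  | .test a c, ν => {w | ∃ d : D, c.Sat d ν ∧ w = [(a, d)]}
  | .union r s, ν => r.lang ν + s.lang ν
  | .concat r s, ν => r.lang ν * s.lang ν
  | .star r, ν => KStar.kstar (r.lang ν)
  | .bind a x r, ν =>
      {w | ∃ (d : D) (w' : List (Sig × D)),
        w' ∈ r.lang (Function.update ν x (some d)) ∧ w = (a, d) :: w'}

mutual

/-- `IsE i r`: the expression `r` is generated by `E_i` (for `i ≥ 1`; `IsE 0` is empty) in
`E_i ::= F_{i-1} | E_i + E_i | E_i · E_i | a ↓_x (E_i)`. -/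
inductive IsE {Sig Var : Type} : ℕ → REWB Sig Var → Prop
  | ofF {i : ℕ} {r : REWB Sig Var} : IsF i r → IsE (i + 1) r
  | union {i : ℕ} {r s : REWB Sig Var} : IsE i r → IsE i s → IsE i (.union r s)
  | concat {i : ℕ} {r s : REWB Sig Var} : IsE i r → IsE i s → IsE i (.concat r s)
  | bind {i : ℕ} {r : REWB Sig Var} (a : Sig) (x : Var) : IsE i r → IsE i (.bind a x r)

/-- `IsF i r`: the expression `r` is generated by `F_i` in
`F_0 ::= ε | a | a[c] | F_0 + F_0 | F_0 · F_0 | F_0^*` and, for `i ≥ 1`,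
`F_i ::= E_i | F_i + F_i | F_i · F_i | F_i^*`. -/
inductive IsF {Sig Var : Type} : ℕ → REWB Sig Var → Prop
  | eps : IsF 0 .eps
  | letter (a : Sig) : IsF 0 (.letter a)
  | test (a : Sig) (c : Cond Var) : IsF 0 (.test a c)
  | ofE {i : ℕ} {r : REWB Sig Var} : IsE i r → IsF i r
  | union {i : ℕ} {r s : REWB Sig Var} : IsF i r → IsF i s → IsF i (.union r s)
  | concat {i : ℕ} {r s : REWB Sig Var} : IsF i r → IsF i s → IsF i (.concat r s)
  | star {i : ℕ} {r : REWB Sig Var} : IsF i r → IsF i (.star r)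

end

/-! ### Data graphs and query evaluation -/

/-- A data graph with vertex set `V`: a finite set of edges labelled in `Sig × D`. -/
structure DataGraph (V Sig D : Type) [Fintype V] where
  edges : Set (V × Sig × D × V)
  finite : edges.Finite

/-- `G.Path u w v`: there is a data path from `u` to `v` with sequence of labels `w`. -/
inductive DataGraph.Path {V Sig D : Type} [Fintype V] (G : DataGraph V Sig D) :
    V → List (Sig × D) → V → Prop
  | nil (v : V) : G.Path v [] v
  | cons {u v v' : V} {a : Sig} {d : D} {w : List (Sig × D)} :
      (u, a, d, v) ∈ G.edges → G.Path v w v' → G.Path u ((a, d) :: w) v'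

/-- The pairs of nodes connected by a data path whose data word is in `L(r, ν)`. -/
def DataGraph.eval {V Sig D Var : Type} [Fintype V] [DecidableEq Var] (G : DataGraph V Sig D)
    (r : REWB Sig Var) (ν : Var → Option D) : Set (V × V) :=
  {p | ∃ w ∈ r.lang ν, G.Path p.1 w p.2}

/-- A partial valuation of variables that is defined on all free variables of `r`. -/
def Compatible {Sig Var D : Type} (r : REWB Sig Var) (ν : Var → Option D) : Prop :=
  ∀ x ∈ r.fv, ν x ≠ none

/-! ### Codes over the binary alphabet -/

/-- A uniquely readable (prefix-free) code. -/
def IsPrefixCode {α : Type} (c : α → List Bool) : Prop :=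
  ∀ (a b : α) (s t : List Bool), c a ++ s = c b ++ t → a = b ∧ s = t

/-- `n` as `1^n 0`. -/
def unaryCode (n : ℕ) : List Bool := List.replicate n true ++ [false]

/-- A list as `1 c(a₁) 1 c(a₂) … 1 c(a_m) 0`. -/
def listCode {α : Type} (c : α → List Bool) : List α → List Bool
  | [] => [false]
  | a :: l => true :: (c a ++ listCode c l)

/-- `n` as the self-delimiting code of its binary digits. -/
def natCode (n : ℕ) : List Bool := listCode (fun b => [b]) n.bits

/-- Prefix notation. -/
def condCode : Cond ℕ → List Bool
  | .eq x => [false, false, false] ++ natCode x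
  | .ne x => [false, false, true] ++ natCode x
  | .and c₁ c₂ => [false, true, false] ++ (condCode c₁ ++ condCode c₂)
  | .or c₁ c₂ => [false, true, true] ++ (condCode c₁ ++ condCode c₂)
  | .not c => [true, false, false] ++ condCode c

/-- Prefix notation. -/
def queryCode : REWB ℕ ℕ → List Bool
  | .eps => [false, false, false]
  | .letter a => [false, false, true] ++ natCode a
  | .test a c => [false, true, false] ++ (natCode a ++ condCode c)
  | .union r s => [false, true, true] ++ (queryCode r ++ queryCode s)
  | .concat r s => [true, false, false] ++ (queryCode r ++ queryCode s)
  | .star r => [true, false, true] ++ queryCode r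
  | .bind a x r => [true, true, false] ++ (natCode a ++ (natCode x ++ queryCode r))

theorem isPrefixCode_unaryCode : IsPrefixCode unaryCode := by
  intro a
  induction a with
  | zero =>
    intro b s t h
    cases b with
    | zero => simpa [unaryCode] using h
    | succ b => simp [unaryCode, List.replicate_succ] at h
  | succ a ih =>
    intro b s t h
    cases b with
    | zero => simp [unaryCode, List.replicate_succ] at h
    | succ b =>
      have h' : unaryCode a ++ s = unaryCode b ++ t := by
        simpa [unaryCode, List.replicate_succ] using h
      obtain ⟨h₁, h₂⟩ := ih b s t h'
      exact ⟨by rw [h₁], h₂⟩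

theorem isPrefixCode_listCode {α : Type} {c : α → List Bool} (hc : IsPrefixCode c) :
    IsPrefixCode (listCode c) := by
  intro a
  induction a with
  | nil =>
    intro b s t h
    cases b with
    | nil => simpa [listCode] using h
    | cons b l => simp [listCode] at h
  | cons a l ih =>
    intro b s t h
    cases b with
    | nil => simp [listCode] at h
    | cons b l' =>
      simp only [listCode, List.cons_append, List.append_assoc, List.cons.injEq, true_and] at h
      obtain ⟨h₁, h₂⟩ := hc _ _ _ _ h
      obtain ⟨h₃, h₄⟩ := ih _ _ _ h₂
      exact ⟨by rw [h₁, h₃], h₄⟩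

theorem bits_injective : Function.Injective Nat.bits := by
  intro m n h
  apply Nat.digits.injective 2
  rw [Nat.digits_two_eq_bits, Nat.digits_two_eq_bits, h]

theorem isPrefixCode_natCode : IsPrefixCode natCode := by
  intro a b s t h
  have hb : IsPrefixCode (fun b : Bool => [b]) := by
    intro a b s t h
    simpa using h
  obtain ⟨h₁, h₂⟩ := isPrefixCode_listCode hb _ _ _ _ h
  exact ⟨bits_injective h₁, h₂⟩

theorem isPrefixCode_condCode : IsPrefixCode condCode := by
  intro a
  induction a with
  | eq x | ne x =>
    intro b s t h
    cases b <;> simp [condCode] at h ⊢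
    exact isPrefixCode_natCode _ _ _ _ h
  | and c₁ c₂ ih₁ ih₂ | or c₁ c₂ ih₁ ih₂ =>
    intro b s t h
    cases b <;> simp [condCode] at h ⊢
    obtain ⟨h₁, h₂⟩ := ih₁ _ _ _ h
    obtain ⟨h₃, h₄⟩ := ih₂ _ _ _ h₂
    exact ⟨⟨h₁, h₃⟩, h₄⟩
  | not c ih =>
    intro b s t h
    cases b <;> simp [condCode] at h ⊢
    exact ih _ _ _ h

theorem isPrefixCode_queryCode : IsPrefixCode queryCode := by
  intro a
  induction a with
  | eps =>
    intro b s t h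
    cases b <;> simp [queryCode] at h ⊢
    exact h
  | letter a =>
    intro b s t h
    cases b <;> simp [queryCode] at h ⊢
    exact isPrefixCode_natCode _ _ _ _ h
  | test a c =>
    intro b s t h
    cases b <;> simp [queryCode] at h ⊢
    obtain ⟨h₁, h₂⟩ := isPrefixCode_natCode _ _ _ _ h
    obtain ⟨h₃, h₄⟩ := isPrefixCode_condCode _ _ _ _ h₂
    exact ⟨⟨h₁, h₃⟩, h₄⟩
  | union c₁ c₂ ih₁ ih₂ | concat c₁ c₂ ih₁ ih₂ =>
    intro b s t h
    cases b <;> simp [queryCode] at h ⊢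
    obtain ⟨h₁, h₂⟩ := ih₁ _ _ _ h
    obtain ⟨h₃, h₄⟩ := ih₂ _ _ _ h₂
    exact ⟨⟨h₁, h₃⟩, h₄⟩
  | star c ih =>
    intro b s t h
    cases b <;> simp [queryCode] at h ⊢
    exact ih _ _ _ h
  | bind a x r ih =>
    intro b s t h
    cases b <;> simp [queryCode] at h ⊢
    obtain ⟨h₁, h₂⟩ := isPrefixCode_natCode _ _ _ _ h
    obtain ⟨h₃, h₄⟩ := isPrefixCode_natCode _ _ _ _ h₂
    obtain ⟨h₅, h₆⟩ := ih _ _ _ h₄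
    exact ⟨⟨h₁, h₃, h₅⟩, h₆⟩

/-! ### Parameterized problems and FPT reductions -/

/-- A parameterized problem. Its instances are pairs `(x, k)`, where the string `x` encodes an
input structure and `k` is the parameter; `Inst` is the type of these pairs, presented by the
structures that they encode. -/
structure ParamProblem where
  Inst : Type
  encode : Inst → List Bool
  param : Inst → ℕ
  encode_inj : Function.Injective fun I => (encode I, param I)
  yes : Set Inst

/-- What is written on the tape for the pair `(x, k)`, as input and as output. -/
def ParamProblem.tape (P : ParamProblem) (I : P.Inst) : List Bool :=
  unaryCode (P.param I) ++ P.encode I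

/-- The Turing machine `M` halts on input `s` with output `t` after at most `m` steps. -/
def OutputsWithin (M : Turing.TM2ComputableAux Bool Bool) (s t : List Bool) (m : ℕ) : Prop :=
  Nonempty (Turing.TM2OutputsInTime M.tm (s.map M.inputAlphabet.symm)
    (some (t.map M.outputAlphabet.symm)) m)

/-- `R` is an FPT reduction from `P` to `Q`. -/
structure IsFPTReduction (P Q : ParamProblem) (R : P.Inst → Q.Inst) : Prop where
  correct : ∀ I : P.Inst, I ∈ P.yes ↔ R I ∈ Q.yes
  param_le : ∃ g : ℕ → ℕ, Computable g ∧ ∀ I : P.Inst, Q.param (R I) ≤ g (P.param I)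
  computable : ∃ (M : Turing.TM2ComputableAux Bool Bool) (f : ℕ → ℕ) (c : ℕ), Computable f ∧
    ∀ I : P.Inst, OutputsWithin M (P.tape I) (Q.tape (R I))
      (f (P.param I) * (P.encode I).length ^ c)

def FPTReducible (P Q : ParamProblem) : Prop := ∃ R : P.Inst → Q.Inst, IsFPTReduction P Q R

/-! ### Boolean circuits, weighted circuit satisfiability and W[P] -/

/-- A gate; its arguments are indices of wires. -/
inductive Gate : Type
  | not (i : ℕ)
  | and (i j : ℕ)
  | or (i j : ℕ)

/-- All arguments of the gate are smaller than `b`. -/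
def Gate.ArgsBelow (b : ℕ) : Gate → Prop
  | .not i => i < b
  | .and i j => i < b ∧ j < b
  | .or i j => i < b ∧ j < b

/-- Value of a gate, given the values of the wires before it. -/
def Gate.eval (vals : List Bool) : Gate → Bool
  | .not i => !(vals.getD i false)
  | .and i j => vals.getD i false && vals.getD j false
  | .or i j => vals.getD i false || vals.getD j false

/-- A Boolean circuit whose gates are listed in a topological order. The wires `0, …, numInputs - 1`
are the inputs and wire `numInputs + i` is the value of the `i`-th gate. -/
structure Circuit where
  numInputs : ℕ
  gates : List Gate
  output : ℕ
  args_lt : ∀ (i : ℕ) (h : i < gates.length), gates[i].ArgsBelow (numInputs + i)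
  output_lt : output < numInputs + gates.length

/-- Extends the list of the values of the wires gate by gate. -/
def evalGates : List Gate → List Bool → List Bool
  | [], vals => vals
  | g :: gs, vals => evalGates gs (vals ++ [g.eval vals])

/-- Value of the circuit under a truth assignment to its inputs. -/
def Circuit.eval (C : Circuit) (a : Fin C.numInputs → Bool) : Bool :=
  (evalGates C.gates (List.ofFn a)).getD C.output false

/-- Number of inputs set to true. -/
def weight {n : ℕ} (a : Fin n → Bool) : ℕ := (Finset.univ.filter fun i => a i = true).card

def gateCode : Gate → List Bool
  | .not i => [false, false] ++ unaryCode i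
  | .and i j => [false, true] ++ (unaryCode i ++ unaryCode j)
  | .or i j => [true, false] ++ (unaryCode i ++ unaryCode j)

/-- Every wire contributes to the length of this code, so indices of wires in unary only give a
polynomial overhead. -/
def Circuit.code (C : Circuit) : List Bool :=
  unaryCode C.numInputs ++ (listCode gateCode C.gates ++ unaryCode C.output)

theorem isPrefixCode_gateCode : IsPrefixCode gateCode := by
  intro a b s t h
  cases a <;> cases b <;> simp [gateCode] at h ⊢
  · exact isPrefixCode_unaryCode _ _ _ _ h
  · obtain ⟨h₁, h₂⟩ := isPrefixCode_unaryCode _ _ _ _ h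
    obtain ⟨h₃, h₄⟩ := isPrefixCode_unaryCode _ _ _ _ h₂
    exact ⟨⟨h₁, h₃⟩, h₄⟩
  · obtain ⟨h₁, h₂⟩ := isPrefixCode_unaryCode _ _ _ _ h
    obtain ⟨h₃, h₄⟩ := isPrefixCode_unaryCode _ _ _ _ h₂
    exact ⟨⟨h₁, h₃⟩, h₄⟩

theorem Circuit.code_injective : Function.Injective Circuit.code := by
  rintro ⟨n, gs, o, _, _⟩ ⟨n', gs', o', _, _⟩ h
  simp only [Circuit.code] at h
  obtain ⟨h₁, h⟩ := isPrefixCode_unaryCode _ _ _ _ h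
  obtain ⟨h₂, h⟩ := isPrefixCode_listCode isPrefixCode_gateCode _ _ _ _ h
  obtain ⟨h₃, -⟩ := isPrefixCode_unaryCode o o' [] [] (by simpa using h)
  subst h₁ h₂ h₃
  rfl

/-- Parameterized weighted circuit satisfiability: given a circuit and the parameter `k`, is there a
satisfying assignment of weight exactly `k`? -/
def weightedCircuitSat : ParamProblem where
  Inst := Circuit × ℕ
  encode I := I.1.code
  param I := I.2
  encode_inj := by
    rintro ⟨C, k⟩ ⟨C', k'⟩ h
    simp only [Prod.mk.injEq] at h
    rw [Circuit.code_injective h.1, h.2]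
  yes := {I | ∃ a : Fin I.1.numInputs → Bool, weight a = I.2 ∧ I.1.eval a = true}

/-- The class W[P]: the parameterized problems that are FPT-reducible to weighted circuit
satisfiability. -/
def WP : Set ParamProblem := {P | FPTReducible P weightedCircuitSat}

/-! ### The evaluation problem for queries in `E_i` -/

/-- An instance of the evaluation problem for queries in `E_i`. Letters, variables and data values
are natural numbers (only finitely many occur in an instance), and the vertices are `0, …, numVertices - 1`. The edges and the
partial valuation are given by lists. -/
structure EvalInstance (i : ℕ) where
  numVertices : ℕ
  edges : List (Fin numVertices × ℕ × ℕ × Fin numVertices)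
  query : REWB ℕ ℕ
  query_level : IsE i query
  valuation : List (ℕ × ℕ)
  compatible : Compatible query (fun x => valuation.lookup x)
  source : Fin numVertices
  target : Fin numVertices

def EvalInstance.graph {i : ℕ} (I : EvalInstance i) : DataGraph (Fin I.numVertices) ℕ ℕ where
  edges := {e | e ∈ I.edges}
  finite := List.finite_toSet I.edges

def edgeCode {n : ℕ} (e : Fin n × ℕ × ℕ × Fin n) : List Bool :=
  unaryCode e.1 ++ (natCode e.2.1 ++ (natCode e.2.2.1 ++ unaryCode e.2.2.2))

def bindingCode (p : ℕ × ℕ) : List Bool := natCode p.1 ++ natCode p.2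

/-- Letters, variables and data values are written in binary. The vertices are listed by a unary
numeral, so the indices of vertices in unary only give a polynomial overhead. -/
def EvalInstance.code {i : ℕ} (I : EvalInstance i) : List Bool :=
  unaryCode I.numVertices ++ (listCode edgeCode I.edges ++ (queryCode I.query ++
    (listCode bindingCode I.valuation ++ (unaryCode I.source ++ unaryCode I.target))))

theorem isPrefixCode_edgeCode {n : ℕ} : IsPrefixCode (edgeCode (n := n)) := by
  rintro ⟨u, a, d, v⟩ ⟨u', a', d', v'⟩ s t h
  simp only [edgeCode, List.append_assoc] at h
  obtain ⟨h₁, h⟩ := isPrefixCode_unaryCode _ _ _ _ h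
  obtain ⟨h₂, h⟩ := isPrefixCode_natCode _ _ _ _ h
  obtain ⟨h₃, h⟩ := isPrefixCode_natCode _ _ _ _ h
  obtain ⟨h₄, h⟩ := isPrefixCode_unaryCode _ _ _ _ h
  exact ⟨by rw [Fin.ext h₁, h₂, h₃, Fin.ext h₄], h⟩

theorem isPrefixCode_bindingCode : IsPrefixCode bindingCode := by
  rintro ⟨x, d⟩ ⟨x', d'⟩ s t h
  simp only [bindingCode, List.append_assoc] at h
  obtain ⟨h₁, h⟩ := isPrefixCode_natCode _ _ _ _ h
  obtain ⟨h₂, h⟩ := isPrefixCode_natCode _ _ _ _ h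
  exact ⟨by rw [h₁, h₂], h⟩

theorem EvalInstance.code_injective {i : ℕ} :
    Function.Injective (EvalInstance.code (i := i)) := by
  rintro ⟨n, es, e, _, ν, _, u, v⟩ ⟨n', es', e', _, ν', _, u', v'⟩ h
  simp only [EvalInstance.code] at h
  obtain ⟨h₁, h⟩ := isPrefixCode_unaryCode _ _ _ _ h
  subst h₁
  obtain ⟨h₂, h⟩ := isPrefixCode_listCode isPrefixCode_edgeCode _ _ _ _ h
  obtain ⟨h₃, h⟩ := isPrefixCode_queryCode _ _ _ _ h
  obtain ⟨h₄, h⟩ := isPrefixCode_listCode isPrefixCode_bindingCode _ _ _ _ h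
  obtain ⟨h₅, h⟩ := isPrefixCode_unaryCode _ _ _ _ h
  obtain ⟨h₆, -⟩ := isPrefixCode_unaryCode v v' [] [] (by simpa using h)
  have h₇ := Fin.ext h₅
  have h₈ := Fin.ext h₆
  subst h₂ h₃ h₄ h₇ h₈
  rfl

/-- Evaluation of queries in `E_i`, parameterized by the size of the query: given a data graph `G`,
an expression `e` in `E_i`, a compatible valuation `ν` and nodes `u`, `v`, is `u` connected to `v`
by a data path in `L(e, ν)`? -/
def evalProblem (i : ℕ) : ParamProblem where
  Inst := EvalInstance i
  encode I := I.code
  param I := I.query.size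
  encode_inj := by
    intro I J h
    simp only [Prod.mk.injEq] at h
    exact EvalInstance.code_injective h.1
  yes := {I | (I.source, I.target) ∈ I.graph.eval I.query (fun x => I.valuation.lookup x)}

end DataQuery

/-! ### Structured programs on four binary stacks -/

-- The reduction maps an expression of size `k` to a circuit together with the same parameter `k`,
-- and it is computable even in polynomial time.
--
-- In an expression of `E_1` no binding operator lies below a star. Hence each binding operator is
-- used at most once in the derivation of a word, and the data value that it stores can be guessed
-- in advance (`exists_guess`). A value that is really stored occurs in the word, so it occurs on an
-- edge of the graph. A guess is therefore a choice, for each of the `k` symbols of the expression,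
-- of an index in the list of edges; index `0`, held by a fictitious edge into the source vertex,
-- stands for "no value". With `m` indices these are `k` rows of `m` Boolean inputs. The circuit
-- checks that every row contains a true input; weight exactly `k` then forces exactly one true
-- input in each row and makes all other inputs false (`exists_weight_iff`).
--
-- Once the guess is fixed, `a↓x(r)` reads an `a` and compares its value with the guessed one, and
-- every literal compares the last value read with a fixed one. The expression becomes a finite
-- automaton with at most `2k + 2` states (`queryTrans`): negations are pushed down to literals,
-- conjunctions become serial and disjunctions parallel. A configuration consists of a state and the
-- index of the edge read last. That an accepting word yields a run follows by induction on the
-- expression. For the converse, each state is given a set of words that may still be read from it;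
-- these sets are built by recursion on the expression, and a run is followed backwards through
-- them. Both directions meet in `exists_run_iff`.
--
-- The query thus holds iff some guess makes a final configuration reachable in a graph on `(2k +
-- 2)m` nodes whose arcs are governed by the guessed inputs. Reachability is computed by rounds of
-- relaxation, written as a straight-line program over Boolean registers (`run_rounds_eq_true_iff`);
-- such a program unfolds into a circuit with one layer of gates for each instruction
-- (`eval_progCircuit`).
--
-- To bound the running time on a Turing machine, a small functional language on binary trees, with
-- folds as its only loops, is compiled to programs on four stacks and these to stack machines.
-- Closure properties of the class `PolyFun` then reduce the claim to writing the reduction,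
-- including the parsing of its input, with list operations (`poly_tapeReduction`).

namespace StackProg

open Function

/-- Programs on the stacks `0, 1, 2, 3`. `loop k c p` pops the stack `k`; if it was empty the loop
ends, and if the symbol `b` was popped, then `p b` is run, and the loop continues iff `c b`. -/
inductive Prog : Type
  | skip
  | push (k : Fin 4) (b : Bool)
  | seq (p q : Prog)
  | loop (k : Fin 4) (c : Bool → Bool) (p : Bool → Prog)

abbrev Store := Fin 4 → List Bool

/-- `Run p s s' t`: the program `p` leads from the store `s` to the store `s'` in at most `t`
steps. -/
inductive Run : Prog → Store → Store → ℕ → Prop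
  | skip {s t} : 1 ≤ t → Run .skip s s t
  | push {k b s t} : 1 ≤ t → Run (.push k b) s (update s k (b :: s k)) t
  | seq {p q s s₁ s₂ t₁ t₂ t} : Run p s s₁ t₁ → Run q s₁ s₂ t₂ → t₁ + t₂ ≤ t →
      Run (.seq p q) s s₂ t
  | loop_nil {k c p s t} : s k = [] → 1 ≤ t → Run (.loop k c p) s s t
  | loop_exit {k c p s s₁ b l t₁ t} : s k = b :: l → c b = false →
      Run (p b) (update s k l) s₁ t₁ → t₁ + 1 ≤ t → Run (.loop k c p) s s₁ t
  | loop_cont {k c p s s₁ s₂ b l t₁ t₂ t} : s k = b :: l → c b = true →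
      Run (p b) (update s k l) s₁ t₁ → Run (.loop k c p) s₁ s₂ t₂ → t₁ + t₂ + 1 ≤ t →
      Run (.loop k c p) s s₂ t

theorem Run.mono {p : Prog} {s s' : Store} {t t' : ℕ} (h : Run p s s' t) (ht : t ≤ t') :
    Run p s s' t' := by
  cases h with
  | skip h => exact .skip (h.trans ht)
  | push h => exact .push (h.trans ht)
  | seq h₁ h₂ h => exact .seq h₁ h₂ (h.trans ht)
  | loop_nil h₁ h => exact .loop_nil h₁ (h.trans ht)
  | loop_exit h₁ h₂ h₃ h => exact .loop_exit h₁ h₂ h₃ (h.trans ht)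
  | loop_cont h₁ h₂ h₃ h₄ h => exact .loop_cont h₁ h₂ h₃ h₄ (h.trans ht)

/-! ### Compilation to Turing machines -/

/-- The labels of the machine for a program. -/
inductive Lab : Prog → Type
  | skip : Lab .skip
  | push (k : Fin 4) (b : Bool) : Lab (.push k b)
  | inl {p q : Prog} (l : Lab p) : Lab (.seq p q)
  | inr {p q : Prog} (l : Lab q) : Lab (.seq p q)
  | head {k : Fin 4} {c : Bool → Bool} {p : Bool → Prog} : Lab (.loop k c p)
  | body {k : Fin 4} {c : Bool → Bool} {p : Bool → Prog} (b : Bool) (l : Lab (p b)) :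
      Lab (.loop k c p)

theorem finite_lab (p : Prog) : Finite (Lab p) := by
  induction p with
  | skip => exact Finite.of_surjective (fun _ : Unit => Lab.skip) fun l => by cases l; simp
  | push k b =>
    exact Finite.of_surjective (fun _ : Unit => Lab.push k b) fun l => by cases l; simp
  | seq p q ihp ihq =>
    refine Finite.of_surjective (fun l : Lab p ⊕ Lab q => l.elim Lab.inl Lab.inr) fun l => ?_
    cases l with
    | inl l => exact ⟨Sum.inl l, rfl⟩
    | inr l => exact ⟨Sum.inr l, rfl⟩
  | loop k c p ih =>
    refine Finite.of_surjective (fun l : Option (Σ b, Lab (p b)) =>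
      (l.elim Lab.head fun l => Lab.body l.1 l.2 : Lab (.loop k c p))) fun l => ?_
    cases l with
    | head => exact ⟨none, rfl⟩
    | body b l => exact ⟨some ⟨b, l⟩, rfl⟩

def entry : (p : Prog) → Lab p
  | .skip => .skip
  | .push k b => .push k b
  | .seq p _ => .inl (entry p)
  | .loop _ _ _ => .head

abbrev TMStmt (Λ : Type) := Turing.TM2.Stmt (fun _ : Fin 4 => Bool) Λ (Option Bool)

/-- The statement at a label; `emb` embeds the labels into those of the whole machine, and `exit` is
the label to continue with. -/
def stmt {Λ : Type} : {p : Prog} → (Lab p → Λ) → Λ → Lab p → TMStmt Λ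
  | _, _, exit, .skip => .goto fun _ => exit
  | _, _, exit, .push k b => .push k (fun _ => b) (.goto fun _ => exit)
  | .seq _ q, emb, _, .inl l => stmt (fun l => emb (.inl l)) (emb (.inr (entry q))) l
  | _, emb, exit, .inr l => stmt (fun l => emb (.inr l)) exit l
  | .loop k _ p, emb, exit, .head => .pop k (fun _ o => o) (.goto fun v =>
      v.elim exit fun b => emb (.body b (entry (p b))))
  | .loop _ c _, emb, exit, .body b l =>
      stmt (fun l => emb (.body b l)) (if c b then emb .head else exit) l

/-- `m` steps lead from the label `l` and the store `s` to the label `l'` and the store `s'`. -/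
def Leads {Λ : Type} (M : Λ → TMStmt Λ) (l : Λ) (s : Store) (l' : Λ) (s' : Store) (t : ℕ) : Prop :=
  ∃ m ≤ t, ∀ v, ∃ v', (flip bind (Turing.TM2.step M))^[m] (some ⟨some l, v, s⟩) =
    some ⟨some l', v', s'⟩

theorem Leads.trans {Λ : Type} {M : Λ → TMStmt Λ} {l₁ l₂ l₃ : Λ} {s₁ s₂ s₃ : Store} {t₁ t₂ t : ℕ}
    (h₁ : Leads M l₁ s₁ l₂ s₂ t₁) (h₂ : Leads M l₂ s₂ l₃ s₃ t₂) (ht : t₁ + t₂ ≤ t) :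
    Leads M l₁ s₁ l₃ s₃ t := by
  obtain ⟨m₁, hm₁, h₁⟩ := h₁
  obtain ⟨m₂, hm₂, h₂⟩ := h₂
  refine ⟨m₂ + m₁, by omega, fun v => ?_⟩
  obtain ⟨v', hv'⟩ := h₁ v
  obtain ⟨v'', hv''⟩ := h₂ v'
  exact ⟨v'', by rw [Function.iterate_add_apply, hv', hv'']⟩

theorem Leads.single {Λ : Type} {M : Λ → TMStmt Λ} {l l' : Λ} {s s' : Store} {t : ℕ} (ht : 1 ≤ t)
    (h : ∀ v, ∃ v', Turing.TM2.stepAux (M l) v s = ⟨some l', v', s'⟩) : Leads M l s l' s' t :=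
  ⟨1, ht, fun v => by
    obtain ⟨v', hv'⟩ := h v
    exact ⟨v', by simp [flip, hv']⟩⟩

/-- Induction on the run. As `emb` and `exit` are arbitrary, the induction hypotheses apply to the
block of labels of a subprogram inside the whole machine. The internal variable may be anything on
entry, since it is only read right after a pop has set it. -/
theorem leads_of_run {Λ : Type} (M : Λ → TMStmt Λ) {p : Prog} {s s' : Store} {t : ℕ}
    (h : Run p s s' t) : ∀ (emb : Lab p → Λ) (exit : Λ),
      (∀ l, M (emb l) = stmt emb exit l) → Leads M (emb (entry p)) s exit s' t := by
  induction h with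
  | skip ht =>
    intro emb exit h
    refine Leads.single ht fun v => ⟨v, ?_⟩
    rw [entry, h]
    rfl
  | push ht =>
    intro emb exit h
    refine Leads.single ht fun v => ⟨v, ?_⟩
    rw [entry, h]
    rfl
  | @seq p q _ _ _ _ _ _ _ _ ht ih₁ ih₂ =>
    intro emb exit h
    exact (ih₁ (fun l => emb (Lab.inl l)) (emb (Lab.inr (entry q))) fun l => h (Lab.inl l)).trans
      (ih₂ (fun l => emb (Lab.inr l)) exit fun l => h (Lab.inr l)) ht
  | loop_nil hk ht =>
    intro emb exit h
    refine Leads.single ht fun v => ⟨none, ?_⟩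
    rw [entry, h]
    simp [stmt, hk]
  | @loop_exit k c p s s₁ b l t₁ t hk hc _ ht ih =>
    intro emb exit h
    have h₁ : Leads M (emb .head) s (emb (.body b (entry (p b)))) (update s k l) 1 := by
      refine Leads.single le_rfl fun v => ⟨some b, ?_⟩
      rw [h]
      simp [stmt, hk]
    refine h₁.trans (ih (fun l => emb (.body b l)) exit fun l => ?_) (by omega)
    rw [h]
    simp [stmt, hc]
  | @loop_cont k c p s s₁ s₂ b l t₁ t₂ t hk hc _ _ ht ih₁ ih₂ =>
    intro emb exit h
    have h₁ : Leads M (emb .head) s (emb (.body b (entry (p b)))) (update s k l) 1 := by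
      refine Leads.single le_rfl fun v => ⟨some b, ?_⟩
      rw [h]
      simp [stmt, hk]
    refine (h₁.trans (ih₁ (fun l => emb (.body b l)) (emb .head) fun l => ?_) le_rfl).trans
      (ih₂ emb exit h) (by omega)
    rw [h]
    simp [stmt, hc]

attribute [local instance] finite_lab in
/-- The Turing machine for a program, with stack `0` for input and output. -/
noncomputable def machine (p : Prog) : Turing.TM2ComputableAux Bool Bool where
  tm :=
    letI := Fintype.ofFinite (Lab p)
    { K := Fin 4
      k₀ := 0
      k₁ := 0
      Γ := fun _ => Bool
      Λ := Option (Lab p)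
      main := some (entry p)
      σ := Option Bool
      initialState := none
      m := fun l =>
        match l with
        -- A halting configuration counts as output only if the internal variable has its initial
        -- value again.
        | none => .load (fun _ => none) .halt
        | some l => stmt some none l }
  inputAlphabet := Equiv.refl _
  outputAlphabet := Equiv.refl _

/-- The store with the given stacks. -/
def st (m a b c : List Bool) : Store := ![m, a, b, c]

/-- One step is added for the halting label. The auxiliary stacks have to be empty at the end,
because the output convention fixes the contents of all stacks. -/
theorem outputsWithin_machine {p : Prog} {s s' : List Bool} {t : ℕ}
    (h : Run p (st s [] [] []) (st s' [] [] []) t) :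
    DataQuery.OutputsWithin (machine p) s s' (t + 1) := by
  obtain ⟨m, hm, h⟩ := leads_of_run (machine p).tm.m h some none (fun l => rfl)
  obtain ⟨v, hv⟩ := h none
  have h₀ : Turing.initList (machine p).tm (s.map (machine p).inputAlphabet.symm) =
      ⟨some (some (entry p)), none, st s [] [] []⟩ := by
    have h₁ : s.map (machine p).inputAlphabet.symm = s := by
      change s.map id = s
      simp
    rw [h₁]
    change Turing.TM2.Cfg.mk _ _ _ = _
    congr 1
    funext (k : Fin 4)
    fin_cases k <;> rfl
  have h₂ : Turing.haltList (machine p).tm (s'.map (machine p).outputAlphabet.symm) =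
      ⟨none, none, st s' [] [] []⟩ := by
    have h₁ : s'.map (machine p).outputAlphabet.symm = s' := by
      change s'.map id = s'
      simp
    rw [h₁]
    change Turing.TM2.Cfg.mk _ _ _ = _
    congr 1
    funext (k : Fin 4)
    fin_cases k <;> rfl
  refine ⟨⟨⟨m + 1, ?_⟩, Nat.succ_le_succ hm⟩⟩
  rw [h₀, Function.iterate_succ_apply', Option.map_some, h₂]
  have h₃ : (flip bind (machine p).tm.step)^[m] (some ⟨some (some (entry p)), none, st s [] [] []⟩)
      = some ⟨some none, v, st s' [] [] []⟩ := hv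
  rw [h₃]
  rfl

end StackProg

namespace StackProg

open Function

/-! ### Scanning values -/

@[simp] theorem st_zero (m a b c : List Bool) : st m a b c 0 = m := rfl
@[simp] theorem st_one (m a b c : List Bool) : st m a b c 1 = a := rfl
@[simp] theorem st_two (m a b c : List Bool) : st m a b c 2 = b := rfl
@[simp] theorem st_three (m a b c : List Bool) : st m a b c 3 = c := rfl

@[simp] theorem update_st_zero (m a b c x : List Bool) : update (st m a b c) 0 x = st x a b c := by
  funext k; fin_cases k <;> rfl
@[simp] theorem update_st_one (m a b c x : List Bool) : update (st m a b c) 1 x = st m x b c := by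
  funext k; fin_cases k <;> rfl
@[simp] theorem update_st_two (m a b c x : List Bool) : update (st m a b c) 2 x = st m a x c := by
  funext k; fin_cases k <;> rfl
@[simp] theorem update_st_three (m a b c x : List Bool) :
    update (st m a b c) 3 x = st m a b x := by
  funext k; fin_cases k <;> rfl

/-- Binary trees, the values of the functional language below. -/
inductive V : Type
  | leaf
  | node (x y : V)

/-- Prefix notation of a tree. -/
def V.ser : V → List Bool
  | .leaf => [false]
  | .node x y => true :: (x.ser ++ y.ser)

def V.size : V → ℕ
  | .leaf => 1
  | .node x y => x.size + y.size + 1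

theorem V.one_le_size (x : V) : 1 ≤ x.size := by
  cases x <;> simp [V.size]

namespace Prog

def pushIf (c : Bool) (k : Fin 4) (b : Bool) : Prog := if c then .push k b else .skip

/-- Removes the topmost value of the main stack and pushes its reversed code on the stack `1` if
`ca`, and on the stack `2` if `cb`. -/
def scan (ca cb : Bool) : Prog :=
  -- Stack `3` is a unary counter of the subtrees that are still to be read: each symbol removes
  -- one, and the symbol of an inner node adds two. A loop with constant condition `false` pops at
  -- most one symbol.
  .seq (.push 3 true) (.loop 3 (fun _ => true) fun _ => .loop 0 (fun _ => false) fun b =>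
    .seq (pushIf ca 1 b) (.seq (pushIf cb 2 b) (.seq (pushIf b 3 true) (pushIf b 3 true))))

/-- Moves the stack `k` to the main stack. -/
def restore (k : Fin 4) : Prog := .loop k (fun _ => true) fun b => .push 0 b

def drop : Prog := scan false false
def dup : Prog := .seq (scan true true) (.seq (restore 1) (restore 2))
def swap : Prog := .seq (scan true false) (.seq (scan false true) (.seq (restore 1) (restore 2)))

end Prog

open Prog

theorem run_pushIf_one (c b : Bool) (m x y z : List Bool) :
    Run (pushIf c 1 b) (st m x y z) (st m (if c then b :: x else x) y z) 1 := by
  cases c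
  · exact .skip le_rfl
  · simpa [pushIf] using Run.push (k := 1) (b := b) (s := st m x y z) (le_refl 1)

theorem run_pushIf_two (c b : Bool) (m x y z : List Bool) :
    Run (pushIf c 2 b) (st m x y z) (st m x (if c then b :: y else y) z) 1 := by
  cases c
  · exact .skip le_rfl
  · simpa [pushIf] using Run.push (k := 2) (b := b) (s := st m x y z) (le_refl 1)

theorem run_pushIf_three (c b : Bool) (m x y z : List Bool) :
    Run (pushIf c 3 b) (st m x y z) (st m x y (if c then b :: z else z)) 1 := by
  cases c
  · exact .skip le_rfl
  · simpa [pushIf] using Run.push (k := 3) (b := b) (s := st m x y z) (le_refl 1)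

theorem run_push_zero (b : Bool) (m x y z : List Bool) :
    Run (.push 0 b) (st m x y z) (st (b :: m) x y z) 1 := by
  simpa using Run.push (k := 0) (b := b) (s := st m x y z) (le_refl 1)

theorem run_scan_symbol (ca cb b : Bool) (m x y z : List Bool) :
    Run (.loop 0 (fun _ => false) fun b =>
      .seq (pushIf ca 1 b) (.seq (pushIf cb 2 b) (.seq (pushIf b 3 true) (pushIf b 3 true))))
      (st (b :: m) x y z)
      (st m (if ca then b :: x else x) (if cb then b :: y else y)
        (if b then true :: true :: z else z)) 5 := by
  refine Run.loop_exit (b := b) (l := m) rfl rfl (t₁ := 4) ?_ (by omega)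
  rw [update_st_zero]
  have h := (run_pushIf_one ca b m x y z).seq ((run_pushIf_two cb b ..).seq
    ((run_pushIf_three b true ..).seq (run_pushIf_three b true ..) le_rfl) le_rfl) le_rfl
  cases b <;> exact h

/-- Stated with a continuation: any run from the store in which `v` has been scanned is prolonged
backwards to one in which `v` is still to be read. For an inner node the two induction hypotheses
can then be chained. -/
theorem run_scan_loop (ca cb : Bool) (v : V) : ∀ (m x y z s) (t : ℕ),
    Run (.loop 3 (fun _ => true) fun _ => .loop 0 (fun _ => false) fun b =>
      .seq (pushIf ca 1 b) (.seq (pushIf cb 2 b) (.seq (pushIf b 3 true) (pushIf b 3 true))))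
      (st m (if ca then v.ser.reverse ++ x else x) (if cb then v.ser.reverse ++ y else y) z) s t →
    Run (.loop 3 (fun _ => true) fun _ => .loop 0 (fun _ => false) fun b =>
      .seq (pushIf ca 1 b) (.seq (pushIf cb 2 b) (.seq (pushIf b 3 true) (pushIf b 3 true))))
      (st (v.ser ++ m) x y (true :: z)) s (t + 6 * v.size) := by
  induction v with
  | leaf =>
    intro m x y z s t h
    refine Run.loop_cont (b := true) (l := z) rfl rfl (by
      rw [update_st_three]; exact run_scan_symbol ca cb false m x y z) (t₂ := t) ?_
      (by simp [V.size]; omega)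
    simpa [V.ser] using h
  | node v w ihv ihw =>
    intro m x y z s t h
    refine Run.loop_cont (b := true) (l := z) rfl rfl (by
      rw [update_st_three]; exact run_scan_symbol ca cb true _ x y z)
      (t₂ := t + 6 * w.size + 6 * v.size) ?_ (by simp [V.size]; omega)
    have h₁ := ihv (w.ser ++ m) (if ca then true :: x else x) (if cb then true :: y else y)
      (true :: z) _ _ (ihw _ _ _ _ s t ?_)
    · simpa using h₁
    · convert h using 2
      · cases ca <;> simp [V.ser]
      · cases cb <;> simp [V.ser]

theorem run_scan (ca cb : Bool) (v : V) (m x y : List Bool) :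
    Run (scan ca cb) (st (v.ser ++ m) x y [])
      (st m (if ca then v.ser.reverse ++ x else x) (if cb then v.ser.reverse ++ y else y) [])
      (6 * v.size + 2) := by
  refine Run.seq (t₁ := 1) (t₂ := 1 + 6 * v.size) (Run.push le_rfl) ?_ (by omega)
  simp only [update_st_three, st_three]
  exact run_scan_loop ca cb v m x y [] _ 1 (.loop_nil rfl le_rfl)

theorem run_restore_one (l m x y : List Bool) :
    Run (restore 1) (st m l x y) (st (l.reverse ++ m) [] x y) (2 * l.length + 1) := by
  induction l generalizing m with
  | nil => exact .loop_nil rfl le_rfl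
  | cons b l ih =>
    have h := ih (b :: m)
    refine Run.loop_cont (b := b) (l := l) rfl rfl (by
      rw [update_st_one]; exact run_push_zero ..) (t₂ := 2 * l.length + 1) ?_ (by simp; omega)
    simpa [restore] using h

theorem run_restore_two (l m x y : List Bool) :
    Run (restore 2) (st m x l y) (st (l.reverse ++ m) x [] y) (2 * l.length + 1) := by
  induction l generalizing m with
  | nil => exact .loop_nil rfl le_rfl
  | cons b l ih =>
    have h := ih (b :: m)
    refine Run.loop_cont (b := b) (l := l) rfl rfl (by
      rw [update_st_two]; exact run_push_zero ..) (t₂ := 2 * l.length + 1) ?_ (by simp; omega)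
    simpa [restore] using h

theorem V.length_ser (v : V) : v.ser.length = v.size := by
  induction v with
  | leaf => rfl
  | node x y ihx ihy => simp [V.ser, V.size, ihx, ihy]

theorem run_restore_value_one (v : V) (m x : List Bool) :
    Run (restore 1) (st m v.ser.reverse x []) (st (v.ser ++ m) [] x []) (2 * v.size + 1) := by
  simpa [V.length_ser] using run_restore_one v.ser.reverse m x []

theorem run_restore_value_two (v : V) (m x : List Bool) :
    Run (restore 2) (st m x v.ser.reverse []) (st (v.ser ++ m) x [] []) (2 * v.size + 1) := by
  simpa [V.length_ser] using run_restore_two v.ser.reverse m x []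

/-- The store with main stack `m`, the other stacks being empty. -/
def ms (m : List Bool) : Store := st m [] [] []

theorem run_push (b : Bool) (m : List Bool) : Run (.push 0 b) (ms m) (ms (b :: m)) 1 :=
  run_push_zero ..

theorem run_drop (v : V) (m : List Bool) : Run drop (ms (v.ser ++ m)) (ms m) (6 * v.size + 2) := by
  have h := run_scan false false v m [] []
  exact h

theorem run_dup (v : V) (m : List Bool) :
    Run dup (ms (v.ser ++ m)) (ms (v.ser ++ (v.ser ++ m))) (10 * v.size + 4) := by
  have h := run_scan true true v m [] []
  simp only [if_true, List.append_nil] at h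
  exact h.seq ((run_restore_value_one ..).seq (run_restore_value_two ..) le_rfl) (by omega)

theorem run_swap (v w : V) (m : List Bool) :
    Run swap (ms (v.ser ++ (w.ser ++ m))) (ms (w.ser ++ (v.ser ++ m)))
      (8 * v.size + 8 * w.size + 6) := by
  have h := run_scan true false v (w.ser ++ m) [] []
  have h' := run_scan false true w m v.ser.reverse []
  simp only [if_true, List.append_nil, Bool.false_eq_true, if_false] at h h'
  exact h.seq (h'.seq ((run_restore_value_one ..).seq (run_restore_value_two ..) le_rfl) le_rfl)
    (by omega)

/-- Pops a symbol of the main stack and continues accordingly. -/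
def onPop (p q : Prog) : Prog := .loop 0 (fun _ => false) fun b => if b then q else p

theorem run_onPop_false {p q : Prog} {m : List Bool} {s : Store} {t : ℕ} (h : Run p (ms m) s t) :
    Run (onPop p q) (ms (false :: m)) s (t + 1) := by
  refine Run.loop_exit (b := false) (l := m) rfl rfl (t₁ := t) ?_ le_rfl
  simpa [ms] using h

theorem run_onPop_true {p q : Prog} {m : List Bool} {s : Store} {t : ℕ} (h : Run q (ms m) s t) :
    Run (onPop p q) (ms (true :: m)) s (t + 1) := by
  refine Run.loop_exit (b := true) (l := m) rfl rfl (t₁ := t) ?_ le_rfl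
  simpa [ms] using h

/-! ### A functional language on trees -/

/-- The only loop is a fold over a list that is given beforehand, so evaluation and cost are defined
by structural recursion and every program terminates. The case distinction `cnd` looks at whether
the first component is a leaf, which serves for Booleans as well as for empty lists. -/
inductive Code : Type
  | id
  | leaf
  | fst
  | snd
  | pair (f g : Code)
  | comp (f g : Code)
  | cnd (f g : Code)
  | fold (f : Code)

/-- Left fold over a list, coded by a tree. -/
def V.foldl (f : V → V) : V → V → V
  | .leaf, s => s
  | .node a l, s => V.foldl f l (f (.node a s))

def V.fst : V → V
  | .leaf => .leaf
  | .node x _ => x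

def V.snd : V → V
  | .leaf => .leaf
  | .node _ y => y

namespace Code

def eval : Code → V → V
  | .id, x => x
  | .leaf, _ => .leaf
  | .fst, x => x.fst
  | .snd, x => x.snd
  | .pair f g, x => .node (f.eval x) (g.eval x)
  | .comp f g, x => f.eval (g.eval x)
  | .cnd _ _, .leaf => .leaf
  | .cnd f _, .node .leaf y => f.eval y
  | .cnd _ g, .node (.node _ _) y => g.eval y
  | .fold _, .leaf => .leaf
  | .fold f, .node l s => V.foldl f.eval l s

/-- Cost of a fold whose body costs `c`. -/
def foldCost (f : V → V) (c : V → ℕ) : V → V → ℕ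
  | .leaf, _ => 1
  | .node a l, s => c (.node a s) + 40 * (a.size + l.size + s.size + (f (.node a s)).size) +
      foldCost f c l (f (.node a s))

/-- The constants are generous, so that one quantity dominates the running time of the compiled
program and also the growth in size of the value. -/
def cost : Code → V → ℕ
  | .id, _ => 1
  | .leaf, x => 10 * x.size
  | .fst, x => 20 * x.size
  | .snd, x => 20 * x.size
  | .pair f g, x => f.cost x + g.cost x +
      40 * (x.size + (f.eval x).size + (g.eval x).size)
  | .comp f g, x => f.cost (g.eval x) + g.cost x
  | .cnd _ _, .leaf => 10
  | .cnd f _, .node .leaf y => f.cost y + 10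
  | .cnd _ g, .node (.node a b) y => g.cost y + 20 * (a.size + b.size)
  | .fold _, .leaf => 10
  | .fold f, .node l s => foldCost f.eval f.cost l s + 10

theorem size_foldl_le {f : V → V} {c : V → ℕ} (l s : V) :
    (V.foldl f l s).size ≤ s.size + foldCost f c l s := by
  induction l generalizing s with
  | leaf => simp [V.foldl, foldCost]
  | node a l _ ih =>
    have := ih (f (.node a s))
    simp only [V.foldl, foldCost]
    omega

/-- A value cannot grow by more than the time spent on it. This bounds the length of the output and
the size of intermediate results in compositions. -/
theorem size_eval_le (c : Code) (x : V) : (c.eval x).size ≤ x.size + c.cost x := by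
  induction c generalizing x with
  | id => simp [eval]
  | leaf => simp only [eval, V.size, cost]; have := x.one_le_size; omega
  | fst => cases x <;> simp [eval, V.fst, V.size]; omega
  | snd => cases x <;> simp [eval, V.snd, V.size]; omega
  | pair f g => simp only [eval, V.size, cost]; have := x.one_le_size; omega
  | comp f g ihf ihg =>
    have := ihf (g.eval x)
    have := ihg x
    simp only [eval, cost]
    omega
  | cnd f g ihf ihg =>
    rcases x with _ | ⟨_ | _, y⟩
    · simp [eval]
    · have := ihf y
      simp only [eval, cost, V.size]
      omega
    · have := ihg y
      simp only [eval, cost, V.size]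
      omega
  | fold f =>
    rcases x with _ | ⟨l, s⟩
    · simp [eval]
    · have := size_foldl_le (f := f.eval) (c := f.cost) l s
      simp only [eval, cost, V.size]
      omega

def prog : Code → Prog
  | .id => .skip
  | .leaf => .seq drop (.push 0 false)
  | .fst => onPop (.push 0 false) (.seq (scan true false) (.seq drop (restore 1)))
  | .snd => onPop (.push 0 false) drop
  | .pair f g => .seq dup (.seq f.prog (.seq swap (.seq g.prog (.seq swap (.push 0 true)))))
  | .comp f g => .seq g.prog f.prog
  | .cnd f g => onPop (.push 0 false) (onPop f.prog (.seq drop (.seq drop g.prog)))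
  -- The list lies above the accumulator. Each pass pops the list's head symbol; if it is a cons,
  -- the item is joined to the accumulator below the rest of the list, this node is moved to the
  -- top, and after `f` the rest of the list is brought back on top.
  | .fold f => onPop (.push 0 false) (.loop 0 (fun b => b) fun b =>
      if b then .seq swap (.seq (scan true false) (.seq (.push 0 true) (.seq (scan false true)
        (.seq (restore 1) (.seq (restore 2) (.seq f.prog swap))))))
      else .skip)

theorem run_foldBody {p : Prog} {a l s s' : V} {m : List Bool} {t : ℕ}
    (h : ∀ m, Run p (ms ((V.node a s).ser ++ m)) (ms (s'.ser ++ m)) t) :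
    Run (.seq swap (.seq (scan true false) (.seq (.push 0 true) (.seq (scan false true)
        (.seq (restore 1) (.seq (restore 2) (.seq p swap)))))))
      (ms (a.ser ++ (l.ser ++ (s.ser ++ m)))) (ms (l.ser ++ (s'.ser ++ m)))
      (t + 24 * (a.size + l.size + s.size + s'.size) + 40) := by
  have h₁ := run_swap a l (s.ser ++ m)
  have h₂ := run_scan true false l (a.ser ++ (s.ser ++ m)) [] []
  have h₃ := run_push_zero true (a.ser ++ (s.ser ++ m)) l.ser.reverse [] []
  have h₄ := run_scan false true (.node a s) m l.ser.reverse []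
  have h₅ := run_restore_value_one l m (V.node a s).ser.reverse
  have h₆ := run_restore_value_two (.node a s) (l.ser ++ m) []
  have h₈ := run_swap s' l m
  simp only [if_true, List.append_nil, Bool.false_eq_true, if_false] at h₂ h₄
  simp only [V.ser, V.size, List.cons_append, List.append_assoc] at h₄
  refine h₁.seq (h₂.seq (h₃.seq (h₄.seq (h₅.seq (h₆.seq ((h _).seq h₈ le_rfl) le_rfl) le_rfl)
    le_rfl) le_rfl) le_rfl) ?_
  simp only [V.size]
  omega

/-- The rest `m` of the main stack is arbitrary and stays untouched, which is what allows pending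
values to lie below the current argument. The auxiliary stacks are empty before and after every
construct. -/
theorem run_prog (c : Code) (x : V) (m : List Bool) :
    Run c.prog (ms (x.ser ++ m)) (ms ((c.eval x).ser ++ m)) (c.cost x) := by
  induction c generalizing x m with
  | id => exact .skip le_rfl
  | leaf =>
    have := x.one_le_size
    exact (run_drop x m).seq (run_push false m) (by simp only [cost]; omega)
  | fst =>
    cases x with
    | leaf => exact (run_onPop_false (run_push false m)).mono (by simp [cost, V.size])
    | node x y =>
      have h₁ := run_scan true false x (y.ser ++ m) [] []
      have h₂ := run_scan false false y m x.ser.reverse []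
      simp only [if_true, List.append_nil, Bool.false_eq_true, if_false] at h₁ h₂
      have := run_onPop_true (p := .push 0 false)
        (h₁.seq (h₂.seq (run_restore_value_one x m []) le_rfl) le_rfl)
      simp only [eval, V.fst, V.ser, List.cons_append, List.append_assoc]
      exact this.mono (by simp only [cost, V.size]; omega)
  | snd =>
    cases x with
    | leaf => exact (run_onPop_false (run_push false m)).mono (by simp [cost, V.size])
    | node x y =>
      have := run_onPop_true (p := .push 0 false) (run_drop x (y.ser ++ m))
      simp only [eval, V.snd, V.ser, List.cons_append, List.append_assoc]
      exact this.mono (by simp only [cost, V.size]; omega)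
  | pair f g ihf ihg =>
    have := x.one_le_size
    simp only [eval, V.ser, List.cons_append, List.append_assoc]
    refine (run_dup x m).seq ((ihf x _).seq ((run_swap _ x m).seq ((ihg x _).seq
      ((run_swap _ _ m).seq (run_push true _) le_rfl) le_rfl) le_rfl) le_rfl) ?_
    simp only [cost]
    omega
  | comp f g ihf ihg => exact (ihg x m).seq (ihf _ m) (by simp only [cost]; omega)
  | cnd f g ihf ihg =>
    rcases x with _ | ⟨_ | ⟨a, b⟩, y⟩
    · exact (run_onPop_false (run_push false m)).mono (by simp [cost])
    · exact (run_onPop_true (run_onPop_false (ihf y m))).mono (by simp only [cost]; omega)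
    · have := a.one_le_size
      simp only [V.ser, List.cons_append, List.append_assoc]
      exact (run_onPop_true (run_onPop_true ((run_drop a _).seq ((run_drop b _).seq (ihg y m)
        le_rfl) le_rfl))).mono (by simp only [cost]; omega)
  | fold f ih =>
    rcases x with _ | ⟨l, s⟩
    · exact (run_onPop_false (run_push false m)).mono (by simp [cost])
    · simp only [V.ser, List.cons_append, List.append_assoc]
      refine (run_onPop_true (t := foldCost f.eval f.cost l s + 1) ?_).mono
        (by simp only [cost]; omega)
      simp only [eval]
      induction l generalizing s with
      | leaf =>
        refine Run.loop_exit (b := false) (l := s.ser ++ m) rfl rfl (t₁ := 1) ?_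
          (by simp [foldCost])
        simp only [ms, update_st_zero, Bool.false_eq_true, if_false]
        exact .skip le_rfl
      | node a l _ ihl =>
        refine Run.loop_cont (b := true) (l := a.ser ++ (l.ser ++ (s.ser ++ m)))
          (by simp [V.ser, ms]) rfl ?_ (ihl (f.eval (.node a s)))
          -- One unit of the cost is reserved for the pop made by the loop itself.
          (t₁ := f.cost (.node a s) + 40 * (a.size + l.size + s.size +
            (f.eval (.node a s)).size) - 1) ?_
        · have := a.one_le_size
          have := s.one_le_size
          have := l.one_le_size
          simp only [ms, update_st_zero, if_true]
          refine (run_foldBody fun m => ih (.node a s) m).mono ?_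
          omega
        · have := a.one_le_size
          simp only [foldCost]
          omega

end Code

end StackProg

namespace StackProg

/-! ### Conversion between binary strings and coded lists -/

def V.ofBool : Bool → V
  | false => .leaf
  | true => .node .leaf .leaf

def V.ofList : List V → V
  | [] => .leaf
  | x :: l => .node x (V.ofList l)

theorem V.size_ofBool_le (b : Bool) : (V.ofBool b).size ≤ 3 := by
  cases b <;> simp [V.ofBool, V.size]

theorem V.size_ofList_ofBool_le (s : List Bool) :
    (V.ofList (s.map V.ofBool)).size ≤ 4 * s.length + 1 := by
  induction s with
  | nil => simp [V.ofList, V.size]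
  | cons b s ih =>
    have := V.size_ofBool_le b
    simp only [List.map_cons, V.ofList, V.size, List.length_cons]
    omega

namespace Prog

def pushBool (b : Bool) : Prog :=
  .seq (if b then .seq (.push 0 false) (.seq (.push 0 false) (.push 0 true)) else .push 0 false)
    (.push 0 true)

/-- Replaces a string by its code as a list. -/
def readInput : Prog :=
  -- After the reversal onto stack `1` the last symbol comes off first, which is the order in which
  -- a list is built from its end.
  .seq (.loop 0 (fun _ => true) fun b => .push 1 b)
    (.seq (.push 0 false) (.loop 1 (fun _ => true) pushBool))

/-- Replaces the code of a list of Booleans by the list. -/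
def writeOutput : Prog :=
  .seq (.loop 0 (fun b => b) fun b => if b then
      onPop (.push 1 false) (.seq drop (.seq drop (.push 1 true))) else .skip)
    (restore 1)

end Prog

open Prog

theorem run_push_one (b : Bool) (m x y z : List Bool) :
    Run (.push 1 b) (st m x y z) (st m (b :: x) y z) 1 := by
  simpa using Run.push (k := 1) (b := b) (s := st m x y z) (le_refl 1)

theorem run_reverse (s x : List Bool) :
    Run (.loop 0 (fun _ => true) fun b => .push 1 b) (st s x [] []) (st [] (s.reverse ++ x) [] [])
      (2 * s.length + 1) := by
  induction s generalizing x with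
  | nil => exact .loop_nil rfl le_rfl
  | cons b s ih =>
    have h := ih (b :: x)
    refine Run.loop_cont (b := b) (l := s) rfl rfl (by
      rw [update_st_zero]; exact run_push_one ..) (t₂ := 2 * s.length + 1) ?_ (by simp; omega)
    simpa using h

theorem run_pushBool (b : Bool) (m x y z : List Bool) :
    Run (pushBool b) (st m x y z) (st (true :: ((V.ofBool b).ser ++ m)) x y z) 4 := by
  cases b
  · exact (run_push_zero ..).seq (run_push_zero ..) (by omega)
  · exact ((run_push_zero ..).seq ((run_push_zero ..).seq (run_push_zero ..) le_rfl) le_rfl).seq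
      (run_push_zero ..) (by omega)

theorem run_readInput (s : List Bool) :
    Run readInput (ms s) (ms (V.ofList (s.map V.ofBool)).ser) (7 * s.length + 3) := by
  have key : ∀ (l : List Bool) (r : List Bool),
      Run (.loop 1 (fun _ => true) pushBool) (st (V.ofList (r.map V.ofBool)).ser l [] [])
        (ms (V.ofList ((l.reverse ++ r).map V.ofBool)).ser) (5 * l.length + 1) := by
    intro l
    induction l with
    | nil => exact fun r => .loop_nil rfl le_rfl
    | cons b l ih =>
      intro r
      have h := ih (b :: r)
      refine Run.loop_cont (b := b) (l := l) rfl rfl (by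
        rw [update_st_one]; exact run_pushBool ..) (t₂ := 5 * l.length + 1) ?_ (by simp; omega)
      simpa [V.ofList, V.ser] using h
  have h₁ := run_reverse s []
  have h₂ := key (s.reverse ++ []) []
  simp only [List.append_nil, List.reverse_reverse, List.length_reverse] at h₁ h₂
  exact h₁.seq ((run_push_zero false [] s.reverse [] []).seq h₂ le_rfl) (by omega)

theorem run_writeOutput (s : List Bool) :
    Run writeOutput (ms (V.ofList (s.map V.ofBool)).ser) (ms s) (24 * s.length + 3) := by
  have key : ∀ (s l : List Bool), Run (.loop 0 (fun b => b) fun b => if b then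
      onPop (.push 1 false) (.seq drop (.seq drop (.push 1 true))) else .skip)
      (st (V.ofList (s.map V.ofBool)).ser l [] []) (st [] (s.reverse ++ l) [] [])
        (22 * s.length + 2) := by
    intro s
    induction s with
    | nil =>
      intro l
      refine Run.loop_exit (b := false) (l := []) rfl rfl (t₁ := 1) ?_ (by omega)
      simp only [update_st_zero, Bool.false_eq_true, if_false]
      exact .skip le_rfl
    | cons b s ih =>
      intro l
      have h := ih (b :: l)
      refine Run.loop_cont (s₁ := st (V.ofList (s.map V.ofBool)).ser (b :: l) [] []) (b := true)
        (l := (V.ofBool b).ser ++ (V.ofList (s.map V.ofBool)).ser) (by simp [V.ofList, V.ser])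
        rfl ?_ (t₁ := 20) (t₂ := 22 * s.length + 2) ?_ (by simp; omega)
      · simp only [update_st_zero, if_true]
        cases b
        · refine Run.loop_exit (b := false) (l := (V.ofList (s.map V.ofBool)).ser) rfl rfl (t₁ := 1)
            ?_ (by omega)
          simp only [update_st_zero, Bool.false_eq_true, if_false]
          exact run_push_one ..
        · refine Run.loop_exit (b := true) (l := false :: false :: (V.ofList (s.map V.ofBool)).ser)
            rfl rfl (t₁ := 19) ?_ le_rfl
          have h₁ := run_scan false false V.leaf (false :: (V.ofList (s.map V.ofBool)).ser) l []
          have h₂ := run_scan false false V.leaf ((V.ofList (s.map V.ofBool)).ser) l []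
          simp only [update_st_zero, if_true]
          exact (h₁.seq (h₂.seq (run_push_one ..) le_rfl) le_rfl).mono (by simp [V.size])
      · simpa using h
  have h₁ := key s []
  have h₂ := run_restore_one s.reverse [] [] []
  simp only [List.append_nil, List.reverse_reverse, List.length_reverse] at h₁ h₂
  exact h₁.seq h₂ (by omega)

/-- The length of the output is at most the size of its code, hence at most `4 * s.length + 1` plus
the cost. Reading, evaluating and writing together stay below the stated multiple. -/
theorem Code.outputsWithin (c : Code) {s s' : List Bool}
    (h : c.eval (V.ofList (s.map V.ofBool)) = V.ofList (s'.map V.ofBool)) :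
    DataQuery.OutputsWithin (machine (.seq readInput (.seq c.prog writeOutput))) s s'
      (131 * (s.length + c.cost (V.ofList (s.map V.ofBool)) + 1)) := by
  have h₁ := c.run_prog (V.ofList (s.map V.ofBool)) []
  have h₂ := c.size_eval_le (V.ofList (s.map V.ofBool))
  have h₃ := V.size_ofList_ofBool_le s
  have h₄ : s'.length ≤ (V.ofList (s'.map V.ofBool)).size := by
    clear h
    induction s' with
    | nil => simp
    | cons b s' ih => simp only [List.map_cons, V.ofList, V.size, List.length_cons]; omega
  rw [h] at h₁ h₂
  simp only [List.append_nil] at h₁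
  have h₅ := outputsWithin_machine
    ((run_readInput s).seq (h₁.seq (run_writeOutput s') le_rfl) le_rfl)
  obtain ⟨h₅⟩ := h₅
  exact ⟨⟨h₅.1, h₅.2.trans (by omega)⟩⟩

end StackProg

/-! ### Functions computable in polynomial time -/

namespace PolyTime

open StackProg

class Enc (α : Type) where
  enc : α → V

open Enc

instance : Enc Bool := ⟨V.ofBool⟩
instance : Enc Unit := ⟨fun _ => .leaf⟩

/-- Unary is affordable: the numbers that are computed with (vertices, states, registers, wires) are
polynomially bounded. Letters, variables and data values are kept as lists of binary digits and are
only compared. -/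
def encNat : ℕ → V
  | 0 => .leaf
  | n + 1 => .node .leaf (encNat n)

/-- Unary representation. -/
instance : Enc ℕ := ⟨encNat⟩

variable {α β γ δ σ : Type} [Enc α] [Enc β] [Enc γ] [Enc δ] [Enc σ]

instance : Enc (List α) := ⟨fun l => V.ofList (l.map enc)⟩
instance : Enc (α × β) := ⟨fun p => .node (enc p.1) (enc p.2)⟩

@[simp] theorem enc_nil : enc ([] : List α) = .leaf := rfl
@[simp] theorem enc_cons (a : α) (l : List α) : enc (a :: l) = .node (enc a) (enc l) := rfl
@[simp] theorem enc_prod (p : α × β) : enc p = .node (enc p.1) (enc p.2) := rfl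
@[simp] theorem enc_succ (n : ℕ) : enc (n + 1) = .node .leaf (enc n) := rfl
def sz (a : α) : ℕ := (enc a).size

theorem one_le_sz (a : α) : 1 ≤ sz a := V.one_le_size _
@[simp] theorem sz_nil : sz ([] : List α) = 1 := rfl
@[simp] theorem sz_cons (a : α) (l : List α) : sz (a :: l) = sz a + sz l + 1 := rfl
@[simp] theorem sz_prod (p : α × β) : sz p = sz p.1 + sz p.2 + 1 := rfl
@[simp] theorem sz_nat (n : ℕ) : sz n = 2 * n + 1 := by
  induction n with
  | zero => rfl
  | succ n ih => simp only [sz, enc_succ, V.size] at *; omega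
theorem sz_bool_le (b : Bool) : sz b ≤ 3 := V.size_ofBool_le b

theorem sz_append (l₁ l₂ : List α) : sz (l₁ ++ l₂) + 1 = sz l₁ + sz l₂ := by
  induction l₁ with
  | nil => simp only [List.nil_append, sz_nil]; omega
  | cons a l ih => simp only [List.cons_append, sz_cons]; omega

theorem length_le_sz (l : List α) : l.length < sz l := by
  induction l with
  | nil => simp
  | cons a l ih => simp only [List.length_cons, sz_cons]; omega

theorem sz_le_of_mem {a : α} {l : List α} (h : a ∈ l) : sz a < sz l := by
  induction l with
  | nil => simp at h
  | cons b l ih =>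
    rcases List.mem_cons.1 h with rfl | h
    · simp only [sz_cons]; omega
    · have := ih h; simp; omega

theorem sz_le_of_forall {l : List α} {B : ℕ} (h : ∀ a ∈ l, sz a ≤ B) :
    sz l ≤ l.length * (B + 1) + 1 := by
  induction l with
  | nil => simp
  | cons a l ih =>
    have h₁ := h a (by simp)
    have h₂ := ih fun b hb => h b (by simp [hb])
    simp only [sz_cons, List.length_cons, add_mul]
    omega

/-- Bounded by a polynomial in the size of the argument. -/
def PolyBdd (g : α → ℕ) : Prop := ∃ e, ∀ x, g x ≤ (sz x + 2) ^ e

-- Calculus of polynomial bounds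

namespace PolyBdd

theorem mono {g h : α → ℕ} (hh : PolyBdd h) (hgh : ∀ x, g x ≤ h x) : PolyBdd g := by
  obtain ⟨e, he⟩ := hh
  exact ⟨e, fun x => (hgh x).trans (he x)⟩

theorem const (n : ℕ) : PolyBdd fun _ : α => n :=
  -- The base `sz x + 2` is at least `2`, so that constants and factors are absorbed by the
  -- exponent.
  ⟨n, fun x => Nat.lt_two_pow_self.le.trans (Nat.pow_le_pow_left (by omega) n)⟩

theorem sz : PolyBdd fun x : α => sz x := ⟨1, fun x => by simp⟩

theorem mul {g h : α → ℕ} (hg : PolyBdd g) (hh : PolyBdd h) : PolyBdd fun x => g x * h x := by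
  obtain ⟨e, he⟩ := hg
  obtain ⟨d, hd⟩ := hh
  exact ⟨e + d, fun x => by rw [pow_add]; exact Nat.mul_le_mul (he x) (hd x)⟩

theorem add {g h : α → ℕ} (hg : PolyBdd g) (hh : PolyBdd h) : PolyBdd fun x => g x + h x := by
  refine (((const 1).mul ((const 2).mul ?_)) : PolyBdd fun x : α => 1 * (2 * max (g x) (h x))).mono
    fun x => by omega
  obtain ⟨e, he⟩ := hg
  obtain ⟨d, hd⟩ := hh
  exact ⟨max e d, fun x => max_le
    ((he x).trans (Nat.pow_le_pow_right (by omega) (le_max_left _ _)))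
    ((hd x).trans (Nat.pow_le_pow_right (by omega) (le_max_right _ _)))⟩

theorem pow {g : α → ℕ} (hg : PolyBdd g) (n : ℕ) : PolyBdd fun x => g x ^ n := by
  obtain ⟨e, he⟩ := hg
  exact ⟨e * n, fun x => by rw [pow_mul]; exact Nat.pow_le_pow_left (he x) n⟩

theorem comp_of_sz {g : β → ℕ} {f : α → β} (hg : PolyBdd g) (hf : PolyBdd fun x => PolyTime.sz (f x)) :
    PolyBdd fun x => g (f x) := by
  obtain ⟨e, he⟩ := hg
  exact ((hf.add (const 2)).pow e).mono fun x => he (f x)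

end PolyBdd

/-- Computable in polynomial time. -/
def PolyFun (f : α → β) : Prop :=
  ∃ c : Code, (∀ x, c.eval (enc x) = enc (f x)) ∧ PolyBdd fun x : α => c.cost (enc x)

theorem PolyFun.outputsWithin {F : List Bool → List Bool} (hF : PolyFun F) :
    ∃ (M : Turing.TM2ComputableAux Bool Bool) (e : ℕ),
      ∀ s, DataQuery.OutputsWithin M s (F s) ((s.length + 2) ^ e) := by
  obtain ⟨c, hc, hb⟩ := hF
  have h₁ : PolyBdd fun s : List Bool => 131 * (s.length + c.cost (enc s) + 1) :=
    (PolyBdd.const 131).mul (((PolyBdd.sz.mono fun s => (length_le_sz s).le).add hb).add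
      (PolyBdd.const 1))
  obtain ⟨e, he⟩ := h₁
  refine ⟨machine (.seq Prog.readInput (.seq c.prog Prog.writeOutput)), 2 * e + e, fun s => ?_⟩
  obtain ⟨h₂⟩ := Code.outputsWithin c (hc s)
  refine ⟨⟨h₂.1, h₂.2.trans ((he s).trans ?_)⟩⟩
  have h₃ : sz s ≤ 4 * s.length + 1 := V.size_ofList_ofBool_le s
  have h₄ : (s.length + 2) ^ (2 * e + e) = ((s.length + 2) ^ 3) ^ e := by
    rw [← pow_mul]; congr 1; ring
  rw [h₄]
  refine Nat.pow_le_pow_left ?_ e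
  -- The size of the encoded string is about four times its length; the factor `4` is absorbed by
  -- two further powers of `s.length + 2`.
  calc sz s + 2 ≤ 2 * 2 * (s.length + 2) := by omega
    _ ≤ (s.length + 2) * (s.length + 2) * (s.length + 2) := by gcongr <;> omega
    _ = _ := by ring

-- Closure under composition, pairing and case distinction

namespace PolyFun

theorem sz {f : α → β} (hf : PolyFun f) : PolyBdd fun x => PolyTime.sz (f x) := by
  obtain ⟨c, hc, hb⟩ := hf
  refine (PolyBdd.sz.add hb).mono fun x => ?_
  rw [PolyTime.sz, ← hc]
  exact c.size_eval_le _

theorem comp {g : β → γ} {f : α → β} (hg : PolyFun g) (hf : PolyFun f) : PolyFun fun x => g (f x) := by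
  have hs := hf.sz
  obtain ⟨c, hc, hcb⟩ := hg
  obtain ⟨d, hd, hdb⟩ := hf
  refine ⟨.comp c d, fun x => by simp [Code.eval, hc, hd],
    ((hcb.comp_of_sz hs).add hdb).mono fun x => ?_⟩
  simp [Code.cost, hd]

theorem id : PolyFun fun x : α => x := ⟨.id, fun _ => rfl, PolyBdd.const 1⟩

theorem const (b : β) : PolyFun fun _ : α => b := by
  have key : ∀ v : V, ∃ c : Code, (∀ x, c.eval x = v) ∧ PolyBdd fun x : α => c.cost (enc x) := by
    intro v
    induction v with
    | leaf => exact ⟨.leaf, fun _ => rfl, (PolyBdd.const 10).mul PolyBdd.sz⟩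
    | node v w ihv ihw =>
      obtain ⟨c, hc, hcb⟩ := ihv
      obtain ⟨d, hd, hdb⟩ := ihw
      refine ⟨.pair c d, fun x => by simp [Code.eval, hc, hd], ?_⟩
      simp only [Code.cost, hc, hd]
      exact (hcb.add hdb).add ((PolyBdd.const 40).mul ((PolyBdd.sz.add (.const _)).add (.const _)))
  obtain ⟨c, hc, hb⟩ := key (enc b)
  exact ⟨c, fun _ => hc _, hb⟩

theorem pair {f : α → β} {g : α → γ} (hf : PolyFun f) (hg : PolyFun g) : PolyFun fun x => (f x, g x) := by
  have hfs := hf.sz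
  have hgs := hg.sz
  obtain ⟨c, hc, hcb⟩ := hf
  obtain ⟨d, hd, hdb⟩ := hg
  refine ⟨.pair c d, fun x => by simp [Code.eval, hc, hd], ?_⟩
  simp only [Code.cost, hc, hd]
  exact (hcb.add hdb).add ((PolyBdd.const 40).mul ((PolyBdd.sz.add hfs).add hgs))

theorem fst {f : α → β × γ} (hf : PolyFun f) : PolyFun fun x => (f x).1 :=
  comp (g := Prod.fst) ⟨.fst, fun _ => rfl, (PolyBdd.const 20).mul PolyBdd.sz⟩ hf

theorem snd {f : α → β × γ} (hf : PolyFun f) : PolyFun fun x => (f x).2 :=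
  comp (g := Prod.snd) ⟨.snd, fun _ => rfl, (PolyBdd.const 20).mul PolyBdd.sz⟩ hf

theorem tail {f : α → List β} (hf : PolyFun f) : PolyFun fun x => (f x).tail :=
  comp (g := List.tail) ⟨.snd, fun l => by cases l <;> rfl, (PolyBdd.const 20).mul PolyBdd.sz⟩ hf

theorem cons {f : α → β} {g : α → List β} (hf : PolyFun f) (hg : PolyFun g) :
    PolyFun fun x => f x :: g x :=
  comp (f := fun x => (f x, g x)) (g := fun p => p.1 :: p.2)
    ⟨.id, fun _ => rfl, PolyBdd.const 1⟩ (hf.pair hg)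

theorem succ {f : α → ℕ} (hf : PolyFun f) : PolyFun fun x => f x + 1 := by
  obtain ⟨c, hc, hb⟩ := (const ()).pair hf
  exact ⟨c, fun x => by rw [hc]; rfl, hb⟩

/-- Case distinction on whether a list is empty. -/
theorem nilCase {l : α → List β} {f g : α → γ} (hl : PolyFun l) (hf : PolyFun f) (hg : PolyFun g) :
    PolyFun fun x => if l x = [] then f x else g x := by
  have h := hl.pair id
  obtain ⟨c, hc, hcb⟩ := hf
  obtain ⟨d, hd, hdb⟩ := hg
  refine comp (g := fun p : List β × α => if p.1 = [] then f p.2 else g p.2)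
    ⟨.cnd c d, ?_, ?_⟩ h
  · rintro ⟨_ | ⟨b, l⟩, x⟩
    · simp [Code.eval, hc]
    · simp [Code.eval, hd]
  · have h₁ : PolyBdd fun p : List β × α => PolyTime.sz p.2 :=
      PolyBdd.sz.mono fun p => by simp only [sz_prod]; omega
    refine (((hcb.comp_of_sz h₁).add (hdb.comp_of_sz h₁)).add
      ((PolyBdd.const 20).mul PolyBdd.sz)).mono ?_
    rintro ⟨_ | ⟨b, l⟩, x⟩
    · simp only [enc_prod, enc_nil, Code.cost, sz_prod, sz_nil]; omega
    · simp only [enc_prod, enc_cons, Code.cost, PolyTime.sz, V.size]; omega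

end PolyFun

end PolyTime

-- Cost of a fold with bounded intermediate states

namespace StackProg

/-- The bounds are required only along the prefixes of the given list, that is, for accumulators
that really occur. A bound for all accumulators would not be available, as the body may be expensive
on large ones. -/
theorem Code.foldCost_le (f : V → V) (c : V → ℕ) (K B : ℕ) (l : List V) (s : V)
    (hK : ∀ l₁ a l₂, l = l₁ ++ a :: l₂ →
      c (.node a (V.foldl f (V.ofList l₁) s)) ≤ K)
    (hB : ∀ l₁ l₂, l = l₁ ++ l₂ → (V.foldl f (V.ofList l₁) s).size ≤ B) (hl : (V.ofList l).size ≤ B) :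
    foldCost f c (V.ofList l) s ≤ l.length * (K + 120 * B) + 1 := by
  induction l generalizing s with
  | nil => simp [V.ofList, foldCost]
  | cons a l ih =>
    have h₀ := ih (f (.node a s)) (fun l₁ b l₂ h => hK (a :: l₁) b l₂ (by rw [h]; rfl))
      (fun l₁ l₂ h => hB (a :: l₁) l₂ (by rw [h]; rfl)) (by simp only [V.ofList, V.size] at hl; omega)
    have h₁ := hK [] a l rfl
    have h₂ := hB [] (a :: l) rfl
    have h₃ := hB [a] l rfl
    simp only [V.ofList, V.foldl, V.size] at h₁ h₂ h₃ hl
    simp only [V.ofList, foldCost, List.length_cons, add_mul]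
    omega

end StackProg

-- List operations as folds

namespace PolyTime

open StackProg Enc

variable {α β γ δ σ : Type} [Enc α] [Enc β] [Enc γ] [Enc δ] [Enc σ]

namespace PolyFun

/-- A polynomial step alone is not enough, since iterating it may make the state explode. The
hypothesis `hb` keeps all intermediate states polynomially small; then each step costs polynomially
much and there are polynomially many of them. -/
theorem foldl {l : γ → List α} {s₀ : γ → σ} {step : γ → σ → α → σ} {B : γ → ℕ} (hl : PolyFun l)
    (hs : PolyFun s₀) (hstep : PolyFun fun p : γ × σ × α => step p.1 p.2.1 p.2.2) (hB : PolyBdd B)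
    (hb : ∀ x l₁ l₂, l x = l₁ ++ l₂ → PolyTime.sz (l₁.foldl (step x) (s₀ x)) ≤ B x) :
    PolyFun fun x => (l x).foldl (step x) (s₀ x) := by
  -- The body of a fold sees only the item and the accumulator, so the parameter `x` is carried
  -- along inside the accumulator.
  have hbody : PolyFun fun p : α × γ × σ => (p.2.1, step p.2.1 p.2.2 p.1) :=
    id.snd.fst.pair (hstep.comp (id.snd.fst.pair (id.snd.snd.pair id.fst)))
  obtain ⟨c, hc, hcb⟩ := hbody
  have hfold : ∀ x (l : List α) s, V.foldl c.eval (enc l) (enc (x, s)) =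
      enc (x, l.foldl (step x) s) := by
    intro x l
    induction l with
    | nil => intro s; rfl
    | cons a l ih =>
      intro s
      have h := hc (a, x, s)
      rw [enc_prod] at h
      rw [enc_cons, V.foldl, h, ih, List.foldl_cons]
  have hinit : PolyFun fun x => (l x, x, s₀ x) := hl.pair (id.pair hs)
  have hls := hl.sz
  obtain ⟨d, hd, hdb⟩ := hinit
  have hprod : PolyFun fun x => (x, (l x).foldl (step x) (s₀ x)) := by
    obtain ⟨e, he⟩ := hcb
    refine ⟨.comp (.fold c) d, fun x => ?_, ?_⟩
    · rw [Code.eval, hd, enc_prod, Code.eval, hfold]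
    · have hlen : PolyBdd fun x => (l x).length := hls.mono fun x => (length_le_sz _).le
      have h₁ : PolyBdd fun x => PolyTime.sz x + B x + 1 + PolyTime.sz (l x) :=
        ((PolyBdd.sz.add hB).add (.const 1)).add hls
      refine ((((hlen.mul (((h₁.add (.const 4)).pow e).add ((PolyBdd.const 120).mul h₁))).add
        (.const 1)).add (.const 10)).add hdb).mono fun x => ?_
      rw [Code.cost, hd, enc_prod, Code.cost]
      gcongr
      have h₂ := Code.foldCost_le c.eval c.cost
        ((PolyTime.sz x + B x + 1 + PolyTime.sz (l x) + 4) ^ e)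
        (PolyTime.sz x + B x + 1 + PolyTime.sz (l x)) ((l x).map enc) (enc (x, s₀ x)) ?_ ?_ ?_
      · rw [List.length_map] at h₂
        exact h₂
      · intro l₁ a l₂ h
        obtain ⟨l₁, l₂, h₃, rfl, h₄⟩ := List.map_eq_append_iff.1 h
        obtain ⟨a, l₂, rfl, rfl, rfl⟩ := List.map_eq_cons_iff.1 h₄
        have h₅ : V.foldl c.eval (V.ofList (l₁.map enc)) (enc (x, s₀ x)) = _ := hfold x l₁ (s₀ x)
        rw [h₅]
        refine (he (a, x, _)).trans (Nat.pow_le_pow_left ?_ e)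
        have h₆ := hb x _ _ h₃
        have h₇ : PolyTime.sz a < PolyTime.sz (l x) := sz_le_of_mem (by rw [h₃]; simp)
        simp only [sz_prod]
        omega
      · intro l₁ l₂ h
        obtain ⟨l₁, l₂, h₃, rfl, h₄⟩ := List.map_eq_append_iff.1 h
        have h₅ : V.foldl c.eval (V.ofList (l₁.map enc)) (enc (x, s₀ x)) = _ := hfold x l₁ (s₀ x)
        rw [h₅]
        have h₆ := hb x _ _ h₃
        change PolyTime.sz (x, _) ≤ _
        simp only [sz_prod]
        omega
      · change PolyTime.sz (l x) ≤ _
        omega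
  exact hprod.snd

/-- A fold each of whose steps increases the size of the state by a bounded amount. -/
theorem foldl_of_growth {l : γ → List α} {s₀ : γ → σ} {step : γ → σ → α → σ} {G : γ → ℕ}
    (hl : PolyFun l) (hs : PolyFun s₀) (hstep : PolyFun fun p : γ × σ × α => step p.1 p.2.1 p.2.2)
    (hG : PolyBdd G)
    (hg : ∀ x s, ∀ a ∈ l x, PolyTime.sz (step x s a) ≤ PolyTime.sz s + G x) :
    PolyFun fun x => (l x).foldl (step x) (s₀ x) := by
  have hlen : PolyBdd fun x => (l x).length := hl.sz.mono fun x => (length_le_sz _).le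
  refine foldl hl hs hstep (hs.sz.add (hlen.mul hG)) fun x l₁ l₂ h => ?_
  have key : ∀ (l₁ : List α) s, (∀ a ∈ l₁, a ∈ l x) →
      PolyTime.sz (l₁.foldl (step x) s) ≤ PolyTime.sz s + l₁.length * G x := by
    intro l₁
    induction l₁ with
    | nil => intro s _; simp
    | cons a l₁ ih =>
      intro s hm
      have h₁ := hg x s a (hm a (by simp))
      have h₂ := ih (step x s a) fun b hb => hm b (by simp [hb])
      simp only [List.foldl_cons, List.length_cons, add_mul]
      omega
  refine (key l₁ (s₀ x) fun a ha => by rw [h]; simp [ha]).trans ?_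
  gcongr
  rw [h]
  simp

theorem reverseAppend {f g : γ → List α} (hf : PolyFun f) (hg : PolyFun g) :
    PolyFun fun x => (f x).reverse ++ g x := by
  have h := foldl_of_growth (step := fun _ s a => a :: s) hf hg (id.snd.snd.cons id.snd.fst)
    (hf.sz) fun x s a ha => by
      have := sz_le_of_mem ha
      simp only [sz_cons]
      omega
  have h₁ : ∀ (l s : List α), l.foldl (fun s a => a :: s) s = l.reverse ++ s := by
    intro l
    induction l with
    | nil => simp
    | cons a l ih => intro s; simp [ih]
  simpa only [h₁] using h

theorem reverse {f : γ → List α} (hf : PolyFun f) : PolyFun fun x => (f x).reverse := by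
  simpa using hf.reverseAppend (const [])

theorem append {f g : γ → List α} (hf : PolyFun f) (hg : PolyFun g) : PolyFun fun x => f x ++ g x := by
  simpa using hf.reverse.reverseAppend hg

theorem _root_.PolyTime.sz_reverse (l : List α) : PolyTime.sz l.reverse = PolyTime.sz l := by
  induction l with
  | nil => rfl
  | cons a l ih =>
    have := sz_append l.reverse [a]
    simp only [sz_cons, sz_nil] at this
    rw [List.reverse_cons, sz_cons]
    omega

theorem flatMap {l : γ → List α} {f : γ → α → List β} (hl : PolyFun l)
    (hf : PolyFun fun p : γ × α => f p.1 p.2) : PolyFun fun x => (l x).flatMap (f x) := by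
  have hfs := hf.sz
  obtain ⟨e, he⟩ := hfs
  have h := foldl_of_growth (step := fun x s a => (f x a).reverse ++ s)
    (G := fun x => (PolyTime.sz x + PolyTime.sz (l x) + 3) ^ e) hl (const [])
    (reverseAppend (hf.comp (id.fst.pair id.snd.snd)) id.snd.fst)
    (((PolyBdd.sz.add hl.sz).add (.const 3)).pow e) fun x s a ha => by
      have h₁ := sz_append (f x a).reverse s
      have h₂ := sz_reverse (f x a)
      have h₃ := sz_le_of_mem ha
      have h₄ : PolyTime.sz (f x a) ≤ _ := (he (x, a)).trans (Nat.pow_le_pow_left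
        (show _ ≤ PolyTime.sz x + PolyTime.sz (l x) + 3 by simp only [sz_prod]; omega) e)
      omega
  have h₁ : ∀ x (l : List α) (s : List β), l.foldl (fun s a => (f x a).reverse ++ s) s =
      (l.flatMap (f x)).reverse ++ s := by
    intro x l
    induction l with
    | nil => simp
    | cons a l ih => intro s; simp [ih]
  simpa only [h₁, List.append_nil, List.reverse_reverse] using h.reverse

theorem map {l : γ → List α} {f : γ → α → β} (hl : PolyFun l) (hf : PolyFun fun p : γ × α => f p.1 p.2) :
    PolyFun fun x => (l x).map (f x) := by
  simpa only [List.map_eq_flatMap] using hl.flatMap (hf.cons (const []))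

theorem cond {b : γ → Bool} {f g : γ → α} (hb : PolyFun b) (hf : PolyFun f) (hg : PolyFun g) :
    PolyFun fun x => bif b x then f x else g x := by
  have h : PolyFun fun x => if b x then [()] else [] :=
    -- The trees of `true` and `[()]` coincide, and so do those of `false` and `[]`; the identity
    -- therefore performs this conversion.
    comp (g := fun b : Bool => if b then [()] else [])
      ⟨.id, fun b => by cases b <;> rfl, PolyBdd.const 1⟩ hb
  refine (nilCase h hg hf |> fun h => ?_)
  convert h using 2 with x
  cases b x <;> simp

theorem ite {b : γ → Bool} {f g : γ → α} (hb : PolyFun b) (hf : PolyFun f) (hg : PolyFun g) :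
    PolyFun fun x => if b x then f x else g x := by
  simpa only [Bool.cond_eq_ite] using cond hb hf hg

theorem and {b c : γ → Bool} (hb : PolyFun b) (hc : PolyFun c) : PolyFun fun x => b x && c x := by
  convert ite hb hc (const false) using 2 with x
  cases b x <;> simp

theorem not {b : γ → Bool} (hb : PolyFun b) : PolyFun fun x => !b x := by
  convert ite hb (const false) (const true) using 2 with x
  cases b x <;> simp

theorem filter {l : γ → List α} {f : γ → α → Bool} (hl : PolyFun l)
    (hf : PolyFun fun p : γ × α => f p.1 p.2) : PolyFun fun x => (l x).filter (f x) := by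
  have h := hl.flatMap (f := fun x a => if f x a then [a] else [])
    (ite hf (id.snd.cons (const [])) (const []))
  convert h using 2 with x
  induction l x with
  | nil => rfl
  | cons a l ih => cases h : f x a <;> simp [h, ih]

theorem isEmpty {l : γ → List α} (hl : PolyFun l) : PolyFun fun x => (l x).isEmpty := by
  convert nilCase hl (const true) (const false) using 2 with x
  cases l x <;> simp

/-- The fold over the reversed list remembers the item seen last, which is the first item of the
list. -/
theorem headD {l : γ → List α} {d : γ → α} (hl : PolyFun l) (hd : PolyFun d) :
    PolyFun fun x => (l x).headD (d x) := by
  have h := foldl_of_growth (step := fun _ _ a => a) hl.reverse hd id.snd.snd hl.sz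
    fun x s a ha => by
      have := sz_le_of_mem ha
      rw [sz_reverse] at this
      omega
  convert h using 2 with x
  cases l x <;> simp

theorem takeOne {l : γ → List α} (hl : PolyFun l) : PolyFun fun x => (l x).take 1 := by
  have h := foldl_of_growth (step := fun _ _ a => [a]) hl.reverse (const [])
    (id.snd.snd.cons (const [])) (hl.sz.add (.const 2)) fun x s a ha => by
      have := sz_le_of_mem ha
      rw [sz_reverse] at this
      simp only [sz_cons, sz_nil]
      omega
  convert h using 2 with x
  cases l x <;> simp

/-- A number and the list of that many units have the same tree, so replication is a `map` over a
number. Conversely, the length of a list is found by mapping everything to the unit, and arithmetic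
reduces to list operations. -/
theorem replicate {n : γ → ℕ} {a : γ → α} (hn : PolyFun n) (ha : PolyFun a) :
    PolyFun fun x => List.replicate (n x) (a x) := by
  have h₁ : PolyFun fun n : ℕ => List.replicate n () := by
    refine ⟨.id, fun n => ?_, PolyBdd.const 1⟩
    induction n with
    | zero => rfl
    | succ n ih =>
      rw [Code.eval] at ih
      change V.node _ (enc n) = V.node _ _
      rw [ih]
      rfl
  simpa using (h₁.comp hn).map (f := fun x _ => a x) (ha.comp id.fst)

theorem length {l : γ → List α} (hl : PolyFun l) : PolyFun fun x => (l x).length := by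
  have h₁ : PolyFun fun l : List Unit => l.length := by
    refine ⟨.id, fun l => ?_, PolyBdd.const 1⟩
    induction l with
    | nil => rfl
    | cons a l ih =>
      rw [Code.eval] at ih
      change V.node _ (enc l) = V.node _ _
      rw [ih]
      rfl
  simpa using h₁.comp (hl.map (f := fun _ _ => ()) (const ()))

theorem add {m n : γ → ℕ} (hm : PolyFun m) (hn : PolyFun n) : PolyFun fun x => m x + n x := by
  simpa using ((hm.replicate (const ())).append (hn.replicate (const ()))).length

theorem mul {m n : γ → ℕ} (hm : PolyFun m) (hn : PolyFun n) : PolyFun fun x => m x * n x := by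
  simpa using ((hm.replicate (const ())).flatMap (f := fun x _ => List.replicate (n x) ())
    ((hn.comp id.fst).replicate (const ()))).length

theorem zipIdx {l : γ → List α} (hl : PolyFun l) : PolyFun fun x => (l x).zipIdx := by
  have h := foldl (step := fun _ (s : List (α × ℕ) × ℕ) a => ((a, s.2) :: s.1, s.2 + 1))
    (B := fun x => (l x).length * (PolyTime.sz (l x) + 2 * (l x).length + 5) + 3) hl (const ([], 0))
    (((id.snd.snd.pair id.snd.fst.snd).cons id.snd.fst.fst).pair id.snd.fst.snd.succ)
    ((hl.length.sz.mono fun x => by rw [sz_nat]; omega).mul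
      ((hl.sz.add ((PolyBdd.const 2).mul (hl.length.sz.mono fun x => by rw [sz_nat]; omega))).add
      (.const 5)) |>.add (.const 3)) fun x l₁ l₂ h => by
    have key : ∀ (l₁ : List α) (s : List (α × ℕ) × ℕ), (∀ a ∈ l₁, a ∈ l x) →
        s.2 + l₁.length ≤ (l x).length →
        PolyTime.sz (l₁.foldl (fun s a => ((a, s.2) :: s.1, s.2 + 1)) s) ≤
          PolyTime.sz s + l₁.length * (PolyTime.sz (l x) + 2 * (l x).length + 5) := by
      intro l₁
      induction l₁ with
      | nil => intro s _; simp
      | cons a l₁ ih =>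
        intro s hm hs
        have h₁ := sz_le_of_mem (hm a (by simp))
        simp only [List.length_cons] at hs
        have h₂ := ih ((a, s.2) :: s.1, s.2 + 1) (fun b hb => hm b (by simp [hb])) (by simp; omega)
        simp only [sz_prod, sz_cons, sz_nat] at h₂
        simp only [List.foldl_cons, List.length_cons, add_mul, sz_prod, sz_nat] at h₂ ⊢
        omega
    have h₁ := key l₁ ([], 0) (fun a ha => by rw [h]; simp [ha]) (by rw [h]; simp)
    refine h₁.trans ?_
    have h₂ : l₁.length ≤ (l x).length := by rw [h]; simp
    rw [add_comm]
    gcongr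
    simp
  have h₁ : ∀ (l : List α) (s : List (α × ℕ) × ℕ),
      (l.foldl (fun s a => ((a, s.2) :: s.1, s.2 + 1)) s).1 = (l.zipIdx s.2).reverse ++ s.1 := by
    intro l
    induction l with
    | nil => simp
    | cons a l ih => intro s; simp [ih, List.zipIdx_cons]
  simpa only [h₁, List.append_nil, List.reverse_reverse] using h.fst.reverse

theorem range {n : γ → ℕ} (hn : PolyFun n) : PolyFun fun x => List.range (n x) := by
  have h := (hn.replicate (const ())).zipIdx.map (f := fun _ p => p.2) id.snd.snd
  convert h using 2 with x
  apply List.ext_getElem <;> simp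

theorem beqBits {f g : γ → List Bool} (hf : PolyFun f) (hg : PolyFun g) : PolyFun fun x => f x == g x := by
  -- The state consists of the unmatched rest of the second list and a flag for agreement so far;
  -- equality holds iff the flag survives and nothing is left over.
  have hbeq : PolyFun fun p : γ × (List Bool × Bool) × Bool =>
      (p.2.1.1.tail, p.2.1.2 && (!p.2.1.1.isEmpty &&
        if p.2.1.1.headD false then p.2.2 else !p.2.2)) :=
    id.snd.fst.fst.tail.pair (id.snd.fst.snd.and (id.snd.fst.fst.isEmpty.not.and
      (ite (id.snd.fst.fst.headD (const false)) id.snd.snd id.snd.snd.not)))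
  have h := foldl_of_growth (step := fun _ (s : List Bool × Bool) b =>
      (s.1.tail, s.2 && (!s.1.isEmpty && if s.1.headD false then b else !b)))
    (G := fun _ => 3) hf (hg.pair (const true)) hbeq (.const 3) fun x s b _ => by
      have h₁ : PolyTime.sz s.1.tail ≤ PolyTime.sz s.1 := by
        cases s.1 <;> simp only [List.tail_nil, List.tail_cons, sz_cons] <;> omega
      have h₂ := sz_bool_le (s.2 && (!s.1.isEmpty && if s.1.headD false then b else !b))
      simp only [sz_prod]
      omega
  have h₁ : ∀ (l : List Bool) (s : List Bool × Bool),
      (let r := l.foldl (fun s b =>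
        (s.1.tail, s.2 && (!s.1.isEmpty && if s.1.headD false then b else !b))) s
      r.2 && r.1.isEmpty) = (s.2 && l == s.1) := by
    intro l
    induction l with
    | nil => rintro ⟨_ | _, b⟩ <;> simp
    | cons a l ih =>
      rintro ⟨r, b⟩
      rw [List.foldl_cons, ih]
      cases r with
      | nil => cases b <;> simp
      | cons c r => cases a <;> cases b <;> cases c <;> simp
  convert h.snd.and h.fst.isEmpty using 2 with x
  have h₂ := h₁ (f x) (g x, true)
  simp only [Bool.true_and] at h₂
  exact h₂.symm

theorem beqNat {m n : γ → ℕ} (hm : PolyFun m) (hn : PolyFun n) : PolyFun fun x => m x == n x := by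
  convert beqBits (hm.replicate (const true)) (hn.replicate (const true)) using 2 with x
  rw [Bool.eq_iff_iff]
  simp [List.replicate_inj]

end PolyFun

end PolyTime

/-! ### Parsers -/

namespace EvalReduction

open PolyTime DataQuery

abbrev Bits := List Bool

-- Parsing lists with the input as a clock

section ListParser

variable {α β : Type}

/-- One step of the parser for lists; the state consists of the items read so far, in reverse
order, the rest of the input, and a flag that tells whether the list is complete. -/
def parseListStep (item : Bits → α × Bits) (s : List α × Bits × Bool) : List α × Bits × Bool :=
  if s.2.2 then s
  else if s.2.1.headD false then ((item s.2.1.tail).1 :: s.1, (item s.2.1.tail).2, false)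
  else (s.1, s.2.1.tail, true)

/-- Reads the code of a list, given a parser for the items. -/
def parseList (item : Bits → α × Bits) (l : Bits) : List α × Bits :=
  ((l.foldl (fun s _ => parseListStep item s) ([], l, false)).1.reverse,
    (l.foldl (fun s _ => parseListStep item s) ([], l, false)).2.1)

theorem length_lt_length_listCode (c : α → Bits) (as : List α) :
    as.length < (listCode c as).length := by
  induction as with
  | nil => simp [listCode]
  | cons a as ih => simp [listCode]; omega

/-- Only bounded loops are available, so the step is repeated once for each symbol of the input.
This is enough because the code of a list is longer than the list has items; the flag freezes the
state once the end marker has been read. -/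
theorem parseList_listCode {item : Bits → β × Bits} {c : α → Bits} {g : α → β}
    (h : ∀ a r, item (c a ++ r) = (g a, r)) (as : List α) (r : Bits) :
    parseList item (listCode c as ++ r) = (as.map g, r) := by
  have h₁ : ∀ n (acc : List β) (r : Bits),
      (parseListStep item)^[n] (acc, r, true) = (acc, r, true) := by
    intro n acc r
    exact Function.iterate_fixed rfl n
  have key : ∀ (as : List α) (acc : List β) (n : ℕ), as.length < n →
      (parseListStep item)^[n] (acc, listCode c as ++ r, false) =
        ((as.map g).reverse ++ acc, r, true) := by
    intro as
    induction as with
    | nil =>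
      rintro acc (_ | n) hn
      · simp at hn
      · rw [Function.iterate_succ_apply]
        exact h₁ n acc r
    | cons a as ih =>
      rintro acc (_ | n) hn
      · simp at hn
      · rw [Function.iterate_succ_apply]
        have h₂ : parseListStep item (acc, listCode c (a :: as) ++ r, false) =
            (g a :: acc, listCode c as ++ r, false) := by
          simp [parseListStep, listCode, h]
        rw [h₂, ih _ n (by simpa using hn)]
        simp
  simp only [parseList, List.foldl_const]
  rw [key as [] _ ((length_lt_length_listCode c as).trans_le (by simp))]
  simp

variable [Enc α]

theorem sz_tail_le {l : List α} : sz l.tail ≤ sz l := by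
  cases l <;> simp only [List.tail_nil, List.tail_cons, sz_cons] <;> omega

theorem sz_snd_parseListStep_le {item : Bits → α × Bits} (h : ∀ l, sz (item l).2 ≤ sz l)
    (s : List α × Bits × Bool) : sz (parseListStep item s).2.1 ≤ sz s.2.1 := by
  unfold parseListStep
  split_ifs
  · exact le_rfl
  · exact (h _).trans sz_tail_le
  · exact sz_tail_le

theorem sz_snd_parseList_le {item : Bits → α × Bits} (h : ∀ l, sz (item l).2 ≤ sz l) (l : Bits) :
    sz (parseList item l).2 ≤ sz l := by
  have key : ∀ (l' : Bits) (s : List α × Bits × Bool),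
      sz (l'.foldl (fun s _ => parseListStep item s) s).2.1 ≤ sz s.2.1 := by
    intro l'
    induction l' with
    | nil => intro s; exact le_rfl
    | cons b l' ih => intro s; exact (ih _).trans (sz_snd_parseListStep_le h s)
  exact key l _

/-- The unread rest never grows, by hypothesis `h`. Hence every item is parsed from a string no
larger than the input, and the accumulated list grows by a polynomially bounded amount in each step.
-/
theorem poly_parseList {item : Bits → α × Bits} (hi : PolyFun item) (h : ∀ l, sz (item l).2 ≤ sz l) :
    PolyFun (parseList item) := by
  obtain ⟨e, he⟩ := hi.fst.sz
  have hstep : PolyFun (parseListStep item) :=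
    .ite PolyFun.id.snd.snd .id (.ite (PolyFun.id.snd.fst.headD (.const false))
      (((hi.comp PolyFun.id.snd.fst.tail).fst.cons PolyFun.id.fst).pair
        ((hi.comp PolyFun.id.snd.fst.tail).snd.pair (.const false)))
      (PolyFun.id.fst.pair (PolyFun.id.snd.fst.tail.pair (.const true))))
  have hfold : PolyFun fun l : Bits =>
      l.foldl (fun s _ => parseListStep item s) (([] : List α), l, false) := by
    refine PolyFun.foldl (step := fun _ s _ => parseListStep item s)
      (B := fun l => l.length * ((sz l + 2) ^ e + 1) + sz l + 6) .id
      ((PolyFun.const []).pair (PolyFun.id.pair (.const false))) (hstep.comp PolyFun.id.snd.fst)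
      ((((PolyBdd.sz.mono fun l => (length_le_sz l).le).mul
        (((PolyBdd.sz.add (.const 2)).pow e).add (.const 1))).add .sz).add (.const 6))
      fun l l₁ l₂ hl => ?_
    have key : ∀ (l₁ : Bits) (s : List α × Bits × Bool), sz s.2.1 ≤ sz l →
        sz (l₁.foldl (fun s _ => parseListStep item s) s).2.1 ≤ sz l ∧
        sz (l₁.foldl (fun s _ => parseListStep item s) s).1 ≤
          l₁.length * ((sz l + 2) ^ e + 1) + sz s.1 := by
      intro l₁
      induction l₁ with
      | nil => intro s hs; exact ⟨hs, by simp⟩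
      | cons b l₁ ih =>
        intro s hs
        obtain ⟨h₁, h₂⟩ := ih (parseListStep item s) ((sz_snd_parseListStep_le h s).trans hs)
        refine ⟨h₁, h₂.trans ?_⟩
        have h₃ : sz (parseListStep item s).1 ≤ (sz l + 2) ^ e + 1 + sz s.1 := by
          unfold parseListStep
          split_ifs
          · omega
          · have h₄ : sz (item s.2.1.tail).1 ≤ (sz l + 2) ^ e :=
              (he _).trans (Nat.pow_le_pow_left (by
                have := sz_tail_le (l := s.2.1)
                omega) e)
            simp only [sz_cons]
            omega
          · simp only
            omega
        simp only [List.length_cons, add_mul]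
        omega
    obtain ⟨h₁, h₂⟩ := key l₁ ([], l, false) le_rfl
    have h₃ : l₁.length ≤ l.length := by rw [hl]; simp
    have h₄ : l₁.length * ((sz l + 2) ^ e + 1) ≤ l.length * ((sz l + 2) ^ e + 1) := by gcongr
    rw [sz_prod, sz_prod]
    have h₅ := sz_bool_le (l₁.foldl (fun s _ => parseListStep item s) ([], l, false)).2.2
    simp only [sz_nil] at h₂
    omega
  exact hfold.fst.reverse.pair hfold.snd.fst

end ListParser

/-- Reads a unary numeral. -/
def parseUnary (l : Bits) : ℕ × Bits :=
  ((parseList (fun l => ((), l)) l).1.length, (parseList (fun l => ((), l)) l).2)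

/-- Reads the binary digits of a number. -/
def parseBits : Bits → Bits × Bits := parseList fun l => (l.headD false, l.tail)

theorem parseUnary_unaryCode (n : ℕ) (r : Bits) : parseUnary (unaryCode n ++ r) = (n, r) := by
  -- A unary numeral is the code of a list of units whose items have empty codes.
  have h₁ : unaryCode n = listCode (fun _ : Unit => []) (List.replicate n ()) := by
    induction n with
    | zero => rfl
    | succ n ih =>
      rw [List.replicate_succ, listCode, ← ih]
      rfl
  rw [parseUnary, h₁, parseList_listCode (g := fun _ => ()) (fun _ _ => rfl)]
  simp

theorem parseBits_natCode (n : ℕ) (r : Bits) : parseBits (natCode n ++ r) = (n.bits, r) := by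
  rw [parseBits, natCode, parseList_listCode (g := fun b => b) (fun _ _ => rfl)]
  simp

theorem sz_snd_parseUnary_le (l : Bits) : sz (parseUnary l).2 ≤ sz l :=
  sz_snd_parseList_le (fun _ => le_rfl) l

theorem sz_snd_parseBits_le (l : Bits) : sz (parseBits l).2 ≤ sz l :=
  sz_snd_parseList_le (fun _ => sz_tail_le) l

theorem poly_parseUnary : PolyFun parseUnary :=
  have h := poly_parseList (item := fun l => ((), l)) ((PolyFun.const ()).pair .id) fun _ => le_rfl
  h.fst.length.pair h.snd

theorem poly_parseBits : PolyFun parseBits :=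
  poly_parseList ((PolyFun.id.headD (.const false)).pair PolyFun.id.tail) fun _ => sz_tail_le

theorem sz_fst_parseBits_le (l : Bits) : sz (parseBits l).1 ≤ 4 * sz l + 1 := by
  have key : ∀ (l' : Bits) (s : Bits × Bits × Bool),
      (l'.foldl (fun s _ => parseListStep (fun l => (l.headD false, l.tail)) s) s).1.length ≤
        l'.length + s.1.length := by
    intro l'
    induction l' with
    | nil => intro s; simp
    | cons b l' ih =>
      intro s
      refine (ih _).trans ?_
      have : (parseListStep (fun l => (l.headD false, l.tail)) s).1.length ≤ s.1.length + 1 := by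
        unfold parseListStep
        split_ifs <;> simp
      simp only [List.length_cons]
      omega
  have h₁ := key l ([], l, false)
  have h₂ := length_le_sz l
  have h₃ := sz_le_of_forall (l := (parseBits l).1) (B := 3) fun b _ => sz_bool_le b
  have h₄ : (parseBits l).1.length ≤ l.length := by
    simpa [parseBits, parseList] using h₁
  omega

/-- An edge of the graph, with the digits of its letter and its data value. -/
abbrev Edge := ℕ × Bits × Bits × ℕ

def parseEdge (l : Bits) : Edge × Bits :=
  let u := parseUnary l
  let a := parseBits u.2
  let d := parseBits a.2
  let v := parseUnary d.2
  ((u.1, a.1, d.1, v.1), v.2)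

def parseBinding (l : Bits) : (Bits × Bits) × Bits :=
  let x := parseBits l
  let d := parseBits x.2
  ((x.1, d.1), d.2)

theorem parseEdge_edgeCode {n : ℕ} (e : Fin n × ℕ × ℕ × Fin n) (r : Bits) :
    parseEdge (edgeCode e ++ r) = ((e.1.val, e.2.1.bits, e.2.2.1.bits, e.2.2.2.val), r) := by
  simp [parseEdge, edgeCode, parseUnary_unaryCode, parseBits_natCode]

theorem parseBinding_bindingCode (p : ℕ × ℕ) (r : Bits) :
    parseBinding (bindingCode p ++ r) = ((p.1.bits, p.2.bits), r) := by
  simp [parseBinding, bindingCode, parseBits_natCode]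

theorem sz_snd_parseEdge_le (l : Bits) : sz (parseEdge l).2 ≤ sz l :=
  (sz_snd_parseUnary_le _).trans ((sz_snd_parseBits_le _).trans
    ((sz_snd_parseBits_le _).trans (sz_snd_parseUnary_le _)))

theorem sz_snd_parseBinding_le (l : Bits) : sz (parseBinding l).2 ≤ sz l :=
  (sz_snd_parseBits_le _).trans (sz_snd_parseBits_le _)

theorem poly_parseEdge : PolyFun parseEdge :=
  have hu := poly_parseUnary
  have ha := poly_parseBits.comp hu.snd
  have hd := poly_parseBits.comp ha.snd
  have hv := poly_parseUnary.comp hd.snd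
  (hu.fst.pair (ha.fst.pair (hd.fst.pair hv.fst))).pair hv.snd

theorem poly_parseBinding : PolyFun parseBinding :=
  have hx := poly_parseBits
  have hd := poly_parseBits.comp hx.snd
  (hx.fst.pair hd.fst).pair hd.snd

/-! ### From expressions to automata -/

/-- Actions of transitions: a flag for `ε`, a flag for reading a letter, the polarity of a literal,
the slot that its variable is bound to (if any), and the name of the letter or variable. -/
abbrev Act := Bool × Bool × Bool × List ℕ × Bits

def Act.eps : Act := (true, false, false, [], [])
def Act.read (a : Bits) : Act := (false, true, false, [], a)
def Act.lit (pol : Bool) (slots : List ℕ) (x : Bits) : Act := (false, false, pol, slots, x)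

/-- A transition: its source, its target, and its action. -/
abbrev Trans := ℕ × ℕ × Act

/-- The slots that bound variables refer to. -/
abbrev Env := List (Bits × ℕ)

/-- An expression or a condition (if the flag is set) whose code remains to be read, the polarity
of the condition, the states between which its automaton is to be inserted, and the environment. -/
abbrev Task := Bool × Bool × ℕ × ℕ × Env

/-- The value of `x` in an association list, as a list of length at most one. -/
def lookupAll {β : Type} (env : List (Bits × β)) (x : Bits) : List β :=
  ((env.filter fun e => e.1 == x).take 1).map fun e => e.2

/-- Reads the first symbol of a condition; the result consists of the new tasks, the rest of the
input and the new transitions. -/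
def expandCond (i : ℕ) (o : Task) (l : Bits) : List Task × Bits × List Trans :=
  let b := if l.tail.tail.headD false then !o.2.1 else o.2.1
  let r := l.tail.tail.tail
  let p := o.2.2.1
  let q := o.2.2.2.1
  let env := o.2.2.2.2
  if l.headD false then ([(true, !o.2.1, p, q, env)], r, [])
  else if l.tail.headD false then
    if b then ([(true, o.2.1, p, 2 * i + 2, env), (true, o.2.1, 2 * i + 2, q, env)], r, [])
    else ([(true, o.2.1, p, q, env), (true, o.2.1, p, q, env)], r, [])
  else ([], (parseBits r).2, [(p, q, Act.lit b (lookupAll env (parseBits r).1) (parseBits r).1)])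

/-- Reads the first symbol of an expression. -/
def expandQuery (i : ℕ) (o : Task) (l : Bits) : List Task × Bits × List Trans :=
  let b := l.tail.tail.headD false
  let r := l.tail.tail.tail
  let p := o.2.2.1
  let q := o.2.2.2.1
  let env := o.2.2.2.2
  let m := 2 * i + 2
  let a := parseBits r
  let x := parseBits a.2
  if l.headD false then
    if l.tail.headD false then
      ([(false, true, m + 1, q, (x.1, i) :: env)], x.2,
        [(p, m, Act.read a.1), (m, m + 1, Act.lit true [i] x.1)])
    else if b then ([(false, true, m, m, env)], r, [(p, m, Act.eps), (m, q, Act.eps)])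
    else ([(false, true, p, m, env), (false, true, m, q, env)], r, [])
  else if l.tail.headD false then
    if b then ([(false, true, p, q, env), (false, true, p, q, env)], r, [])
    else ([(true, true, m, q, env)], a.2, [(p, m, Act.read a.1)])
  else if b then ([], a.2, [(p, q, Act.read a.1)])
  else ([], r, [(p, q, Act.eps)])

def expand (i : ℕ) (o : Task) (l : Bits) : List Task × Bits × List Trans :=
  if o.1 then expandCond i o l else expandQuery i o l

/-- The state of the translation: the stack of tasks, the rest of the input, the transitions found
so far, and the number of symbols read so far. -/
abbrev TransState := List Task × Bits × List Trans × ℕ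

def noTask : Task := (false, false, 0, 0, [])

/-- Each step consumes one symbol of the prefix notation. The topmost task always belongs to the
subexpression that starts at the current position. The symbol with number `i` owns the states `2 * i
+ 2` and `2 * i + 3`, while `0` and `1` are initial and final; so no bookkeeping of fresh names is
needed. -/
def translateStep (s : TransState) : TransState :=
  if s.1.isEmpty then s
  else
    let e := expand s.2.2.2 (s.1.headD noTask) s.2.1
    (e.1 ++ s.1.tail, e.2.1, e.2.2 ++ s.2.2.1, s.2.2.2 + 1)

/-- Reads the code of an expression; the result consists of the transitions of its automaton, with
initial state `0` and final state `1`, and the rest of the input. -/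
def translate (l : Bits) : List Trans × Bits :=
  let s := l.foldl (fun s _ => translateStep s) ([(false, true, 0, 1, [])], l, [], 0)
  (s.2.2.1, s.2.1)

-- The translation runs in polynomial time

theorem poly_lookupAll {γ β : Type} [Enc γ] [Enc β] {env : γ → List (Bits × β)} {x : γ → Bits} (he : PolyFun env)
    (hx : PolyFun x) : PolyFun fun y => lookupAll (env y) (x y) := by
  refine PolyFun.map (f := fun _ (e : Bits × β) => e.2) (PolyFun.takeOne ?_) PolyFun.id.snd.snd
  exact PolyFun.filter (f := fun y e => e.1 == x y) he (PolyFun.beqBits PolyFun.id.snd.fst (hx.comp PolyFun.id.fst))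

theorem poly_lit {γ : Type} [Enc γ] {b : γ → Bool} {s : γ → List ℕ} {x : γ → Bits} (hb : PolyFun b)
    (hs : PolyFun s) (hx : PolyFun x) : PolyFun fun y => Act.lit (b y) (s y) (x y) :=
  (PolyFun.const false).pair ((PolyFun.const false).pair (hb.pair (hs.pair hx)))

theorem poly_read {γ : Type} [Enc γ] {x : γ → Bits} (hx : PolyFun x) : PolyFun fun y => Act.read (x y) :=
  (PolyFun.const false).pair ((PolyFun.const true).pair ((PolyFun.const false).pair ((PolyFun.const []).pair hx)))

theorem poly_two_mul_add_two {γ : Type} [Enc γ] {n : γ → ℕ} (hn : PolyFun n) :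
    PolyFun fun y => 2 * n y + 2 :=
  ((PolyFun.const 2).mul hn).add (.const 2)

theorem poly_task {γ : Type} [Enc γ] {a b : γ → Bool} {p q : γ → ℕ} {env : γ → Env} (ha : PolyFun a)
    (hb : PolyFun b) (hp : PolyFun p) (hq : PolyFun q) (he : PolyFun env) :
    PolyFun fun y => ((a y, b y, p y, q y, env y) : Task) :=
  ha.pair (hb.pair (hp.pair (hq.pair he)))

theorem poly_trans {γ : Type} [Enc γ] {p q : γ → ℕ} {a : γ → Act} (hp : PolyFun p) (hq : PolyFun q)
    (ha : PolyFun a) : PolyFun fun y => ((p y, q y, a y) : Trans) :=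
  hp.pair (hq.pair ha)

theorem poly_expandCond : PolyFun fun x : ℕ × Task × Bits => expandCond x.1 x.2.1 x.2.2 := by
  have hi : PolyFun fun x : ℕ × Task × Bits => x.1 := PolyFun.id.fst
  have ho : PolyFun fun x : ℕ × Task × Bits => x.2.1 := PolyFun.id.snd.fst
  have hl : PolyFun fun x : ℕ × Task × Bits => x.2.2 := PolyFun.id.snd.snd
  have hr := hl.tail.tail.tail
  have hp := ho.snd.snd.fst
  have hq := ho.snd.snd.snd.fst
  have he := ho.snd.snd.snd.snd
  have hm := poly_two_mul_add_two hi
  have hx := poly_parseBits.comp hr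
  have hb := PolyFun.ite (hl.tail.tail.headD (.const false)) ho.snd.fst.not ho.snd.fst
  refine PolyFun.ite (hl.headD (.const false)) ?_ (PolyFun.ite (hl.tail.headD (.const false))
    (PolyFun.ite hb ?_ ?_) ?_)
  · exact ((poly_task (.const true) ho.snd.fst.not hp hq he).cons (.const [])).pair
      (hr.pair (.const []))
  · exact ((poly_task (.const true) ho.snd.fst hp hm he).cons
      ((poly_task (.const true) ho.snd.fst hm hq he).cons (.const []))).pair (hr.pair (.const []))
  · exact ((poly_task (.const true) ho.snd.fst hp hq he).cons
      ((poly_task (.const true) ho.snd.fst hp hq he).cons (.const []))).pair (hr.pair (.const []))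
  · exact (PolyFun.const []).pair (hx.snd.pair
      ((poly_trans hp hq (poly_lit hb (poly_lookupAll he hx.fst) hx.fst)).cons (.const [])))

theorem poly_expandQuery : PolyFun fun x : ℕ × Task × Bits => expandQuery x.1 x.2.1 x.2.2 := by
  have hi : PolyFun fun x : ℕ × Task × Bits => x.1 := PolyFun.id.fst
  have ho : PolyFun fun x : ℕ × Task × Bits => x.2.1 := PolyFun.id.snd.fst
  have hl : PolyFun fun x : ℕ × Task × Bits => x.2.2 := PolyFun.id.snd.snd
  have hb := hl.tail.tail.headD (.const false)
  have hr := hl.tail.tail.tail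
  have hp := ho.snd.snd.fst
  have hq := ho.snd.snd.snd.fst
  have he := ho.snd.snd.snd.snd
  have hm := poly_two_mul_add_two hi
  have ha := poly_parseBits.comp hr
  have hx := poly_parseBits.comp ha.snd
  have hq₀ : ∀ {p q : ℕ × Task × Bits → ℕ} {env : ℕ × Task × Bits → Env}, PolyFun p → PolyFun q →
      PolyFun env → PolyFun fun x => ((false, true, p x, q x, env x) : Task) :=
    fun hp hq he => poly_task (.const false) (.const true) hp hq he
  refine PolyFun.ite (hl.headD (.const false))
    (PolyFun.ite (hl.tail.headD (.const false)) ?_ (PolyFun.ite hb ?_ ?_))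
    (PolyFun.ite (hl.tail.headD (.const false)) (PolyFun.ite hb ?_ ?_) (PolyFun.ite hb ?_ ?_))
  · exact ((hq₀ hm.succ hq ((hx.fst.pair hi).cons he)).cons (.const [])).pair (hx.snd.pair
      ((poly_trans hp hm (poly_read ha.fst)).cons ((poly_trans hm hm.succ
        (poly_lit (.const true) (hi.cons (.const [])) hx.fst)).cons (.const []))))
  · exact ((hq₀ hm hm he).cons (.const [])).pair (hr.pair
      ((poly_trans hp hm (.const _)).cons ((poly_trans hm hq (.const _)).cons (.const []))))
  · exact ((hq₀ hp hm he).cons ((hq₀ hm hq he).cons (.const []))).pair (hr.pair (.const []))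
  · exact ((hq₀ hp hq he).cons ((hq₀ hp hq he).cons (.const []))).pair (hr.pair (.const []))
  · exact ((poly_task (.const true) (.const true) hm hq he).cons (.const [])).pair (ha.snd.pair
      ((poly_trans hp hm (poly_read ha.fst)).cons (.const [])))
  · exact (PolyFun.const []).pair (ha.snd.pair
      ((poly_trans hp hq (poly_read ha.fst)).cons (.const [])))
  · exact (PolyFun.const []).pair (hr.pair ((poly_trans hp hq (.const _)).cons (.const [])))

theorem poly_translateStep : PolyFun translateStep := by
  have hs : PolyFun fun s : TransState => s := .id
  have he : PolyFun fun s : TransState => expand s.2.2.2 (s.1.headD noTask) s.2.1 := by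
    have h : PolyFun fun x : ℕ × Task × Bits => expand x.1 x.2.1 x.2.2 :=
      PolyFun.ite PolyFun.id.snd.fst.fst poly_expandCond poly_expandQuery
    exact h.comp (hs.snd.snd.snd.pair ((hs.fst.headD (.const _)).pair hs.snd.fst))
  exact PolyFun.ite hs.fst.isEmpty hs ((he.fst.append hs.fst.tail).pair (he.snd.fst.pair
    ((he.snd.snd.append hs.snd.snd.fst).pair hs.snd.snd.snd.succ)))

theorem sz_lookupAll_le (env : Env) (x : Bits) : sz (lookupAll env x) ≤ sz env := by
  unfold lookupAll
  induction env with
  | nil => simp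
  | cons e env ih =>
    by_cases h : e.1 == x
    · have := one_le_sz env
      have := one_le_sz e.1
      simp only [List.filter_cons, h, if_true, List.take_succ_cons, List.take_zero, List.map_cons,
        List.map_nil, sz_cons, sz_nil, sz_prod]
      omega
    · simp only [List.filter_cons, h, sz_cons]
      simp only [Bool.false_eq_true, if_false]
      omega

/-- How much a new task or transition may exceed the task that it comes from. -/
def growth (i : ℕ) (l : Bits) : ℕ := 12 * i + 4 * sz l + 80

/-- A task carries its environment with it, so its children are larger. The increase is additive, by
at most `growth`; over polynomially many steps this gives a polynomial bound, where a multiplicative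
increase would not. -/
theorem expand_bounds (i : ℕ) (o : Task) (l : Bits) :
    (expand i o l).1.length ≤ 2 ∧ (expand i o l).2.2.length ≤ 2 ∧
      sz (expand i o l).2.1 ≤ sz l ∧
      (∀ o' ∈ (expand i o l).1, sz o' ≤ sz o + growth i l) ∧
      (∀ t ∈ (expand i o l).2.2, sz t ≤ sz o + growth i l) := by
  obtain ⟨c, pol, p, q, env⟩ := o
  have h₀ : sz l.tail.tail.tail ≤ sz l := sz_tail_le.trans (sz_tail_le.trans sz_tail_le)
  have h₁ := sz_snd_parseBits_le l.tail.tail.tail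
  have h₂ := sz_fst_parseBits_le l.tail.tail.tail
  have h₃ := sz_snd_parseBits_le (parseBits l.tail.tail.tail).2
  have h₄ := sz_fst_parseBits_le (parseBits l.tail.tail.tail).2
  have h₅ := sz_lookupAll_le env (parseBits l.tail.tail.tail).1
  have h₆ := fun b => sz_bool_le b
  have h₇ := h₆ pol
  have h₈ := h₆ (!pol)
  have h₉ := one_le_sz pol
  have h₁₀ := one_le_sz c
  have h₁₁ := h₆ true
  have h₁₂ := h₆ false
  unfold expand
  split_ifs
  · unfold expandCond
    dsimp only
    have h₁₃ := h₆ (if l.tail.tail.headD false then !pol else pol)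
    split_ifs <;>
      simp only [List.length_cons, List.length_nil, List.mem_cons, List.not_mem_nil, or_false,
        forall_eq_or_imp, forall_eq, sz_prod, sz_nat, Act.lit, growth,
        IsEmpty.forall_iff, implies_true, and_true, true_and] <;> omega
  · unfold expandQuery
    dsimp only
    split_ifs <;>
      simp only [List.length_cons, List.length_nil, List.mem_cons, List.not_mem_nil, or_false,
        forall_eq_or_imp, forall_eq, sz_prod, sz_cons, sz_nil, sz_nat, Act.lit, Act.read, Act.eps,
        growth, IsEmpty.forall_iff, implies_true, and_true, true_and] <;> omega

theorem poly_translate : PolyFun translate := by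
  have hfold : PolyFun fun l : Bits => l.foldl (fun s _ => translateStep s)
      (([(false, true, 0, 1, [])], l, [], 0) : TransState) := by
    refine PolyFun.foldl (step := fun _ s _ => translateStep s)
      (B := fun l => ((l.length + 1) * (l.length * (16 * sz l + 80) + 31) + 1) +
        (2 * l.length * (l.length * (16 * sz l + 80) + 31) + 1) + 3 * sz l + 4) .id
      ((PolyFun.const [(false, true, 0, 1, [])]).pair (PolyFun.id.pair ((PolyFun.const []).pair (.const 0))))
      (poly_translateStep.comp PolyFun.id.snd.fst) ?_ fun l l₁ l₂ hl => ?_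
    · have hlen : PolyBdd fun l : Bits => l.length := PolyBdd.sz.mono fun l => (length_le_sz l).le
      have h₁ : PolyBdd fun l : Bits => l.length * (16 * sz l + 80) + 31 :=
        (hlen.mul (((PolyBdd.const 16).mul .sz).add (.const 80))).add (.const 31)
      exact ((((((hlen.add (.const 1)).mul h₁).add (.const 1)).add
        ((((PolyBdd.const 2).mul hlen).mul h₁).add (.const 1))).add
        ((PolyBdd.const 3).mul .sz)).add (.const 4))
    -- This dominates `growth i r` at every step, as the number `i` of symbols read is below `sz l`
    -- and the rest `r` is no larger than the input.
    have hG : ∃ G, G = 16 * sz l + 80 := ⟨_, rfl⟩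
    obtain ⟨G, hG⟩ := hG
    rw [← hG]
    have hlen := length_le_sz l
    -- A step removes one task and adds at most two tasks and two transitions, each exceeding the
    -- removed task by at most `G`. The constant `30` covers the initial task.
    have key : ∀ n ≤ l.length, ∀ s : TransState,
        s = translateStep^[n] ([(false, true, 0, 1, [])], l, [], 0) →
        s.1.length ≤ n + 1 ∧ s.2.2.1.length ≤ 2 * n ∧ sz s.2.1 ≤ sz l ∧ s.2.2.2 ≤ n ∧
        (∀ o ∈ s.1, sz o ≤ n * G + 30) ∧ (∀ t ∈ s.2.2.1, sz t ≤ n * G + 30) := by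
      intro n
      induction n with
      | zero =>
        rintro - s rfl
        refine ⟨by simp, by simp, le_rfl, by simp, ?_, by simp⟩
        have h₁ := sz_bool_le false
        have h₂ := sz_bool_le true
        simp only [Function.iterate_zero, id_eq, List.mem_cons, List.not_mem_nil, or_false,
          forall_eq, sz_prod, sz_nat, sz_nil]
        omega
      | succ n ih =>
        intro hn s hs
        obtain ⟨h₁, h₂, h₃, h₄, h₅, h₆⟩ := ih (by omega) _ rfl
        rw [Function.iterate_succ_apply'] at hs
        generalize translateStep^[n] ([(false, true, 0, 1, [])], l, [], 0) = s₀ at *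
        obtain ⟨_ | ⟨o, st⟩, r, ts, i⟩ := s₀
        · simp only [translateStep, List.isEmpty_nil, if_true] at hs
          subst hs
          simp only [add_mul]
          dsimp only at h₂ h₄
          refine ⟨by simp, by omega, h₃, by omega, by simp, fun t ht => ?_⟩
          have := h₆ t ht
          omega
        · obtain ⟨b₁, b₂, b₃, b₄, b₅⟩ := expand_bounds i o r
          simp only [translateStep, List.isEmpty_cons, Bool.false_eq_true, if_false,
            List.headD_cons, List.tail_cons] at hs
          subst hs
          simp only [List.length_cons] at h₁ h₂ h₃ h₄ h₅ h₆
          have hg : growth i r ≤ G := by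
            unfold growth
            omega
          have ho := h₅ o (by simp)
          refine ⟨by simp; omega, by simp; omega, b₃.trans h₃, by simpa using h₄, ?_, ?_⟩
          · intro o' ho'
            rw [add_mul]
            rcases List.mem_append.1 ho' with h | h
            · have := b₄ o' h
              omega
            · have := h₅ o' (by simp [h])
              omega
          · intro t ht
            rw [add_mul]
            rcases List.mem_append.1 ht with h | h
            · have := b₅ t h
              omega
            · have := h₆ t h
              omega
    have hl₁ : l₁.length ≤ l.length := by rw [hl]; simp
    rw [List.foldl_const]
    obtain ⟨h₁, h₂, h₃, h₄, h₅, h₆⟩ := key l₁.length hl₁ _ rfl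
    have h₇ := sz_le_of_forall h₅
    have h₈ := sz_le_of_forall h₆
    generalize translateStep^[l₁.length] ([(false, true, 0, 1, [])], l, [], 0) = s at *
    have h₁₁ : l₁.length * G ≤ l.length * G := Nat.mul_le_mul_right G hl₁
    have h₉ : s.1.length * (l₁.length * G + 30 + 1) ≤ (l.length + 1) * (l.length * G + 31) :=
      Nat.mul_le_mul (by omega) (by omega)
    have h₁₀ : s.2.2.1.length * (l₁.length * G + 30 + 1) ≤
        2 * l.length * (l.length * G + 31) :=
      Nat.mul_le_mul (by omega) (by omega)
    simp only [sz_prod, sz_nat]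
    omega
  exact hfold.snd.snd.fst.pair hfold.snd.fst

end EvalReduction

namespace EvalReduction

open PolyTime DataQuery

/-! ### The transitions of an expression -/

/-- The transitions for a condition with the given polarity, if its first symbol has number `i`. -/
def condTrans : Cond ℕ → Env → Bool → ℕ → ℕ → ℕ → List Trans
  | .eq x, env, pol, p, q, _ => [(p, q, Act.lit pol (lookupAll env x.bits) x.bits)]
  | .ne x, env, pol, p, q, _ => [(p, q, Act.lit (!pol) (lookupAll env x.bits) x.bits)]
  | .and c d, env, pol, p, q, i =>
    if pol then condTrans d env pol (2 * i + 2) q (i + 1 + c.size) ++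
      condTrans c env pol p (2 * i + 2) (i + 1)
    else condTrans d env pol p q (i + 1 + c.size) ++ condTrans c env pol p q (i + 1)
  | .or c d, env, pol, p, q, i =>
    if pol then condTrans d env pol p q (i + 1 + c.size) ++ condTrans c env pol p q (i + 1)
    else condTrans d env pol (2 * i + 2) q (i + 1 + c.size) ++
      condTrans c env pol p (2 * i + 2) (i + 1)
  | .not c, env, pol, p, q, i => condTrans c env (!pol) p q (i + 1)

/-- The transitions for an expression, if its first symbol has number `i`. -/
def queryTrans : REWB ℕ ℕ → Env → ℕ → ℕ → ℕ → List Trans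
  | .eps, _, p, q, _ => [(p, q, Act.eps)]
  | .letter a, _, p, q, _ => [(p, q, Act.read a.bits)]
  | .test a c, env, p, q, i =>
    condTrans c env true (2 * i + 2) q (i + 1) ++ [(p, 2 * i + 2, Act.read a.bits)]
  | .union r s, env, p, q, i =>
    queryTrans s env p q (i + 1 + r.size) ++ queryTrans r env p q (i + 1)
  | .concat r s, env, p, q, i =>
    queryTrans s env (2 * i + 2) q (i + 1 + r.size) ++ queryTrans r env p (2 * i + 2) (i + 1)
  | .star r, env, p, q, i =>
    queryTrans r env (2 * i + 2) (2 * i + 2) (i + 1) ++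
      [(p, 2 * i + 2, Act.eps), (2 * i + 2, q, Act.eps)]
  | .bind a x r, env, p, q, i =>
    queryTrans r ((x.bits, i) :: env) (2 * i + 3) q (i + 1) ++
      [(p, 2 * i + 2, Act.read a.bits), (2 * i + 2, 2 * i + 3, Act.lit true [i] x.bits)]

theorem iterate_translateStep_cond (c : Cond ℕ) (env : Env) (pol : Bool) (p q : ℕ)
    (st : List Task) (r : Bits) (ts : List Trans) (i : ℕ) :
    translateStep^[c.size] ((true, pol, p, q, env) :: st, condCode c ++ r, ts, i) =
      (st, r, condTrans c env pol p q i ++ ts, i + c.size) := by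
  induction c generalizing pol p q st r ts i with
  | eq x | ne x =>
    cases pol <;>
    simp [Cond.size, translateStep, expand, expandCond, condCode, condTrans, parseBits_natCode]
  | and c d ihc ihd | or c d ihc ihd =>
    have hs : 1 + c.size + d.size = d.size + (c.size + 1) := by omega
    have hi : i + (d.size + (c.size + 1)) = i + 1 + c.size + d.size := by omega
    rw [Cond.size, hs, Function.iterate_add_apply, Function.iterate_succ_apply, hi]
    cases pol <;>
    simp [translateStep, expand, expandCond, condCode, condTrans, ihc, ihd]
  | not c ih =>
    rw [Cond.size, add_comm, Function.iterate_succ_apply, add_comm c.size, ← add_assoc]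
    simp [translateStep, expand, expandCond, condCode, condTrans, ih]

/-- The recursive description `queryTrans` is what the stack machine computes. Exactly `e.size`
steps process `e` and leave the tasks below it untouched; this is what makes the induction go
through for the second operand of a binary operator. -/
theorem iterate_translateStep_query (e : REWB ℕ ℕ) (env : Env) (p q : ℕ)
    (st : List Task) (r : Bits) (ts : List Trans) (i : ℕ) :
    translateStep^[e.size] ((false, true, p, q, env) :: st, queryCode e ++ r, ts, i) =
      (st, r, queryTrans e env p q i ++ ts, i + e.size) := by
  induction e generalizing env p q st r ts i with
  | eps =>
    simp [REWB.size, translateStep, expand, expandQuery, queryCode, queryTrans]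
  | letter a =>
    simp [REWB.size, translateStep, expand, expandQuery, queryCode, queryTrans, parseBits_natCode]
  | test a c =>
    rw [REWB.size, add_comm, Function.iterate_succ_apply, add_comm c.size, ← add_assoc]
    simp [translateStep, expand, expandQuery, queryCode, queryTrans, parseBits_natCode,
      iterate_translateStep_cond]
  | union c d ihc ihd | concat c d ihc ihd =>
    have hs : 1 + c.size + d.size = d.size + (c.size + 1) := by omega
    have hi : i + (d.size + (c.size + 1)) = i + 1 + c.size + d.size := by omega
    rw [REWB.size, hs, Function.iterate_add_apply, Function.iterate_succ_apply, hi]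
    simp [translateStep, expand, expandQuery, queryCode, queryTrans, ihc, ihd]
  | star c ih =>
    rw [REWB.size, add_comm, Function.iterate_succ_apply, add_comm c.size, ← add_assoc]
    simp [translateStep, expand, expandQuery, queryCode, queryTrans, ih]
  | bind a x c ih =>
    rw [REWB.size, add_comm, Function.iterate_succ_apply, add_comm c.size, ← add_assoc]
    simp [translateStep, expand, expandQuery, queryCode, queryTrans, ih, parseBits_natCode]

theorem cond_size_le (c : Cond ℕ) : c.size ≤ (condCode c).length := by
  induction c <;> simp [Cond.size, condCode] <;> omega

theorem query_size_le (e : REWB ℕ ℕ) : e.size ≤ (queryCode e).length := by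
  induction e with
  | test a c => have := cond_size_le c; simp [REWB.size, queryCode]; omega
  | _ => simp [REWB.size, queryCode] <;> omega

/-- The expression has at most as many symbols as its code has bits, so the clock suffices; with no
task left, the remaining steps do nothing. -/
theorem translate_queryCode (e : REWB ℕ ℕ) (r : Bits) :
    translate (queryCode e ++ r) = (queryTrans e [] 0 1 0, r) := by
  have h := iterate_translateStep_query e [] 0 1 [] r [] 0
  obtain ⟨n, hn⟩ : ∃ n, (queryCode e ++ r).length = n + e.size :=
    ⟨(queryCode e ++ r).length - e.size, by
      have := query_size_le e
      simp only [List.length_append]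
      omega⟩
  have h₁ : ∀ n (l : Bits) (ts : List Trans) (i : ℕ),
      translateStep^[n] ([], l, ts, i) = ([], l, ts, i) := fun n l ts i =>
    Function.iterate_fixed rfl n
  simp only [translate, List.foldl_const]
  rw [hn, Function.iterate_add_apply, h, h₁]
  simp

theorem lt_of_mem_condTrans {c : Cond ℕ} {env : Env} {pol : Bool} {p q i : ℕ} {t : Trans}
    (hp : p < 2 * i + 2) (hq : q < 2 * i + 2) (ht : t ∈ condTrans c env pol p q i) :
    t.1 < 2 * (i + c.size) + 2 ∧ t.2.1 < 2 * (i + c.size) + 2 := by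
  induction c generalizing pol p q i with
  | eq x | ne x =>
    simp only [condTrans, List.mem_singleton] at ht
    subst ht
    simp only [Cond.size]
    omega
  | and c d ihc ihd | or c d ihc ihd =>
    simp only [Cond.size]
    simp only [condTrans] at ht
    split_ifs at ht
    all_goals
      rcases List.mem_append.1 ht with h | h
      · have := ihd (by omega) (by omega) h
        omega
      · have := ihc (by omega) (by omega) h
        omega
  | not c ih =>
    have := ih (by omega) (by omega) ht
    simp only [Cond.size]
    omega

/-- States of a subexpression stay below those owned by symbols that follow it. This separates the
subautomata of two operands, and it bounds the number of states of the whole automaton by `2 *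
e.size + 2`. -/
theorem lt_of_mem_queryTrans {e : REWB ℕ ℕ} {env : Env} {p q i : ℕ} {t : Trans}
    (hp : p < 2 * i + 2) (hq : q < 2 * i + 2) (ht : t ∈ queryTrans e env p q i) :
    t.1 < 2 * (i + e.size) + 2 ∧ t.2.1 < 2 * (i + e.size) + 2 := by
  induction e generalizing env p q i with
  | eps | letter a =>
    simp only [queryTrans, List.mem_singleton] at ht
    subst ht
    simp only [REWB.size]
    omega
  | test a c =>
    simp only [queryTrans, List.mem_append, List.mem_singleton] at ht
    simp only [REWB.size]
    rcases ht with h | rfl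
    · have := lt_of_mem_condTrans (by omega) (by omega) h
      omega
    · dsimp only
      omega
  | union c d ihc ihd | concat c d ihc ihd =>
    simp only [REWB.size]
    simp only [queryTrans] at ht
    rcases List.mem_append.1 ht with h | h
    · have := ihd (by omega) (by omega) h
      omega
    · have := ihc (by omega) (by omega) h
      omega
  | star c ih | bind a x c ih =>
    simp only [queryTrans, List.mem_append, List.mem_cons, List.not_mem_nil, or_false] at ht
    simp only [REWB.size]
    rcases ht with h | rfl | rfl
    · have := ih (by omega) (by omega) h
      omega
    · dsimp only
      omega
    · dsimp only
      omega

/-! ### Languages with guessed data values -/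

/-- The words of an expression whose binding operator with number `i` reads the data value `σ i`;
the first symbol of the expression has number `i`. -/
def guessLang (σ : ℕ → Option ℕ) : REWB ℕ ℕ → (ℕ → Option ℕ) → ℕ → Language (ℕ × ℕ)
  | .eps, _, _ => 1
  | .letter a, _, _ => {w | ∃ d, w = [(a, d)]}
  | .test a c, ν, _ => {w | ∃ d, c.Sat d ν ∧ w = [(a, d)]}
  | .union r s, ν, i => guessLang σ r ν (i + 1) + guessLang σ s ν (i + 1 + r.size)
  | .concat r s, ν, i => guessLang σ r ν (i + 1) * guessLang σ s ν (i + 1 + r.size)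
  | .star r, ν, i => KStar.kstar (guessLang σ r ν (i + 1))
  | .bind a x r, ν, i => {w | ∃ d w', σ i = some d ∧
      w' ∈ guessLang σ r (Function.update ν x (σ i)) (i + 1) ∧ w = (a, d) :: w'}

/-- Only the slots numbered by the symbols of `e` itself are consulted. Slots of different
subexpressions are disjoint, so guesses for them can be combined. -/
theorem guessLang_congr {σ σ' : ℕ → Option ℕ} (e : REWB ℕ ℕ) (ν : ℕ → Option ℕ) (i : ℕ)
    (h : ∀ j, i ≤ j → j < i + e.size → σ j = σ' j) : guessLang σ e ν i = guessLang σ' e ν i := by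
  induction e generalizing ν i with
  | eps | letter a | test a c => rfl
  | union r s ihr ihs | concat r s ihr ihs =>
    simp only [REWB.size] at h
    simp only [guessLang]
    rw [ihr _ _ fun j h₁ h₂ => h j (by omega) (by omega),
      ihs _ _ fun j h₁ h₂ => h j (by omega) (by omega)]
  | star r ih =>
    simp only [REWB.size] at h
    simp only [guessLang]
    rw [ih _ _ fun j h₁ h₂ => h j (by omega) (by omega)]
  | bind a x r ih =>
    simp only [REWB.size] at h
    simp only [guessLang]
    rw [ih _ _ fun j h₁ h₂ => h j (by omega) (by omega), h i le_rfl (by omega)]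

theorem lang_star_mono {L L' : Language (ℕ × ℕ)} (h : L ≤ L') : KStar.kstar L ≤ KStar.kstar L' := by
  rintro w ⟨l, rfl, hl⟩
  exact ⟨l, rfl, fun y hy => h (hl y hy)⟩

theorem guessLang_le (σ : ℕ → Option ℕ) (e : REWB ℕ ℕ) (ν : ℕ → Option ℕ) (i : ℕ) :
    guessLang σ e ν i ≤ e.lang ν := by
  induction e generalizing ν i with
  | eps | letter a | test a c => exact le_rfl
  | union r s ihr ihs => exact add_le_add (ihr _ _) (ihs _ _)
  | concat r s ihr ihs => exact mul_le_mul' (ihr _ _) (ihs _ _)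
  | star r ih => exact lang_star_mono (ih _ _)
  | bind a x r ih =>
    rintro w ⟨d, w', hd, hw', rfl⟩
    rw [hd] at hw'
    exact ⟨d, w', ih _ _ hw', rfl⟩

theorem not_isE_zero (e : REWB ℕ ℕ) : ¬ IsE 0 e := by
  induction e with
  | eps | letter | test | star => intro h; cases h
  | union r s ihr ihs | concat r s ihr ihs => intro h; cases h; exact ihr ‹_›
  | bind a x r ih => intro h; cases h; exact ih ‹_›

/-- There is no binding operator in such an expression. This takes care of all stars that occur in
`E_1`. -/
theorem guessLang_of_isF_zero (σ : ℕ → Option ℕ) {e : REWB ℕ ℕ} (he : IsF 0 e) (ν : ℕ → Option ℕ)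
    (i : ℕ) : guessLang σ e ν i = e.lang ν := by
  induction e generalizing ν i with
  | eps | letter a | test a c => rfl
  | union r s ihr ihs | concat r s ihr ihs =>
    cases he
    · exact (not_isE_zero _ ‹_›).elim
    · simp only [guessLang, REWB.lang, ihr ‹IsF 0 r›, ihs ‹IsF 0 s›]
  | star r ih =>
    cases he with
    | ofE h => exact (not_isE_zero _ h).elim
    | star h => simp only [guessLang, REWB.lang, ih h]
  | bind a x r ih =>
    cases he with
    | ofE h => exact (not_isE_zero _ h).elim

/-- In an expression of level one, each binding operator is used at most once, so that its data
value can be guessed in advance. -/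
theorem exists_guess {e : REWB ℕ ℕ} (he : IsE 1 e) (ν : ℕ → Option ℕ) (i : ℕ)
    {w : List (ℕ × ℕ)} (hw : w ∈ e.lang ν) (σ₀ : ℕ → Option ℕ) :
    ∃ σ : ℕ → Option ℕ, w ∈ guessLang σ e ν i ∧
      (∀ j, j < i ∨ i + e.size ≤ j → σ j = σ₀ j) ∧
      ∀ j, σ j = σ₀ j ∨ ∃ x ∈ w, σ j = some x.2 := by
  induction e generalizing ν i w σ₀ with
  | eps | letter a | test a c => exact ⟨σ₀, hw, fun _ _ => rfl, fun _ => .inl rfl⟩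
  | star r ih =>
    cases he with
    | ofF h =>
      exact ⟨σ₀, by rwa [guessLang_of_isF_zero _ h], fun _ _ => rfl, fun _ => .inl rfl⟩
  | union r s ihr ihs =>
    cases he with
    | ofF h =>
      exact ⟨σ₀, by rwa [guessLang_of_isF_zero _ h], fun _ _ => rfl, fun _ => .inl rfl⟩
    | union h₁ h₂ =>
      simp only [REWB.size]
      rcases hw with hw | hw
      · obtain ⟨σ, hσ, hj, hd⟩ := ihr h₁ ν (i + 1) hw σ₀
        exact ⟨σ, Or.inl hσ, fun j h => hj j (by omega), hd⟩
      · obtain ⟨σ, hσ, hj, hd⟩ := ihs h₂ ν (i + 1 + r.size) hw σ₀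
        exact ⟨σ, Or.inr hσ, fun j h => hj j (by omega), hd⟩
  | concat r s ihr ihs =>
    cases he with
    | ofF h =>
      exact ⟨σ₀, by rwa [guessLang_of_isF_zero _ h], fun _ _ => rfl, fun _ => .inl rfl⟩
    | concat h₁ h₂ =>
      simp only [REWB.size]
      obtain ⟨w₁, hw₁, w₂, hw₂, rfl⟩ := hw
      obtain ⟨σ₁, hσ₁, hj₁, hd₁⟩ := ihr h₁ ν (i + 1) hw₁ σ₀
      obtain ⟨σ₂, hσ₂, hj₂, hd₂⟩ := ihs h₂ ν (i + 1 + r.size) hw₂ σ₁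
      refine ⟨σ₂, ⟨w₁, ?_, w₂, hσ₂, rfl⟩, fun j h => ?_, fun j => ?_⟩
      -- The second guess starts from the first one and changes it only at slots of `s`, so the
      -- first factor keeps its membership.
      · rwa [guessLang_congr r ν (i + 1) fun j _ h => hj₂ j (Or.inl h)]
      · rw [hj₂ j (by omega), hj₁ j (by omega)]
      · rcases hd₂ j with h | ⟨x, hx, h⟩
        · rcases hd₁ j with h' | ⟨x, hx, h'⟩
          · exact .inl (h.trans h')
          · exact .inr ⟨x, by simp [hx], h.trans h'⟩
        · exact .inr ⟨x, by simp [hx], h⟩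
  | bind a x r ih =>
    cases he with
    | ofF h => exact ⟨σ₀, by rwa [guessLang_of_isF_zero _ h], fun _ _ => rfl, fun _ => .inl rfl⟩
    | bind _ _ h =>
      simp only [REWB.size]
      obtain ⟨d, w', hw', rfl⟩ := hw
      -- The value read is stored in slot `i` before the recursion, which changes only slots from `i
      -- + 1` on.
      obtain ⟨σ, hσ, hj, hd⟩ := ih h _ (i + 1) hw' (Function.update σ₀ i (some d))
      have hi : σ i = some d := by rw [hj i (by omega), Function.update_self]
      refine ⟨σ, ⟨d, w', hi, by rwa [hi], rfl⟩, fun j h => ?_, fun j => ?_⟩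
      · rw [hj j (by omega), Function.update_of_ne (by omega)]
      · by_cases hji : j = i
        · subst hji
          exact .inr ⟨_, List.mem_cons_self, hi⟩
        · rcases hd j with h | ⟨y, hy, h⟩
          · rw [Function.update_of_ne hji] at h
            exact .inl h
          · exact .inr ⟨y, List.mem_cons_of_mem _ hy, h⟩

end EvalReduction

namespace EvalReduction

open PolyTime DataQuery Relation

/-! ### Runs of the automaton of an expression -/

/-- The value that the variable of a literal refers to. -/
def refVal (σ : ℕ → Option Bits) (val : List (Bits × Bits)) (a : Act) : Option Bits :=
  match a.2.2.2.1 with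
  | [] => (lookupAll val a.2.2.2.2).head?
  | i :: _ => σ i

def LitHolds (σ : ℕ → Option Bits) (val : List (Bits × Bits)) (a : Act) (d : Bits) : Prop :=
  refVal σ val a = some d ↔ a.2.2.1 = true

/-- The action `a` allows to proceed from the edge `ed` with index `j` to the edge `ed'` with index
`j'`. -/
def Allowed (σ : ℕ → Option Bits) (val : List (Bits × Bits)) (a : Act) (j j' : ℕ) (ed ed' : Edge) :
    Prop :=
  if a.2.1 then j' ≠ 0 ∧ ed'.1 = ed.2.2.2 ∧ ed'.2.1 = a.2.2.2.2
  else j = j' ∧ (a.1 = true ∨ LitHolds σ val a ed.2.2.1)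

/-- A step of the automaton with transitions `ts` in a graph with edge list `es`. A configuration
consists of a state and the index of the edge that was read last; the first element of the edge
list is not an edge of the graph, but only determines the vertex to start with. -/
def Step (σ : ℕ → Option Bits) (val : List (Bits × Bits)) (es : List Edge) (ts : List Trans)
    (x y : ℕ × ℕ) : Prop :=
  ∃ t ∈ ts, ∃ ed ed', es[x.2]? = some ed ∧ es[y.2]? = some ed' ∧ t.1 = x.1 ∧ t.2.1 = y.1 ∧
    Allowed σ val t.2.2 x.2 y.2 ed ed'

/-- There is a path from `u` to `v` with sequence of labels `w`. -/
def EdgePath (es : List Edge) : ℕ → List (ℕ × ℕ) → ℕ → Prop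
  | u, [], v => u = v
  | u, x :: w, v => ∃ u', (u, x.1.bits, x.2.bits, u') ∈ es ∧ EdgePath es u' w v

theorem edgePath_append {es : List Edge} {u v : ℕ} {w₁ w₂ : List (ℕ × ℕ)} :
    EdgePath es u (w₁ ++ w₂) v ↔ ∃ u', EdgePath es u w₁ u' ∧ EdgePath es u' w₂ v := by
  induction w₁ generalizing u with
  | nil => simp [EdgePath]
  | cons x w₁ ih =>
    simp only [List.cons_append, EdgePath, ih]
    constructor
    · rintro ⟨u', h, u'', h', h''⟩
      exact ⟨u'', ⟨u', h, h'⟩, h''⟩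
    · rintro ⟨u'', ⟨u', h, h'⟩, h''⟩
      exact ⟨u', h, u'', h', h''⟩

/-- The environment `env`, the guess `σ` and the list `val` together represent the valuation `ν`. -/
def EnvOK (σ : ℕ → Option ℕ) (val : List (Bits × Bits)) (env : Env) (ν : ℕ → Option ℕ) : Prop :=
  ∀ x : ℕ, ∀ pol, refVal (fun i => (σ i).map Nat.bits) val
    (Act.lit pol (lookupAll env x.bits) x.bits) = (ν x).map Nat.bits

/-- In the automaton a bound variable is replaced by the slot of the innermost binding operator for
it. Putting the new pair in front of the environment shadows earlier bindings just as the update of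
the valuation does. -/
theorem EnvOK.update {σ : ℕ → Option ℕ} {val : List (Bits × Bits)} {env : Env} {ν : ℕ → Option ℕ}
    (h : EnvOK σ val env ν) (x i : ℕ) :
    EnvOK σ val ((x.bits, i) :: env) (Function.update ν x (σ i)) := by
  intro y pol
  by_cases hy : y = x
  · subst hy
    simp [lookupAll, Act.lit, refVal]
  · have hb : ¬ (x.bits == y.bits) = true := fun hb => hy (bits_injective (by simpa using hb)).symm
    rw [Function.update_of_ne hy, ← h y pol]
    simp [lookupAll, hb]

theorem litHolds_lit {σ : ℕ → Option ℕ} {val : List (Bits × Bits)} {env : Env} {ν : ℕ → Option ℕ}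
    (h : EnvOK σ val env ν) (pol : Bool) (x d : ℕ) :
    LitHolds (fun i => (σ i).map Nat.bits) val (Act.lit pol (lookupAll env x.bits) x.bits) d.bits ↔
      (ν x = some d ↔ pol = true) := by
  rw [LitHolds, h x pol]
  have h₁ : (ν x).map Nat.bits = some d.bits ↔ ν x = some d := by
    rw [← Option.map_some, (Option.map_injective bits_injective).eq_iff]
  rw [h₁]
  rfl

abbrev Runs (σ : ℕ → Option ℕ) (val : List (Bits × Bits)) (es : List Edge) (ts : List Trans) :
    ℕ × ℕ → ℕ × ℕ → Prop :=
  ReflTransGen (Step (fun i => (σ i).map Nat.bits) val es ts)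

-- From words to runs

section Completeness

variable {σ : ℕ → Option ℕ} {val : List (Bits × Bits)} {es : List Edge} {src : Edge}
  {ts : List Trans}

theorem runs_cond {c : Cond ℕ} {env : Env} {ν : ℕ → Option ℕ} (hν : EnvOK σ val env ν)
    {pol : Bool} {p q i j d : ℕ} {ed : Edge} (hj : (src :: es)[j]? = some ed)
    (hd : ed.2.2.1 = d.bits) (hc : c.Sat d ν ↔ pol = true)
    (hts : ∀ t ∈ condTrans c env pol p q i, t ∈ ts) : Runs σ val (src :: es) ts (p, j) (q, j) := by
  induction c generalizing pol p q i with
  | eq x =>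
    refine .single ⟨_, hts _ List.mem_cons_self, ed, ed, hj, hj, rfl, rfl, ?_⟩
    simp only [Allowed, Act.lit, Bool.false_eq_true, if_false, true_and, false_or, hd]
    exact (litHolds_lit hν _ x d).2 hc
  | ne x =>
    refine .single ⟨_, hts _ List.mem_cons_self, ed, ed, hj, hj, rfl, rfl, ?_⟩
    simp only [Allowed, Act.lit, Bool.false_eq_true, if_false, true_and, false_or, hd]
    refine (litHolds_lit hν _ x d).2 ?_
    simp only [Cond.Sat] at hc
    cases pol <;> simpa using hc
  | and c₁ c₂ ih₁ ih₂ =>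
    simp only [condTrans] at hts
    cases pol
    · simp only [Bool.false_eq_true, if_false, List.mem_append] at hts
      simp only [Cond.Sat, Bool.false_eq_true, iff_false, not_and_or] at hc
      rcases hc with h | h
      · exact ih₁ (by simpa using h) fun t ht => hts t (.inr ht)
      · exact ih₂ (by simpa using h) fun t ht => hts t (.inl ht)
    · simp only [if_true, List.mem_append] at hts
      simp only [Cond.Sat, iff_true] at hc
      exact (ih₁ (by simpa using hc.1) fun t ht => hts t (.inr ht)).trans
        (ih₂ (by simpa using hc.2) fun t ht => hts t (.inl ht))
  | or c₁ c₂ ih₁ ih₂ =>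
    simp only [condTrans] at hts
    cases pol
    · simp only [Bool.false_eq_true, if_false, List.mem_append] at hts
      simp only [Cond.Sat, Bool.false_eq_true, iff_false, not_or] at hc
      exact (ih₁ (by simpa using hc.1) fun t ht => hts t (.inr ht)).trans
        (ih₂ (by simpa using hc.2) fun t ht => hts t (.inl ht))
    · simp only [if_true, List.mem_append] at hts
      simp only [Cond.Sat, iff_true] at hc
      rcases hc with h | h
      · exact ih₁ (by simpa using h) fun t ht => hts t (.inr ht)
      · exact ih₂ (by simpa using h) fun t ht => hts t (.inl ht)
  | not c ih =>
    refine ih (pol := !pol) ?_ hts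
    simp only [Cond.Sat] at hc
    cases pol <;> simpa using hc

theorem runs_read {a d p q j u v : ℕ} {ed : Edge} (hj : (src :: es)[j]? = some ed)
    (hu : ed.2.2.2 = u) (ht : (p, q, Act.read a.bits) ∈ ts) (he : (u, a.bits, d.bits, v) ∈ es) :
    ∃ j', (src :: es)[j']? = some (u, a.bits, d.bits, v) ∧ Runs σ val (src :: es) ts (p, j) (q, j') := by
  obtain ⟨j', hj'⟩ := List.mem_iff_getElem?.1 he
  refine ⟨j' + 1, by simpa using hj', .single ⟨_, ht, ed, (u, a.bits, d.bits, v), hj, ?_, rfl, rfl, ?_⟩⟩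
  · simpa using hj'
  · simp [Allowed, Act.read, hu]

theorem runs_eps {p q j : ℕ} {ed : Edge} (hj : (src :: es)[j]? = some ed)
    (ht : (p, q, Act.eps) ∈ ts) : Runs σ val (src :: es) ts (p, j) (q, j) :=
  .single ⟨_, ht, ed, ed, hj, hj, rfl, rfl, by simp [Allowed, Act.eps]⟩

theorem runs_query {e : REWB ℕ ℕ} {env : Env} {ν : ℕ → Option ℕ} (hν : EnvOK σ val env ν)
    {p q i j u v : ℕ} {ed : Edge} {w : List (ℕ × ℕ)} (hj : (src :: es)[j]? = some ed)
    (hu : ed.2.2.2 = u) (hw : w ∈ guessLang σ e ν i) (hp : EdgePath es u w v)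
    (hts : ∀ t ∈ queryTrans e env p q i, t ∈ ts) :
    ∃ j' ed', (src :: es)[j']? = some ed' ∧ ed'.2.2.2 = v ∧ Runs σ val (src :: es) ts (p, j) (q, j') := by
  induction e generalizing env ν p q i j u v ed w with
  | eps =>
    obtain rfl : w = [] := hw
    exact ⟨j, ed, hj, hu.trans hp, runs_eps hj (hts _ List.mem_cons_self)⟩
  | letter a =>
    obtain ⟨d, rfl⟩ := hw
    obtain ⟨v', he, rfl⟩ := hp
    obtain ⟨j', hj', h⟩ := runs_read hj hu (hts _ List.mem_cons_self) he
    exact ⟨j', _, hj', rfl, h⟩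
  | test a c =>
    obtain ⟨d, hd, rfl⟩ := hw
    obtain ⟨v', he, rfl⟩ := hp
    simp only [queryTrans, List.mem_append, List.mem_singleton] at hts
    obtain ⟨j', hj', h⟩ := runs_read hj hu (hts _ (.inr rfl)) he
    exact ⟨j', _, hj', rfl, h.trans (runs_cond hν hj' rfl (by simpa using hd)
      fun t ht => hts t (.inl ht))⟩
  | union r s ihr ihs =>
    simp only [queryTrans, List.mem_append] at hts
    rcases hw with hw | hw
    · exact ihr hν hj hu hw hp fun t ht => hts t (.inr ht)
    · exact ihs hν hj hu hw hp fun t ht => hts t (.inl ht)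
  | concat r s ihr ihs =>
    simp only [queryTrans, List.mem_append] at hts
    obtain ⟨w₁, hw₁, w₂, hw₂, rfl⟩ := hw
    obtain ⟨u', hp₁, hp₂⟩ := edgePath_append.1 hp
    obtain ⟨j₁, ed₁, hj₁, hu₁, h₁⟩ := ihr hν hj hu hw₁ hp₁ fun t ht => hts t (.inr ht)
    obtain ⟨j₂, ed₂, hj₂, hu₂, h₂⟩ := ihs hν hj₁ hu₁ hw₂ hp₂ fun t ht => hts t (.inl ht)
    exact ⟨j₂, ed₂, hj₂, hu₂, h₁.trans h₂⟩
  | star r ih =>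
    simp only [queryTrans, List.mem_append, List.mem_cons, List.not_mem_nil, or_false] at hts
    obtain ⟨l, rfl, hl⟩ := hw
    -- Each factor of the starred word gives one loop at the state `2 * i + 2`; the same slots serve
    -- in every round.
    have key : ∀ (l : List (List (ℕ × ℕ))), (∀ y ∈ l, y ∈ guessLang σ r ν (i + 1)) →
        ∀ (j u : ℕ) (ed : Edge), (src :: es)[j]? = some ed → ed.2.2.2 = u →
        EdgePath es u l.flatten v → ∃ j' ed', (src :: es)[j']? = some ed' ∧ ed'.2.2.2 = v ∧
          Runs σ val (src :: es) ts (2 * i + 2, j) (2 * i + 2, j') := by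
      intro l
      induction l with
      | nil => exact fun _ j u ed hj hu hp => ⟨j, ed, hj, hu.trans hp, .refl⟩
      | cons w l ihl =>
        intro hl j u ed hj hu hp
        obtain ⟨u', hp₁, hp₂⟩ := edgePath_append.1 hp
        obtain ⟨j₁, ed₁, hj₁, hu₁, h₁⟩ := ih hν hj hu (hl w List.mem_cons_self) hp₁
          fun t ht => hts t (.inl ht)
        obtain ⟨j₂, ed₂, hj₂, hu₂, h₂⟩ := ihl (fun y hy => hl y (List.mem_cons_of_mem _ hy)) j₁ u'
          ed₁ hj₁ hu₁ hp₂
        exact ⟨j₂, ed₂, hj₂, hu₂, h₁.trans h₂⟩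
    obtain ⟨j', ed', hj', hv, h⟩ := key l hl j u ed hj hu hp
    exact ⟨j', ed', hj', hv, ((runs_eps hj (hts _ (.inr (.inl rfl)))).trans h).trans
      (runs_eps hj' (hts _ (.inr (.inr rfl))))⟩
  | bind a x r ih =>
    simp only [queryTrans, List.mem_append, List.mem_cons, List.not_mem_nil, or_false] at hts
    obtain ⟨d, w', hd, hw', rfl⟩ := hw
    obtain ⟨u', he, hp⟩ := hp
    obtain ⟨j₁, hj₁, h₁⟩ := runs_read hj hu (hts _ (.inr (.inl rfl))) he
    obtain ⟨j₂, ed₂, hj₂, hu₂, h₂⟩ := ih (hν.update x i) (u := u') hj₁ rfl hw' hp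
      fun t ht => hts t (.inl ht)
    refine ⟨j₂, ed₂, hj₂, hu₂, (h₁.tail ⟨_, hts _ (.inr (.inr rfl)), _, _, hj₁, hj₁, rfl, rfl, ?_⟩).trans
      h₂⟩
    simp [Allowed, Act.lit, LitHolds, refVal, hd]

end Completeness

-- From runs to words

section Soundness

variable {σ : ℕ → Option ℕ} {val : List (Bits × Bits)}

/-- Sets of words (to be read from a state on) that depend on a state and the last data value. -/
abbrev Potential := ℕ → ℕ → Set (List (ℕ × ℕ))

/-- The transition `t` is compatible with the potential `A`. -/
def Respects (σ : ℕ → Option ℕ) (val : List (Bits × Bits)) (A : Potential) (t : Trans) : Prop :=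
  ∀ d, ∀ w ∈ A t.2.1 d,
    if t.2.2.2.1 then ∀ a d₀, a.bits = t.2.2.2.2.2.2 → (a, d) :: w ∈ A t.1 d₀
    else t.2.2.1 = true ∨ LitHolds (fun i => (σ i).map Nat.bits) val t.2.2 d.bits → w ∈ A t.1 d

theorem Respects.congr {A A' : Potential} {t : Trans} (h : Respects σ val A t)
    (h₁ : A' t.1 = A t.1) (h₂ : A' t.2.1 = A t.2.1) : Respects σ val A' t := by
  unfold Respects at h ⊢
  rwa [h₁, h₂]

/-- The potential `A` can be changed on the states that are new for the symbols with numbers `≥ i`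
such that all transitions in `ts` are compatible with it. -/
def Extends (σ : ℕ → Option ℕ) (val : List (Bits × Bits)) (ts : List Trans) (i : ℕ)
    (A : Potential) : Prop :=
  ∃ A' : Potential, (∀ s < 2 * i + 2, A' s = A s) ∧ ∀ t ∈ ts, Respects σ val A' t

/-- Compatibility of a transition depends only on the potential at its two ends. The first family
has its ends below `2 * j + 2`, where the second extension changes nothing; hence it stays
compatible. -/
theorem Extends.append {ts₁ ts₂ : List Trans} {i j : ℕ} {A : Potential}
    (h₁ : Extends σ val ts₁ i A) (hij : i ≤ j)
    (hs : ∀ t ∈ ts₁, t.1 < 2 * j + 2 ∧ t.2.1 < 2 * j + 2)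
    (h₂ : ∀ A' : Potential, (∀ s < 2 * i + 2, A' s = A s) → Extends σ val ts₂ j A') :
    Extends σ val (ts₂ ++ ts₁) i A := by
  obtain ⟨A₁, hA₁, h₁⟩ := h₁
  obtain ⟨A₂, hA₂, h₂⟩ := h₂ A₁ hA₁
  refine ⟨A₂, fun s h => (hA₂ s (by omega)).trans (hA₁ s h), fun t ht => ?_⟩
  rcases List.mem_append.1 ht with h | h
  · exact h₂ t h
  · exact (h₁ t h).congr (hA₂ _ (hs t h).1) (hA₂ _ (hs t h).2)

theorem Extends.of_new {ts : List Trans} {i : ℕ} {A A' : Potential}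
    (h : Extends σ val ts (i + 1) A') (hA : ∀ s < 2 * i + 2, A' s = A s) : Extends σ val ts i A := by
  obtain ⟨A₁, hA₁, h₁⟩ := h
  exact ⟨A₁, fun s h => (hA₁ s (by omega)).trans (hA s h), h₁⟩

/-- The data value does not change while a condition is tested, so the inclusion between the
potentials at `q` and `p` is needed only for values that give the condition its polarity. -/
theorem extends_cond {c : Cond ℕ} {env : Env} {ν : ℕ → Option ℕ} (hν : EnvOK σ val env ν)
    {pol : Bool} {p q i : ℕ} {A : Potential} (hp : p < 2 * i + 2) (hq : q < 2 * i + 2)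
    (hA : ∀ d, (c.Sat d ν ↔ pol = true) → A q d ⊆ A p d) :
    Extends σ val (condTrans c env pol p q i) i A := by
  -- Serial composition: the middle state may be left with what is allowed at `q`, provided that the
  -- value passes the second test.
  have seq : ∀ (c₁ c₂ : Cond ℕ),
      (∀ {pol : Bool} {p q i : ℕ} {A : Potential}, p < 2 * i + 2 → q < 2 * i + 2 →
        (∀ d, (c₁.Sat d ν ↔ pol = true) → A q d ⊆ A p d) →
        Extends σ val (condTrans c₁ env pol p q i) i A) →
      (∀ {pol : Bool} {p q i : ℕ} {A : Potential}, p < 2 * i + 2 → q < 2 * i + 2 →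
        (∀ d, (c₂.Sat d ν ↔ pol = true) → A q d ⊆ A p d) →
        Extends σ val (condTrans c₂ env pol p q i) i A) →
      ∀ {pol : Bool} {p q i : ℕ} {A : Potential}, p < 2 * i + 2 → q < 2 * i + 2 →
        (∀ d, (c₁.Sat d ν ↔ pol = true) → (c₂.Sat d ν ↔ pol = true) → A q d ⊆ A p d) →
        Extends σ val (condTrans c₂ env pol (2 * i + 2) q (i + 1 + c₁.size) ++
          condTrans c₁ env pol p (2 * i + 2) (i + 1)) i A := by
    intro c₁ c₂ ih₁ ih₂ pol p q i A hp hq hA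
    let A' : Potential := Function.update A (2 * i + 2)
      fun d => {w | (c₂.Sat d ν ↔ pol = true) ∧ w ∈ A q d}
    have hA' : ∀ s < 2 * i + 2, A' s = A s := fun s h => Function.update_of_ne (by omega) _ _
    have hm : A' (2 * i + 2) = fun d => {w | (c₂.Sat d ν ↔ pol = true) ∧ w ∈ A q d} :=
      Function.update_self ..
    refine Extends.of_new (A' := A') (.append (j := i + 1 + c₁.size) (ih₁ (by omega) (by omega) ?_)
      (by omega) (fun t ht => lt_of_mem_condTrans (by omega) (by omega) ht)
      fun A'' h'' => ih₂ (by omega) (by omega) ?_) hA'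
    · intro d hd w hw
      rw [hm] at hw
      rw [hA' p hp]
      exact hA d hd hw.1 hw.2
    · intro d hd w hw
      rw [h'' _ (by omega), hA' q hq] at hw
      rw [h'' _ (by omega), hm]
      exact ⟨hd, hw⟩
  -- Parallel composition: each branch joins `p` to `q` directly, and no new potential is chosen.
  have par : ∀ (c₁ c₂ : Cond ℕ),
      (∀ {pol : Bool} {p q i : ℕ} {A : Potential}, p < 2 * i + 2 → q < 2 * i + 2 →
        (∀ d, (c₁.Sat d ν ↔ pol = true) → A q d ⊆ A p d) →
        Extends σ val (condTrans c₁ env pol p q i) i A) →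
      (∀ {pol : Bool} {p q i : ℕ} {A : Potential}, p < 2 * i + 2 → q < 2 * i + 2 →
        (∀ d, (c₂.Sat d ν ↔ pol = true) → A q d ⊆ A p d) →
        Extends σ val (condTrans c₂ env pol p q i) i A) →
      ∀ {pol : Bool} {p q i : ℕ} {A : Potential}, p < 2 * i + 2 → q < 2 * i + 2 →
        (∀ d, (c₁.Sat d ν ↔ pol = true) ∨ (c₂.Sat d ν ↔ pol = true) → A q d ⊆ A p d) →
        Extends σ val (condTrans c₂ env pol p q (i + 1 + c₁.size) ++
          condTrans c₁ env pol p q (i + 1)) i A := by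
    intro c₁ c₂ ih₁ ih₂ pol p q i A hp hq hA
    refine Extends.of_new (A' := A) (.append (j := i + 1 + c₁.size) (ih₁ (by omega) (by omega)
      fun d hd => hA d (.inl hd)) (by omega)
      (fun t ht => lt_of_mem_condTrans (by omega) (by omega) ht)
      fun A'' h'' => ih₂ (by omega) (by omega) fun d hd => ?_) fun _ _ => rfl
    rw [h'' _ (by omega), h'' _ (by omega)]
    exact hA d (.inr hd)
  induction c generalizing pol p q i A with
  | eq x =>
    refine ⟨A, fun _ _ => rfl, ?_⟩
    simp only [condTrans, List.mem_singleton, forall_eq]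
    intro d w hw
    simp only [Act.lit, Bool.false_eq_true, if_false, false_or]
    intro h
    exact hA d ((litHolds_lit hν _ x d).1 h) hw
  | ne x =>
    refine ⟨A, fun _ _ => rfl, ?_⟩
    simp only [condTrans, List.mem_singleton, forall_eq]
    intro d w hw
    simp only [Act.lit, Bool.false_eq_true, if_false, false_or]
    intro h
    have h₁ := (litHolds_lit hν _ x d).1 h
    refine hA d ?_ hw
    simp only [Cond.Sat]
    cases pol <;> simpa using h₁
  | and c₁ c₂ ih₁ ih₂ =>
    rw [condTrans]
    simp only [Cond.Sat] at hA
    cases pol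
    · refine par c₁ c₂ ih₁ ih₂ hp hq fun d h => hA d ?_
      simp only [Bool.false_eq_true, iff_false] at h ⊢
      tauto
    · refine seq c₁ c₂ ih₁ ih₂ hp hq fun d h h' => hA d ?_
      simp only [iff_true] at h h' ⊢
      tauto
  | or c₁ c₂ ih₁ ih₂ =>
    rw [condTrans]
    simp only [Cond.Sat] at hA
    cases pol
    · refine seq c₁ c₂ ih₁ ih₂ hp hq fun d h h' => hA d ?_
      simp only [Bool.false_eq_true, iff_false] at h h' ⊢
      tauto
    · refine par c₁ c₂ ih₁ ih₂ hp hq fun d h => hA d ?_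
      simp only [iff_true] at h ⊢
      tauto
  | not c ih =>
    refine Extends.of_new (ih (by omega) (by omega) fun d hd => hA d ?_) fun _ _ => rfl
    simp only [Cond.Sat]
    cases pol <;> simpa using hd

/-- Runs need not be cut into pieces that belong to subexpressions. It is enough to choose, for each
new state, the set of words that lead from it through the rest of the expression into the potential
at `q`; compatibility is then checked for one transition at a time. -/
theorem extends_query {e : REWB ℕ ℕ} {env : Env} {ν : ℕ → Option ℕ} (hν : EnvOK σ val env ν)
    {p q i : ℕ} {A : Potential} (hp : p < 2 * i + 2) (hq : q < 2 * i + 2)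
    (hA : ∀ w ∈ guessLang σ e ν i, ∀ d d', ∀ w' ∈ A q d', w ++ w' ∈ A p d) :
    Extends σ val (queryTrans e env p q i) i A := by
  induction e generalizing env ν p q i A with
  | eps =>
    refine ⟨A, fun _ _ => rfl, ?_⟩
    simp only [queryTrans, List.mem_singleton, forall_eq]
    intro d w hw
    simp only [Act.eps, Bool.false_eq_true, if_false, true_or, true_imp_iff]
    exact hA [] rfl d d w hw
  | letter a =>
    refine ⟨A, fun _ _ => rfl, ?_⟩
    simp only [queryTrans, List.mem_singleton, forall_eq]
    intro d w hw
    simp only [Act.read, if_true]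
    intro a' d₀ ha
    obtain rfl := bits_injective ha
    exact hA [(a', d)] ⟨d, rfl⟩ d₀ d w hw
  | test a c =>
    let A' : Potential := Function.update A (2 * i + 2) fun d => {w | c.Sat d ν ∧ w ∈ A q d}
    have hA' : ∀ s < 2 * i + 2, A' s = A s := fun s h => Function.update_of_ne (by omega) _ _
    have hm : A' (2 * i + 2) = fun d => {w | c.Sat d ν ∧ w ∈ A q d} := Function.update_self ..
    refine Extends.of_new (A' := A') (.append (j := i + 1) ⟨A', fun _ _ => rfl, ?_⟩ le_rfl ?_
      fun A'' h'' => extends_cond hν (by omega) (by omega) ?_) hA'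
    · simp only [List.mem_singleton, forall_eq]
      intro d w hw
      simp only [Act.read, if_true]
      intro a' d₀ ha
      obtain rfl := bits_injective ha
      rw [hm] at hw
      rw [hA' p hp]
      exact hA [(a', d)] ⟨d, hw.1, rfl⟩ d₀ d w hw.2
    · simp only [List.mem_singleton, forall_eq]
      omega
    · intro d hd w hw
      rw [h'' _ (by omega), hA' q hq] at hw
      rw [h'' _ (by omega), hm]
      exact ⟨by simpa using hd, hw⟩
  | union r s ihr ihs =>
    refine Extends.of_new (A' := A) (.append (j := i + 1 + r.size) (ihr hν (by omega) (by omega)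
      fun w hw => hA w (.inl hw)) (by omega)
      (fun t ht => lt_of_mem_queryTrans (by omega) (by omega) ht)
      fun A'' h'' => ihs hν (by omega) (by omega) fun w hw => ?_) fun _ _ => rfl
    rw [h'' _ (by omega), h'' _ (by omega)]
    exact hA w (.inr hw)
  | concat r s ihr ihs =>
    let A' : Potential := Function.update A (2 * i + 2) fun _ =>
      {w | ∃ w₁ ∈ guessLang σ s ν (i + 1 + r.size), ∃ d, ∃ w₂ ∈ A q d, w = w₁ ++ w₂}
    have hA' : ∀ s < 2 * i + 2, A' s = A s := fun s h => Function.update_of_ne (by omega) _ _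
    have hm : A' (2 * i + 2) = fun _ =>
        {w | ∃ w₁ ∈ guessLang σ s ν (i + 1 + r.size), ∃ d, ∃ w₂ ∈ A q d, w = w₁ ++ w₂} :=
      Function.update_self ..
    refine Extends.of_new (A' := A') (.append (j := i + 1 + r.size) (ihr hν (by omega) (by omega)
      ?_) (by omega) (fun t ht => lt_of_mem_queryTrans (by omega) (by omega) ht)
      fun A'' h'' => ihs hν (by omega) (by omega) ?_) hA'
    · intro w hw d d' w' hw'
      rw [hm] at hw'
      rw [hA' p hp]
      obtain ⟨w₁, hw₁, d₂, w₂, hw₂, rfl⟩ := hw'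
      rw [← List.append_assoc]
      exact hA _ ⟨w, hw, w₁, hw₁, rfl⟩ d d₂ w₂ hw₂
    · intro w hw d d' w' hw'
      rw [h'' _ (by omega), hA' q hq] at hw'
      rw [h'' _ (by omega), hm]
      exact ⟨w, hw, d', w', hw', rfl⟩
  | star r ih =>
    -- At the loop state, any number of rounds may follow before leaving for `q`. This set is closed
    -- under prefixing one more word of `r`, as the induction hypothesis for the loop demands.
    let A' : Potential := Function.update A (2 * i + 2) fun d =>
      {w | w ∈ A q d ∨ ∃ w₁ ∈ KStar.kstar (guessLang σ r ν (i + 1)), ∃ d, ∃ w₂ ∈ A q d,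
        w = w₁ ++ w₂}
    have hA' : ∀ s < 2 * i + 2, A' s = A s := fun s h => Function.update_of_ne (by omega) _ _
    have hm : A' (2 * i + 2) = fun d =>
        {w | w ∈ A q d ∨ ∃ w₁ ∈ KStar.kstar (guessLang σ r ν (i + 1)), ∃ d, ∃ w₂ ∈ A q d,
          w = w₁ ++ w₂} :=
      Function.update_self ..
    have hnil : [] ∈ KStar.kstar (guessLang σ r ν (i + 1)) := Language.nil_mem_kstar _
    refine Extends.of_new (A' := A') (.append (j := i + 1) ⟨A', fun _ _ => rfl, ?_⟩ le_rfl ?_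
      fun A'' h'' => ih hν (by omega) (by omega) ?_) hA'
    · simp only [List.mem_cons, List.not_mem_nil, or_false, forall_eq_or_imp, forall_eq]
      constructor
      · intro d w hw
        simp only [Act.eps, Bool.false_eq_true, if_false, true_or, true_imp_iff]
        rw [hm] at hw
        rw [hA' p hp]
        rcases hw with hw | ⟨w₁, hw₁, d₂, w₂, hw₂, rfl⟩
        · exact hA [] hnil d d w hw
        · exact hA w₁ hw₁ d d₂ w₂ hw₂
      · intro d w hw
        simp only [Act.eps, Bool.false_eq_true, if_false, true_or, true_imp_iff]
        rw [hA' q hq] at hw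
        rw [hm]
        exact .inl hw
    · simp only [List.mem_cons, List.not_mem_nil, or_false, forall_eq_or_imp, forall_eq]
      omega
    · intro w hw d d' w' hw'
      rw [h'' _ (by omega), hm] at hw' ⊢
      right
      rcases hw' with hw' | ⟨w₁, hw₁, d₂, w₂, hw₂, rfl⟩
      · refine ⟨w, ?_, d', w', hw', rfl⟩
        exact ⟨[w], by simp, by simpa using hw⟩
      · refine ⟨w ++ w₁, ?_, d₂, w₂, hw₂, by simp⟩
        obtain ⟨l, rfl, hl⟩ := hw₁
        exact ⟨w :: l, by simp, by simpa using ⟨hw, hl⟩⟩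
  | bind a x r ih =>
    let B : Set (List (ℕ × ℕ)) := {w | ∃ w₁ ∈ guessLang σ r (Function.update ν x (σ i)) (i + 1),
      ∃ d, ∃ w₂ ∈ A q d, w = w₁ ++ w₂}
    -- The value just read has to equal the guess in order to pass from `2 * i + 2` to `2 * i + 3`;
    -- behind this test it no longer matters.
    let A' : Potential := Function.update (Function.update A (2 * i + 2) fun d =>
      {w | σ i = some d ∧ w ∈ B}) (2 * i + 3) fun _ => B
    have hA' : ∀ s < 2 * i + 2, A' s = A s := fun s h => by
      simp only [A']
      rw [Function.update_of_ne (by omega), Function.update_of_ne (by omega)]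
    have hm : A' (2 * i + 2) = fun d => {w | σ i = some d ∧ w ∈ B} := by
      simp only [A']
      rw [Function.update_of_ne (by omega), Function.update_self]
    have hm' : A' (2 * i + 3) = fun _ => B := Function.update_self ..
    refine Extends.of_new (A' := A') (.append (j := i + 1) ⟨A', fun _ _ => rfl, ?_⟩ le_rfl ?_
      fun A'' h'' => ih (hν.update x i) (by omega) (by omega) ?_) hA'
    · simp only [List.mem_cons, List.not_mem_nil, or_false, forall_eq_or_imp, forall_eq]
      constructor
      · intro d w hw
        simp only [Act.read, if_true]
        intro a' d₀ ha
        obtain rfl := bits_injective ha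
        rw [hm] at hw
        rw [hA' p hp]
        obtain ⟨hd, w₁, hw₁, d₂, w₂, hw₂, rfl⟩ := hw
        exact hA ((a', d) :: w₁) ⟨d, w₁, hd, hw₁, rfl⟩ d₀ d₂ w₂ hw₂
      · intro d w hw
        simp only [Act.lit, Bool.false_eq_true, if_false, false_or]
        rw [hm'] at hw
        rw [hm]
        intro h
        refine ⟨?_, hw⟩
        simp only [LitHolds, refVal, iff_true] at h
        rw [← Option.map_some, (Option.map_injective bits_injective).eq_iff] at h
        exact h
    · simp only [List.mem_cons, List.not_mem_nil, or_false, forall_eq_or_imp, forall_eq]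
      omega
    · intro w hw d d' w' hw'
      rw [h'' _ (by omega), hA' q hq] at hw'
      rw [h'' _ (by omega), hm']
      exact ⟨w, hw, d', w', hw', rfl⟩

end Soundness

/-- Runs of the automaton correspond to paths whose labels form a word of the language. -/
theorem exists_run_iff {σ : ℕ → Option ℕ} {val : List (Bits × Bits)} {es : List Edge} {src : Edge}
    {e : REWB ℕ ℕ} {ν : ℕ → Option ℕ} (hν : EnvOK σ val [] ν)
    (hes : ∀ ed ∈ es, ∃ a d : ℕ, ed.2.1 = a.bits ∧ ed.2.2.1 = d.bits)
    (hsrc : src.2.2.1 = Nat.bits 0) {v : ℕ} :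
    (∃ w ∈ guessLang σ e ν 0, EdgePath es src.2.2.2 w v) ↔
      ∃ j ed, (src :: es)[j]? = some ed ∧ ed.2.2.2 = v ∧
        Runs σ val (src :: es) (queryTrans e [] 0 1 0) (0, 0) (1, j) := by
  constructor
  · rintro ⟨w, hw, hp⟩
    exact runs_query hν (j := 0) rfl rfl hw hp fun _ h => h
  · rintro ⟨j, ed, hj, rfl, h⟩
    obtain ⟨A, hA, hts⟩ := extends_query (σ := σ) (val := val) (e := e) hν (p := 0) (q := 1) (i := 0)
      -- At the final state nothing may remain to be read; at the initial state, exactly the words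
      -- of the language may.
      (A := fun s _ => if s = 0 then guessLang σ e ν 0 else {[]}) (by omega) (by omega) (by
        rintro w hw d d' w' rfl
        rw [List.append_nil]
        exact hw)
    -- The run is followed from its end. Each reading transition puts a letter in front of the word
    -- and an edge in front of the path, and compatibility of the transition carries membership in
    -- the potential backwards. Index `0` is never the target of a reading transition, so the
    -- fictitious edge does not enter the path.
    have key : ∀ x y, Runs σ val (src :: es) (queryTrans e [] 0 1 0) x y → y = (1, j) → ∀ ed₀ (d : ℕ), (src :: es)[x.2]? = some ed₀ →
        ed₀.2.2.1 = d.bits → ∃ w ∈ A x.1 d, EdgePath es ed₀.2.2.2 w ed.2.2.2 := by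
      intro x y h
      induction h using ReflTransGen.head_induction_on with
      | refl =>
        rintro rfl ed₀ d h₁ h₂
        obtain rfl : ed = ed₀ := by simpa [hj] using h₁
        exact ⟨[], by simp [hA 1], rfl⟩
      | head h _ ih =>
        rename_i x z
        intro hy ed₀ d h₁ h₂
        obtain ⟨t, ht, ed₁, ed₂, h₃, h₄, h₅, h₆, h₇⟩ := h
        obtain rfl : ed₀ = ed₁ := by simpa [h₁] using h₃
        unfold Allowed at h₇
        split_ifs at h₇ with hr
        · obtain ⟨hz, h₈, h₉⟩ := h₇
          have hmem : ed₂ ∈ es := by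
            obtain ⟨n, hn⟩ := Nat.exists_eq_succ_of_ne_zero hz
            rw [hn, List.getElem?_cons_succ] at h₄
            exact List.mem_of_getElem? h₄
          obtain ⟨a, d', ha, hd'⟩ := hes ed₂ hmem
          obtain ⟨w, hw, hp⟩ := ih hy ed₂ d' h₄ hd'
          have h₁₀ := hts t ht d' w (by rwa [h₆])
          rw [if_pos hr] at h₁₀
          refine ⟨(a, d') :: w, ?_, ed₂.2.2.2, ?_, hp⟩
          · rw [← h₅]
            exact h₁₀ a d (ha.symm.trans h₉)
          · simpa only [← h₈, ← ha, ← hd'] using hmem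
        · obtain ⟨h₈, h₉⟩ := h₇
          obtain rfl : ed₀ = ed₂ := by simpa [← h₈, h₁] using h₄
          obtain ⟨w, hw, hp⟩ := ih hy ed₀ d h₄ h₂
          have h₁₀ := hts t ht d w (by rwa [h₆])
          rw [if_neg hr] at h₁₀
          rw [h₂] at h₉
          exact ⟨w, by rw [← h₅]; exact h₁₀ h₉, hp⟩
    obtain ⟨w, hw, hp⟩ := key _ _ h rfl src 0 rfl hsrc
    refine ⟨w, ?_, hp⟩
    rw [hA 0 (by omega)] at hw
    exact hw

end EvalReduction

namespace EvalReduction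

open PolyTime DataQuery

/-! ### Programs over Boolean registers and circuits -/

/-- An instruction consists of two flags for the operation (negation, conjunction), the register
that is assigned to, and the registers that are read. -/
abbrev Instr := (Bool × Bool) × ℕ × ℕ × ℕ

def Instr.not (z x : ℕ) : Instr := ((true, false), z, x, x)
def Instr.and (z x y : ℕ) : Instr := ((false, true), z, x, y)
def Instr.or (z x y : ℕ) : Instr := ((false, false), z, x, y)

/-- The effect of an instruction on the registers. -/
def exec (v : ℕ → Bool) (s : Instr) : ℕ → Bool :=
  Function.update v s.2.1
    (if s.1.1 then !v s.2.2.1 else if s.1.2 then v s.2.2.1 && v s.2.2.2 else v s.2.2.1 || v s.2.2.2)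

def run (prog : List Instr) (v : ℕ → Bool) : ℕ → Bool := prog.foldl exec v

def Instr.Below (N : ℕ) (s : Instr) : Prop := s.2.1 < N ∧ s.2.2.1 < N ∧ s.2.2.2 < N

def gateOf (op : Bool × Bool) (i j : ℕ) : Gate :=
  if op.1 then .not i else if op.2 then .and i j else .or i j

/-- The gates for an instruction, if the values of the `N` registers are the wires from `b` on. -/
def instrGates (N b : ℕ) (s : Instr) : List Gate :=
  (List.range N).map fun r =>
    if r == s.2.1 then gateOf s.1 (b + s.2.2.1) (b + s.2.2.2) else .or (b + r) (b + r)

/-- Each instruction becomes a full layer of `N` gates that copies all registers but the one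
assigned to. Register `r` after `n` instructions is then simply the wire `n * N + r`, with no need
to trace the latest assignment. -/
def progGates (N : ℕ) (prog : List Instr) (n : ℕ) : List Gate :=
  (prog.zipIdx n).flatMap fun s => instrGates N (s.2 * N) s.1

theorem argsBelow_mono {g : Gate} {b c : ℕ} (h : g.ArgsBelow b) (hbc : b ≤ c) :
    g.ArgsBelow c := by
  cases g <;> simp only [Gate.ArgsBelow] at h ⊢ <;> omega

theorem argsBelow_of_mem_instrGates {N b : ℕ} {s : Instr} (hs : s.Below N) {g : Gate}
    (hg : g ∈ instrGates N b s) : g.ArgsBelow (b + N) := by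
  obtain ⟨h₁, h₂, h₃⟩ := hs
  obtain ⟨r, hr, rfl⟩ := List.mem_map.1 hg
  have := List.mem_range.1 hr
  unfold gateOf
  split_ifs <;> simp only [Gate.ArgsBelow] <;> omega

theorem length_progGates (N : ℕ) (prog : List Instr) (n : ℕ) :
    (progGates N prog n).length = prog.length * N := by
  cases prog <;> simp [progGates, List.zipIdx_cons, instrGates, add_mul, add_comm]

theorem argsBelow_progGates {N : ℕ} {prog : List Instr} (hp : ∀ s ∈ prog, s.Below N) (n i : ℕ)
    (h : i < (progGates N prog n).length) :
    ((progGates N prog n)[i]).ArgsBelow (n * N + N + i) := by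
  induction prog generalizing n i with
  | nil => simp [progGates] at h
  | cons s prog ih =>
    have h₁ : progGates N (s :: prog) n = instrGates N (n * N) s ++ progGates N prog (n + 1) := by
      simp [progGates, List.zipIdx_cons]
    have h₂ : (instrGates N (n * N) s).length = N := by simp [instrGates]
    simp only [h₁] at h ⊢
    rw [List.getElem_append]
    split_ifs with hi
    · exact argsBelow_mono (argsBelow_of_mem_instrGates (hp s (by simp)) (List.getElem_mem _))
        (by omega)
    · refine argsBelow_mono (ih (fun s hs => hp s (by simp [hs])) (n + 1) _ _) ?_
      rw [add_mul]
      omega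

theorem eval_append_of_argsBelow {g : Gate} {vals l : List Bool} (h : g.ArgsBelow vals.length) :
    g.eval (vals ++ l) = g.eval vals := by
  have h₁ : ∀ i, i < vals.length → (vals ++ l).getD i false = vals.getD i false := fun i hi => by
    rw [List.getD_append _ _ _ _ hi]
  cases g <;> simp only [Gate.ArgsBelow] at h <;> simp only [Gate.eval]
  · rw [h₁ _ h]
  · rw [h₁ _ h.1, h₁ _ h.2]
  · rw [h₁ _ h.1, h₁ _ h.2]

theorem evalGates_append (gs gs' : List Gate) (vals : List Bool) :
    evalGates (gs ++ gs') vals = evalGates gs' (evalGates gs vals) := by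
  induction gs generalizing vals with
  | nil => rfl
  | cons g gs ih => exact ih _

/-- The gates of a layer read only wires before the layer, so they may be evaluated simultaneously.
-/
theorem evalGates_of_argsBelow {gs : List Gate} {vals : List Bool}
    (h : ∀ g ∈ gs, g.ArgsBelow vals.length) :
    evalGates gs vals = vals ++ gs.map fun g => g.eval vals := by
  have key : ∀ (gs : List Gate) (l : List Bool), (∀ g ∈ gs, g.ArgsBelow vals.length) →
      evalGates gs (vals ++ l) = vals ++ l ++ gs.map fun g => g.eval vals := by
    intro gs
    induction gs with
    | nil => intro l _; simp [evalGates]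
    | cons g gs ih =>
      intro l h
      rw [evalGates, eval_append_of_argsBelow (h g (by simp)), List.append_assoc,
        ih _ fun g hg => h g (by simp [hg])]
      simp
  simpa using key gs [] h

/-- The circuit for a program whose inputs are the initial values of all registers. -/
def progCircuit (N : ℕ) (prog : List Instr) (out : ℕ) (hp : ∀ s ∈ prog, s.Below N) (ho : out < N) :
    Circuit where
  numInputs := N
  gates := progGates N prog 0
  output := prog.length * N + out
  args_lt i h := by simpa using argsBelow_progGates hp 0 i h
  output_lt := by rw [length_progGates]; omega

theorem evalGates_progGates {N : ℕ} {prog : List Instr} (hp : ∀ s ∈ prog, s.Below N) (n : ℕ)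
    (vals : List Bool) (v : ℕ → Bool) (hl : vals.length = n * N + N)
    (hv : ∀ r < N, vals.getD (n * N + r) false = v r) (r : ℕ) (hr : r < N) :
    (evalGates (progGates N prog n) vals).getD ((n + prog.length) * N + r) false =
      run prog v r := by
  induction prog generalizing n vals v with
  | nil => simpa [progGates, evalGates, run] using hv r hr
  | cons s prog ih =>
    have h₁ : progGates N (s :: prog) n = instrGates N (n * N) s ++ progGates N prog (n + 1) := by
      simp [progGates, List.zipIdx_cons]
    obtain ⟨h₃, h₄, h₅⟩ := hp s (by simp)
    rw [h₁, evalGates_append, evalGates_of_argsBelow (gs := instrGates N (n * N) s) fun g hg => by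
      rw [hl]; exact argsBelow_of_mem_instrGates (hp s (by simp)) hg]
    have h₂ := ih (fun s hs => hp s (by simp [hs])) (n + 1)
      (vals ++ (instrGates N (n * N) s).map fun g => g.eval vals) (exec v s)
      (by simp [hl, instrGates, add_mul]) fun r hr => ?_
    · rw [List.length_cons, show n + (prog.length + 1) = n + 1 + prog.length by omega, h₂]
      rfl
    · have h₆ : (n + 1) * N + r = vals.length + r := by rw [hl, add_mul, one_mul]
      rw [h₆, List.getD_append_right _ _ _ _ (by omega), Nat.add_sub_cancel_left]
      simp only [instrGates, List.map_map, List.getD_eq_getElem?_getD, List.getElem?_map,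
        List.getElem?_range hr, Option.map_some, Option.getD_some, Function.comp_apply]
      rw [exec]
      by_cases hz : r = s.2.1
      · subst hz
        rw [Function.update_self]
        simp only [beq_self_eq_true, if_true, gateOf]
        split_ifs <;> simp only [Gate.eval, hv _ h₄, hv _ h₅]
      · rw [Function.update_of_ne hz]
        simp only [beq_iff_eq, hz, if_false, Gate.eval, hv r hr, Bool.or_self]

theorem eval_progCircuit {N : ℕ} {prog : List Instr} {out : ℕ} (hp : ∀ s ∈ prog, s.Below N)
    (ho : out < N) (a : Fin N → Bool) :
    (progCircuit N prog out hp ho).eval a =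
      run prog (fun r => if h : r < N then a ⟨r, h⟩ else false) out := by
  have h := evalGates_progGates hp 0 (List.ofFn a)
    (fun r => if h : r < N then a ⟨r, h⟩ else false) (by simp) (fun r hr => by
      simp [hr]) out ho
  simpa [Circuit.eval, progCircuit] using h

/-! ### Elementary programs -/

theorem run_append (p q : List Instr) (v : ℕ → Bool) : run (p ++ q) v = run q (run p v) := by
  simp [run]

theorem run_cons (s : Instr) (p : List Instr) (v : ℕ → Bool) : run (s :: p) v = run p (exec v s) :=
  rfl

@[simp] theorem run_nil (v : ℕ → Bool) : run [] v = v := rfl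

@[simp] theorem exec_not (v : ℕ → Bool) (z x : ℕ) :
    exec v (.not z x) = Function.update v z (!v x) := rfl

@[simp] theorem exec_and (v : ℕ → Bool) (z x y : ℕ) :
    exec v (.and z x y) = Function.update v z (v x && v y) := rfl

@[simp] theorem exec_or (v : ℕ → Bool) (z x y : ℕ) :
    exec v (.or z x y) = Function.update v z (v x || v y) := rfl

theorem any_update_of_notMem {z : ℕ} {W : List ℕ} (hz : z ∉ W) (v : ℕ → Bool) (b : Bool) :
    W.any (Function.update v z b) = W.any v := by
  rw [Bool.eq_iff_iff, List.any_eq_true, List.any_eq_true]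
  refine exists_congr fun w => and_congr_right fun hw => ?_
  rw [Function.update_of_ne]
  rintro rfl
  exact hz hw

theorem run_orAll {z : ℕ} {W : List ℕ} (hz : z ∉ W) (v : ℕ → Bool) :
    run (W.map fun w => .or z z w) v = Function.update v z (v z || W.any v) := by
  induction W generalizing v with
  | nil => simp
  | cons w W ih =>
    simp only [List.mem_cons, not_or] at hz
    rw [List.map_cons, run_cons, ih hz.2, exec_or, Function.update_self, Function.update_idem]
    rw [any_update_of_notMem hz.2, List.any_cons, Bool.or_assoc]

/-- The registers `0` (false), `1` (true), `2` (each slot has a value), `3` (temporary) and `4`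
(result) have a fixed meaning. An arc of a graph on registers consists of a list of registers, a
Boolean, and two registers; it is present if the disjunction of the registers in the list has the
given value. -/
abbrev Arc := List ℕ × Bool × ℕ × ℕ

def Arc.Present (v : ℕ → Bool) (a : Arc) : Prop := a.1.any v = a.2.1

/-- Marks the target of an arc if it is present and its source is marked. -/
def relax (a : Arc) : List Instr :=
  .or 3 0 0 :: ((a.1.map fun w => .or 3 3 w) ++ ((if a.2.1 then [] else [.not 3 3]) ++
    [.and 3 3 a.2.2.1, .or a.2.2.2 a.2.2.2 3]))

def relaxAll (arcs : List Arc) : List Instr := arcs.flatMap relax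

/-- Register `3` accumulates the disjunction for the arc, is negated if the arc asks for the value
false, and is combined with the mark of the source. Its final content is irrelevant, whence the
restriction on `r`. -/
theorem run_relax {a : Arc} {v : ℕ → Bool} (h₀ : v 0 = false) (h₁ : 3 ∉ a.1) (h₂ : a.2.2.1 ≠ 3)
    (h₃ : a.2.2.2 ≠ 3) {r : ℕ} (hr : r ≠ 3) :
    run (relax a) v r =
      if r = a.2.2.2 then v r || (v a.2.2.1 && (a.1.any v == a.2.1)) else v r := by
  obtain ⟨W, pol, x, y⟩ := a
  dsimp only at h₁ h₂ h₃ ⊢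
  have h₄ := any_update_of_notMem h₁ v false
  rw [relax, run_cons, run_append, run_append]
  dsimp only
  rw [run_orAll h₁]
  simp only [exec_or, h₀, Bool.or_false, Function.update_self, h₄, Function.update_idem,
    Bool.false_or]
  have h₅ : run (if pol then [] else [Instr.not 3 3]) (Function.update v 3 (W.any v)) =
      Function.update v 3 (W.any v == pol) := by
    cases pol <;> simp [run_cons, Function.update_idem]
  rw [h₅]
  simp only [run_cons, run_nil, exec_and, exec_or, Function.update_self, Function.update_idem,
    Function.update_of_ne h₂, Function.update_of_ne h₃]
  by_cases hy : r = y
  · subst hy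
    rw [Function.update_self, if_pos rfl, Bool.and_comm]
  · rw [Function.update_of_ne hy, Function.update_of_ne hr, if_neg hy]

end EvalReduction

namespace EvalReduction

open PolyTime DataQuery Relation

/-! ### Reachability by a register program -/

/-- Sets the register `2` to false if all registers in the list are false. -/
def checkAny (W : List ℕ) : List Instr :=
  .or 3 0 0 :: ((W.map fun w => .or 3 3 w) ++ [.and 2 2 3])

theorem run_checkAny {W : List ℕ} {v : ℕ → Bool} (hW : 3 ∉ W) {r : ℕ} (hr : r ≠ 3) :
    run (checkAny W) v r = if r = 2 then v 2 && (v 0 || W.any v) else v r := by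
  rw [checkAny, run_cons, run_append, run_orAll hW]
  simp only [exec_or, Bool.or_self, Function.update_self, any_update_of_notMem hW,
    Function.update_idem, run_cons, run_nil, exec_and]
  by_cases h : r = 2
  · subst h
    simp
  · simp [h, hr]

theorem run_flatMap_checkAny {Ws : List (List ℕ)} {v : ℕ → Bool} (hW : ∀ W ∈ Ws, ∀ w ∈ W, 5 ≤ w)
    {r : ℕ} (hr : r ≠ 3) :
    run (Ws.flatMap checkAny) v r =
      if r = 2 then v 2 && Ws.all fun W => v 0 || W.any v else v r := by
  induction Ws generalizing v with
  | nil =>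
    by_cases h : r = 2 <;> simp [h]
  | cons W Ws ih =>
    have h₃ : 3 ∉ W := fun h => by
      have := hW W (by simp) 3 h
      omega
    rw [List.flatMap_cons, run_append, ih fun W hW' => hW W (by simp [hW'])]
    by_cases h : r = 2
    · simp only [h, if_true]
      rw [run_checkAny h₃ (by omega), run_checkAny h₃ (by omega), if_pos rfl, if_neg (by omega),
        List.all_cons, Bool.and_assoc]
      congr 2
      rw [Bool.eq_iff_iff, List.all_eq_true, List.all_eq_true]
      refine forall_congr' fun W' => forall_congr' fun hW' => ?_
      have h₄ : W'.any (run (checkAny W) v) = W'.any v := by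
        rw [Bool.eq_iff_iff, List.any_eq_true, List.any_eq_true]
        refine exists_congr fun w => and_congr_right fun hw => ?_
        have := hW W' (by simp [hW']) w hw
        rw [run_checkAny h₃ (by omega), if_neg (by omega)]
      rw [h₄]
    · rw [if_neg h, run_checkAny h₃ hr, if_neg h, if_neg h]

/-- The registers of the arc are below `N`, and those that represent nodes are the ones from `L`
on. -/
def Arc.Good (L N : ℕ) (a : Arc) : Prop :=
  (∀ w ∈ a.1, w < L ∧ w ≠ 3 ∧ w ≠ 2) ∧ L ≤ a.2.2.1 ∧ a.2.2.1 < N ∧ L ≤ a.2.2.2 ∧ a.2.2.2 < N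

/-- Two nodes are connected by a present arc. -/
def ArcStep (v : ℕ → Bool) (arcs : List Arc) (x y : ℕ) : Prop :=
  ∃ a ∈ arcs, a.Present v ∧ a.2.2.1 = x ∧ a.2.2.2 = y

-- Relaxation computes reachability

section Reach

variable {L N : ℕ} {arcs : List Arc} {v : ℕ → Bool}

theorem Arc.Good.present_congr {a : Arc} (ha : a.Good L N) {v v' : ℕ → Bool}
    (h : ∀ r < L, r ≠ 3 → r ≠ 2 → v' r = v r) : a.Present v' ↔ a.Present v := by
  have : a.1.any v' = a.1.any v := by
    rw [Bool.eq_iff_iff, List.any_eq_true, List.any_eq_true]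
    exact exists_congr fun w => and_congr_right fun hw => by
      rw [h w (ha.1 w hw).1 (ha.1 w hw).2.1 (ha.1 w hw).2.2]
  rw [Arc.Present, Arc.Present, this]

theorem arcStep_congr (ha : ∀ a ∈ arcs, a.Good L N) {v v' : ℕ → Bool}
    (h : ∀ r < L, r ≠ 3 → r ≠ 2 → v' r = v r) : ArcStep v' arcs = ArcStep v arcs := by
  funext x y
  exact propext <| exists_congr fun a => and_congr_right fun hm => by
    rw [(ha a hm).present_congr h]

theorem run_relax_of_good {a : Arc} (ha : a.Good L N) (hL : 4 ≤ L) (h₀ : v 0 = false) {r : ℕ}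
    (hr : r ≠ 3) : run (relax a) v r =
      if r = a.2.2.2 then v r || (v a.2.2.1 && (a.1.any v == a.2.1)) else v r := by
  obtain ⟨h₁, h₂, -, h₃, -⟩ := ha
  exact run_relax h₀ (fun h => (h₁ 3 h).2.1 rfl) (by omega) (by omega) hr

theorem run_of_forall_ne {prog : List Instr} {r : ℕ} (h : ∀ i ∈ prog, i.2.1 ≠ r)
    (v : ℕ → Bool) : run prog v r = v r := by
  induction prog generalizing v with
  | nil => rfl
  | cons i prog ih =>
    rw [run_cons, ih fun i hi => h i (by simp [hi]), exec,
      Function.update_of_ne (h i (by simp)).symm]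

theorem run_relaxAll_of_lt (ha : ∀ a ∈ arcs, a.Good L N) {r : ℕ} (hr : r ≠ 3) (hrL : r < L) :
    run (relaxAll arcs) v r = v r := by
  refine run_of_forall_ne (fun i hi => ?_) v
  simp only [relaxAll, relax, List.mem_flatMap, List.mem_cons, List.mem_append, List.mem_map,
    List.not_mem_nil, or_false] at hi
  obtain ⟨a, ham, rfl | ⟨w, hw, rfl⟩ | hi | rfl | rfl⟩ := hi
  · exact hr.symm
  · exact hr.symm
  · split_ifs at hi
    · simp at hi
    · rw [List.mem_singleton.1 hi]
      exact hr.symm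
  · exact hr.symm
  · have := (ha a ham).2.2.2.1
    simp only [Instr.or]
    omega

theorem le_run_relaxAll (ha : ∀ a ∈ arcs, a.Good L N) (hL : 4 ≤ L) (h₀ : v 0 = false) {r : ℕ}
    (hr : r ≠ 3) (hv : v r = true) : run (relaxAll arcs) v r = true := by
  induction arcs generalizing v with
  | nil => exact hv
  | cons a arcs ih =>
    rw [relaxAll, List.flatMap_cons, run_append]
    refine ih (fun a h => ha a (by simp [h])) ?_ ?_
    · have h := ha a (by simp)
      have := h.2.2.2.1
      rw [run_relax_of_good h hL h₀ (by omega), if_neg (by omega), h₀]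
    · rw [run_relax_of_good (ha a (by simp)) hL h₀ hr]
      split_ifs <;> simp [hv]

theorem run_relaxAll_of_arcStep (ha : ∀ a ∈ arcs, a.Good L N) (hL : 4 ≤ L) (h₀ : v 0 = false)
    {x y : ℕ} (hv : v x = true) (h : ArcStep v arcs x y) : run (relaxAll arcs) v y = true := by
  induction arcs generalizing v with
  | nil => simp [ArcStep] at h
  | cons a arcs ih =>
    obtain ⟨b, hb, hp, rfl, rfl⟩ := h
    have hga := ha a (by simp)
    have hgb := ha b hb
    have h₁ : ∀ r, r ≠ 3 → r < L → run (relax a) v r = v r := fun r hr hrL => by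
      have := hga.2.2.2.1
      rw [run_relax_of_good hga hL h₀ hr, if_neg (by omega)]
    have h₂ : run (relax a) v 0 = false := by rw [h₁ 0 (by omega) (by omega), h₀]
    rw [relaxAll, List.flatMap_cons, run_append]
    have h₃ := hgb.2.1
    have h₄ := hgb.2.2.2.1
    rcases List.mem_cons.1 hb with rfl | hb
    · refine le_run_relaxAll (fun a h => ha a (by simp [h])) hL h₂ (by omega) ?_
      rw [run_relax_of_good hga hL h₀ (by omega), if_pos rfl, hv, show _ = _ from hp]
      simp
    · refine ih (fun a h => ha a (by simp [h])) h₂ ?_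
        ⟨b, hb, (hgb.present_congr fun r hr h₃ _ => h₁ r h₃ hr).2 hp, rfl, rfl⟩
      rw [run_relax_of_good hga hL h₀ (by omega)]
      split_ifs <;> simp [hv]

theorem run_relaxAll_sound (ha : ∀ a ∈ arcs, a.Good L N) (hL : 4 ≤ L) (h₀ : v 0 = false)
    {P : ℕ → Prop} (hP : ∀ x y, ArcStep v arcs x y → P x → P y) (hv : ∀ r, L ≤ r → v r = true → P r)
    {r : ℕ} (hr : L ≤ r) (h : run (relaxAll arcs) v r = true) : P r := by
  induction arcs generalizing v with
  | nil => exact hv r hr h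
  | cons a arcs ih =>
    have hga := ha a (by simp)
    have h₁ : ∀ r, r ≠ 3 → r < L → run (relax a) v r = v r := fun r hr hrL => by
      have := hga.2.2.2.1
      rw [run_relax_of_good hga hL h₀ hr, if_neg (by omega)]
    rw [relaxAll, List.flatMap_cons, run_append] at h
    refine ih (fun a h => ha a (by simp [h])) (by rw [h₁ 0 (by omega) (by omega), h₀])
      (fun x y hxy => hP x y ?_) (fun r hr hv' => ?_) h
    · obtain ⟨b, hb, hp, rfl, rfl⟩ := hxy
      exact ⟨b, by simp [hb], ((ha b (by simp [hb])).present_congr fun r hr h₃ _ =>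
        h₁ r h₃ hr).1 hp, rfl, rfl⟩
    · rw [run_relax_of_good hga hL h₀ (by omega)] at hv'
      split_ifs at hv' with hra
      · rw [Bool.or_eq_true, Bool.and_eq_true] at hv'
        rcases hv' with hv' | ⟨hx, hp⟩
        · exact hv r hr hv'
        · exact hP a.2.2.1 r ⟨a, by simp, by simpa [Arc.Present] using hp, rfl, hra.symm⟩
            (hv _ hga.2.1 hx)
      · exact hv r hr hv'

/-- `n` rounds of relaxation of all arcs. -/
def rounds (n : ℕ) (arcs : List Arc) : List Instr :=
  (List.range n).flatMap fun _ => relaxAll arcs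

theorem rounds_succ (n : ℕ) (arcs : List Arc) :
    rounds (n + 1) arcs = rounds n arcs ++ relaxAll arcs := by
  simp [rounds, List.range_succ]

theorem run_rounds_of_lt (ha : ∀ a ∈ arcs, a.Good L N) (n : ℕ) {r : ℕ} (hr : r ≠ 3)
    (hrL : r < L) : run (rounds n arcs) v r = v r := by
  induction n with
  | zero => rfl
  | succ n ih => rw [rounds_succ, run_append, run_relaxAll_of_lt ha hr hrL, ih]

/-- The presence of arcs depends only on registers below `L` that the rounds do not change, so the
graph stays fixed. Marks spread only along arcs; and since the marked sets increase inside the nodes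
below `N`, some round before the last one adds nothing, so its marked set is closed under arcs. -/
theorem run_rounds_eq_true_iff (ha : ∀ a ∈ arcs, a.Good L N) (hL : 4 ≤ L) (h₀ : v 0 = false)
    {s : ℕ} (hs : L ≤ s) (hv : ∀ r, L ≤ r → (v r = true ↔ r = s)) {r : ℕ} (hr : L ≤ r)
    (hsN : s < N) :
    run (rounds N arcs) v r = true ↔ ReflTransGen (ArcStep v arcs) s r := by
  have h₁ : ∀ n, ArcStep (run (rounds n arcs) v) arcs = ArcStep v arcs := fun n =>
    arcStep_congr ha fun r hr h₃ _ => run_rounds_of_lt ha n h₃ hr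
  have h₂ : ∀ n, run (rounds n arcs) v 0 = false := fun n => by
    rw [run_rounds_of_lt ha n (by omega) (by omega), h₀]
  constructor
  · have key : ∀ n, ∀ r, L ≤ r → run (rounds n arcs) v r = true →
        ReflTransGen (ArcStep v arcs) s r := by
      intro n
      induction n with
      | zero => intro r hr h; rw [(hv r hr).1 h]
      | succ n ih =>
        intro r hr h
        rw [rounds_succ, run_append] at h
        refine run_relaxAll_sound ha hL (h₂ n) (fun x y hxy hx => ?_) ih hr h
        rw [h₁ n] at hxy
        exact hx.tail hxy
    exact key N r hr
  · intro h
    let S : ℕ → Finset ℕ := fun n =>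
      (Finset.range N).filter fun r => L ≤ r ∧ run (rounds n arcs) v r = true
    have hmono : ∀ n, S n ⊆ S (n + 1) := fun n r h => by
      simp only [S, Finset.mem_filter] at h ⊢
      refine ⟨h.1, h.2.1, ?_⟩
      rw [rounds_succ, run_append]
      exact le_run_relaxAll ha hL (h₂ n) (by omega) h.2.2
    -- Otherwise every round would add a node, giving `N` marked nodes among the `N - L` available.
    have hst : ∃ n < N, S n = S (n + 1) := by
      by_contra! hne
      have hc : ∀ n ≤ N, n ≤ (S n).card := by
        intro n
        induction n with
        | zero => simp
        | succ n ih =>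
          intro hn
          have := Finset.card_lt_card ((hmono n).ssubset_of_ne (hne n (by omega)))
          have := ih (by omega)
          omega
      have h₃ : S N ⊆ Finset.Ico L N := fun r h => by
        simp only [S, Finset.mem_filter, Finset.mem_range, Finset.mem_Ico] at h ⊢
        omega
      have h₄ := Finset.card_le_card h₃
      have h₅ := hc N le_rfl
      rw [Nat.card_Ico] at h₄
      omega
    obtain ⟨n, hn, he⟩ := hst
    have hs₀ : ∀ n, s ∈ S n := by
      intro n
      induction n with
      | zero =>
        simp only [S, Finset.mem_filter, Finset.mem_range]
        exact ⟨hsN, hs, (hv s hs).2 rfl⟩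
      | succ n ih => exact hmono n ih
    have hr' : r ∈ S n := by
      induction h with
      | refl => exact hs₀ n
      | @tail x y _ hxy ih =>
        obtain ⟨a, ham, -, hx, hy⟩ := id hxy
        have hg := ha a ham
        have ih := ih (by have := hg.2.1; omega)
        rw [he]
        simp only [S, Finset.mem_filter, Finset.mem_range] at ih ⊢
        refine ⟨by have := hg.2.2.2.2; omega, by have := hg.2.2.2.1; omega, ?_⟩
        rw [rounds_succ, run_append]
        exact run_relaxAll_of_arcStep ha hL (h₂ n) ih.2.2 (by rwa [h₁ n])
    have hle : S n ⊆ S N := monotone_nat_of_le_succ hmono hn.le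
    have h₃ := hle hr'
    simp only [S, Finset.mem_filter] at h₃
    exact h₃.2.2

end Reach

/-- Computes in register `4` whether each of the lists in `Ws` contains a true register and one of
the nodes in `outs` can be reached from `s`. -/
def reachProg (N : ℕ) (Ws : List (List ℕ)) (arcs : List Arc) (s : ℕ) (outs : List ℕ) : List Instr :=
  [.not 2 0, .not 1 0] ++ (Ws.flatMap checkAny ++ ([.or s 1 1] ++ (rounds N arcs ++
    ([.or 4 0 0] ++ ((outs.map fun y => .or 4 4 y) ++ [.and 4 4 2])))))

-- The program with its check of the input

section ReachProg

variable {L N : ℕ} {Ws : List (List ℕ)} {arcs : List Arc} {s : ℕ} {outs : List ℕ}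

theorem reachProg_below (hW : ∀ W ∈ Ws, ∀ w ∈ W, 5 ≤ w ∧ w < L) (ha : ∀ a ∈ arcs, a.Good L N)
    (hL : 5 ≤ L) (hs : L ≤ s) (hsN : s < N) (ho : ∀ y ∈ outs, L ≤ y ∧ y < N) :
    ∀ i ∈ reachProg N Ws arcs s outs, i.Below N := by
  intro i hi
  simp only [reachProg, List.mem_append, List.mem_flatMap, List.mem_map, List.mem_cons,
    List.not_mem_nil, or_false, rounds, relaxAll, relax, checkAny] at hi
  rcases hi with (rfl | rfl) | ⟨W, hWm, rfl | ⟨w, hw, rfl⟩ | rfl⟩ | rfl |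
    ⟨_, _, a, ham, rfl | ⟨w, hw, rfl⟩ | hi | rfl | rfl⟩ | rfl | ⟨y, hy, rfl⟩ | rfl
  any_goals
    simp only [Instr.Below, Instr.not, Instr.and, Instr.or]
    omega
  · have := hW W hWm w hw
    simp only [Instr.Below, Instr.or]
    omega
  · have := (ha a ham).1 w hw
    simp only [Instr.Below, Instr.or]
    omega
  · split_ifs at hi
    · simp at hi
    · rw [List.mem_singleton.1 hi]
      simp only [Instr.Below, Instr.not]
      omega
  · have := (ha a ham).2
    simp only [Instr.Below, Instr.and]
    omega
  · have := (ha a ham).2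
    simp only [Instr.Below, Instr.or]
    omega
  · have := ho y hy
    simp only [Instr.Below, Instr.or]
    omega

/-- All registers are inputs of the circuit, so none can be assumed to be initially false. Register
`0` is tested and feeds the flag `2`. That the nodes start unmarked is assumed in `hv` only under
the checked conditions; it will follow from the weight of the assignment once every row is known to
be hit. -/
theorem run_reachProg (hW : ∀ W ∈ Ws, ∀ w ∈ W, 5 ≤ w ∧ w < L) (ha : ∀ a ∈ arcs, a.Good L N)
    (hL : 5 ≤ L) (hs : L ≤ s) (hsN : s < N) (ho : ∀ y ∈ outs, L ≤ y ∧ y < N) (v : ℕ → Bool)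
    (hv : v 0 = false → (∀ W ∈ Ws, W.any v = true) → ∀ r, L ≤ r → v r = false) :
    run (reachProg N Ws arcs s outs) v 4 = true ↔
      v 0 = false ∧ (∀ W ∈ Ws, W.any v = true) ∧
        ∃ y ∈ outs, ReflTransGen (ArcStep (Function.update v 1 true) arcs) s y := by
  have hmem : ∀ W ∈ Ws, ∀ u : ℕ → Bool, (∀ r, 5 ≤ r → u r = v r) → W.any u = W.any v := by
    intro W hWm u hu
    rw [Bool.eq_iff_iff, List.any_eq_true, List.any_eq_true]
    exact exists_congr fun w => and_congr_right fun hw => by rw [hu w (hW W hWm w hw).1]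
  set v₁ := run [.not 2 0, .not 1 0] v with hv₁
  have h₁ : v₁ = Function.update (Function.update v 2 (!v 0)) 1 (!v 0) := by simp [hv₁, run_cons]
  set v₂ := run (Ws.flatMap checkAny) v₁ with hv₂
  have h₂ : ∀ r, r ≠ 3 → v₂ r = if r = 2 then v₁ 2 && Ws.all fun W => v₁ 0 || W.any v₁ else v₁ r :=
    fun r hr => run_flatMap_checkAny (fun W hWm w hw => (hW W hWm w hw).1) hr
  set v₃ := Function.update v₂ s (v₂ 1) with hv₃
  set v₄ := run (rounds N arcs) v₃ with hv₄
  have h₄ : ∀ r, r ≠ 3 → r < L → v₄ r = v₂ r := fun r hr hrL => by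
    rw [hv₄, run_rounds_of_lt ha N hr hrL, hv₃, Function.update_of_ne (by omega)]
  have hrun : run (reachProg N Ws arcs s outs) v 4 = ((v₄ 0 || outs.any v₄) && v₄ 2) := by
    have h₅ : 4 ∉ outs := fun h => by have := ho 4 h; omega
    simp only [reachProg, run_append, ← hv₁, ← hv₂, run_cons, run_nil, exec_or, Bool.or_self,
      ← hv₃, ← hv₄, run_orAll h₅, exec_and, Function.update_self, any_update_of_notMem h₅,
      Function.update_idem]
    simp
  have h₅ : v₄ 0 = v 0 := by
    rw [h₄ 0 (by omega) (by omega), h₂ 0 (by omega), if_neg (by omega), h₁]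
    simp
  have h₆ : v₄ 2 = (!v 0 && Ws.all fun W => v 0 || W.any v) := by
    rw [h₄ 2 (by omega) (by omega), h₂ 2 (by omega), if_pos rfl]
    have h₇ : (Ws.all fun W => v₁ 0 || W.any v₁) = Ws.all fun W => v 0 || W.any v := by
      rw [Bool.eq_iff_iff, List.all_eq_true, List.all_eq_true]
      refine forall_congr' fun W => forall_congr' fun hWm => ?_
      rw [hmem W hWm v₁ fun r hr => by
        rw [h₁, Function.update_of_ne (by omega), Function.update_of_ne (by omega)], h₁]
      simp
    rw [h₇, h₁]
    simp
  rw [hrun, h₅, h₆]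
  by_cases h₀ : v 0 = true
  · simp [h₀]
  rw [Bool.not_eq_true] at h₀
  simp only [h₀, Bool.false_or, Bool.not_false, Bool.true_and, Bool.and_eq_true, true_and,
    List.all_eq_true]
  rw [and_comm]
  refine and_congr_right fun hok => ?_
  rw [List.any_eq_true]
  refine exists_congr fun y => and_congr_right fun hy => ?_
  have h₈ : ∀ r, r ≠ 3 → r ≠ 2 → r < L → v₃ r = Function.update v 1 true r := fun r hr hr₂ hrL => by
    rw [hv₃, Function.update_of_ne (by omega), h₂ r hr, if_neg hr₂, h₁, h₀]
    by_cases hr₁ : r = 1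
    · simp [hr₁]
    · simp [hr₁, hr₂]
  have h₉ : v₃ 0 = false := by rw [h₈ 0 (by omega) (by omega) (by omega)]; simpa using h₀
  rw [hv₄, run_rounds_eq_true_iff ha (by omega) h₉ hs (fun r hr => ?_) (ho y hy).1 hsN,
    arcStep_congr ha fun r hr h₃ h₂ => h₈ r h₃ h₂ hr]
  by_cases hrs : r = s
  · have h₁₀ : v₂ 1 = true := by
      rw [h₂ 1 (by omega), if_neg (by omega), h₁, h₀]
      simp
    simp [hrs, hv₃, h₁₀]
  · rw [hv₃, Function.update_of_ne hrs, h₂ r (by omega), if_neg (by omega), h₁,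
      Function.update_of_ne (by omega), Function.update_of_ne (by omega), hv h₀ hok r hr]
    simp [hrs]

end ReachProg

end EvalReduction

namespace EvalReduction

open PolyTime DataQuery Relation

/-! ### The circuit for an automaton -/

theorem lt_of_mem_lookupAll {env : Env} {x : Bits} {n : ℕ} (h : ∀ b ∈ env, b.2 < n) {s : ℕ}
    (hs : s ∈ lookupAll env x) : s < n := by
  obtain ⟨b, hb, rfl⟩ := List.mem_map.1 hs
  exact h b (List.mem_filter.1 (List.mem_of_mem_take hb)).1

theorem slot_lt_of_mem_condTrans {c : Cond ℕ} {env : Env} {pol : Bool} {p q i n : ℕ} {t : Trans}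
    (henv : ∀ b ∈ env, b.2 < n) (ht : t ∈ condTrans c env pol p q i) {s : ℕ}
    (hs : s ∈ t.2.2.2.2.2.1) : s < n := by
  induction c generalizing pol p q i with
  | eq x | ne x =>
    simp only [condTrans, List.mem_singleton] at ht
    subst ht
    exact lt_of_mem_lookupAll henv hs
  | and c d ihc ihd | or c d ihc ihd =>
    simp only [condTrans] at ht
    split_ifs at ht
    all_goals
      rcases List.mem_append.1 ht with h | h
      · exact ihd h
      · exact ihc h
  | not c ih => exact ih ht

theorem slot_lt_of_mem_queryTrans {e : REWB ℕ ℕ} {env : Env} {p q i n : ℕ} {t : Trans}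
    (henv : ∀ b ∈ env, b.2 < n) (hn : i + e.size ≤ n) (ht : t ∈ queryTrans e env p q i) {s : ℕ}
    (hs : s ∈ t.2.2.2.2.2.1) : s < n := by
  induction e generalizing env p q i with
  | eps | letter a =>
    simp only [queryTrans, List.mem_singleton] at ht
    subst ht
    simp [Act.eps, Act.read] at hs
  | test a c =>
    simp only [queryTrans, List.mem_append, List.mem_singleton] at ht
    rcases ht with h | rfl
    · exact slot_lt_of_mem_condTrans henv h hs
    · simp [Act.read] at hs
  | union c d ihc ihd | concat c d ihc ihd =>
    simp only [REWB.size] at hn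
    simp only [queryTrans] at ht
    rcases List.mem_append.1 ht with h | h
    · exact ihd henv (by omega) h
    · exact ihc henv (by omega) h
  | star c ih =>
    simp only [REWB.size] at hn
    simp only [queryTrans, List.mem_append, List.mem_cons, List.not_mem_nil, or_false] at ht
    rcases ht with h | rfl | rfl
    · exact ih henv (by omega) h
    · simp [Act.eps] at hs
    · simp [Act.eps] at hs
  | bind a x c ih =>
    simp only [REWB.size] at hn
    simp only [queryTrans, List.mem_append, List.mem_cons, List.not_mem_nil, or_false] at ht
    rcases ht with h | rfl | rfl
    · refine ih (fun b hb => ?_) (by omega) h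
      rcases List.mem_cons.1 hb with rfl | hb
      · dsimp only
        omega
      · exact henv b hb
    · simp [Act.read] at hs
    · simp only [Act.lit, List.mem_singleton] at hs
      omega

/-- The register for the choice of the edge with index `j` for slot `i`, if there are `m` edges. -/
def slotReg (m i j : ℕ) : ℕ := 5 + (i * m + j)

/-- The register for the configuration with state `q` and edge index `j`. -/
def nodeReg (k m q j : ℕ) : ℕ := 5 + (k * m + (q * m + j))

/-- Five special registers, `k` rows of `m` choices, and one node for each of the `2 * k + 2` states
and `m` edge indices. -/
def numRegs (k m : ℕ) : ℕ := 5 + (k * m + (2 * k + 2) * m)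

theorem mul_add_lt {m a b j : ℕ} (ha : a < b) (hj : j < m) : a * m + j < b * m :=
  calc a * m + j < (a + 1) * m := by rw [add_mul]; omega
    _ ≤ b * m := Nat.mul_le_mul_right m ha

theorem mul_add_inj {m a b i j : ℕ} (hi : i < m) (hj : j < m) (h : a * m + i = b * m + j) :
    a = b ∧ i = j := by
  rcases lt_trichotomy a b with hab | rfl | hab
  · have := mul_add_lt hab hi
    omega
  · omega
  · have := mul_add_lt hab hj
    omega

/-- Registers whose disjunction says that the variable of the literal `a` has the value `d`. -/
def litRegs (m : ℕ) (val : List (Bits × Bits)) (es : List Edge) (a : Act) (d : Bits) : List ℕ :=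
  if a.2.2.2.1.isEmpty then
    (((lookupAll val a.2.2.2.2).take 1).filter fun d' => d' == d).map fun _ => 1
  else
    (a.2.2.2.1.take 1).flatMap fun i =>
      (es.zipIdx.filter fun p => !(p.2 == 0) && p.1.2.2.1 == d).map fun p => slotReg m i p.2

/-- The arcs for a transition from a given edge to another one. -/
def transArcs (k m : ℕ) (val : List (Bits × Bits)) (es : List Edge) (t : Trans) (x y : Edge × ℕ) :
    List Arc :=
  if t.2.2.2.1 then
    if !(y.2 == 0) && (y.1.1 == x.1.2.2.2 && y.1.2.1 == t.2.2.2.2.2.2) then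
      [([], false, nodeReg k m t.1 x.2, nodeReg k m t.2.1 y.2)]
    else []
  else if x.2 == y.2 then
    [(if t.2.2.1 then [] else litRegs m val es t.2.2 x.1.2.2.1,
      !t.2.2.1 && t.2.2.2.2.1, nodeReg k m t.1 x.2, nodeReg k m t.2.1 y.2)]
  else []

def arcs (k m : ℕ) (val : List (Bits × Bits)) (es : List Edge) (ts : List Trans) : List Arc :=
  ts.flatMap fun t => es.zipIdx.flatMap fun x => es.zipIdx.flatMap fun y =>
    transArcs k m val es t x y

def slotRows (k m : ℕ) : List (List ℕ) :=
  (List.range k).map fun i => (List.range m).map fun j => slotReg m i j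

def finalNodes (k m : ℕ) (es : List Edge) (v : ℕ) : List ℕ :=
  (es.zipIdx.filter fun x => x.1.2.2.2 == v).map fun x => nodeReg k m 1 x.2

/-- The program that guesses data values and simulates an automaton. -/
def evalProg (k : ℕ) (val : List (Bits × Bits)) (es : List Edge) (ts : List Trans) (v : ℕ) :
    List Instr :=
  reachProg (numRegs k es.length) (slotRows k es.length) (arcs k es.length val es ts)
    (nodeReg k es.length 0 0) (finalNodes k es.length es v)

/-- Bounds on the states and the slots of transitions. -/
def Bounded (k : ℕ) (ts : List Trans) : Prop :=
  ∀ t ∈ ts, t.1 < 2 * k + 2 ∧ t.2.1 < 2 * k + 2 ∧ ∀ s ∈ t.2.2.2.2.2.1, s < k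

theorem bounded_queryTrans (e : REWB ℕ ℕ) : Bounded e.size (queryTrans e [] 0 1 0) := fun t ht =>
  have h := lt_of_mem_queryTrans (by omega) (by omega) ht
  ⟨by simpa using h.1, by simpa using h.2,
    fun s hs => slot_lt_of_mem_queryTrans (by simp) (by omega) ht hs⟩

-- Choices of edges as assignments of weight `k`

section EvalProg

variable {k : ℕ} {val : List (Bits × Bits)} {es : List Edge} {ts : List Trans} {v : ℕ}

theorem mem_zipIdx_iff {α : Type} {l : List α} {x : α × ℕ} : x ∈ l.zipIdx ↔ l[x.2]? = some x.1 := by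
  rw [List.mem_zipIdx_iff_getElem?]

theorem lt_length_of_mem_zipIdx {α : Type} {l : List α} {x : α × ℕ} (h : x ∈ l.zipIdx) :
    x.2 < l.length := by
  rw [mem_zipIdx_iff] at h
  exact (List.getElem?_eq_some_iff.1 h).1

theorem le_nodeReg (k m q j : ℕ) : 5 + k * m ≤ nodeReg k m q j := by
  unfold nodeReg
  omega

theorem nodeReg_lt {m q j : ℕ} (hq : q < 2 * k + 2) (hj : j < m) : nodeReg k m q j < numRegs k m := by
  have := mul_add_lt hq hj
  unfold nodeReg numRegs
  omega

theorem slotReg_lt {m i j : ℕ} (hi : i < k) (hj : j < m) :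
    5 ≤ slotReg m i j ∧ slotReg m i j < 5 + k * m := by
  have := mul_add_lt hi hj
  unfold slotReg
  omega

theorem mem_slotRows {m : ℕ} {W : List ℕ} (hW : W ∈ slotRows k m) {w : ℕ} (hw : w ∈ W) :
    5 ≤ w ∧ w < 5 + k * m := by
  obtain ⟨i, hi, rfl⟩ := List.mem_map.1 hW
  obtain ⟨j, hj, rfl⟩ := List.mem_map.1 hw
  exact slotReg_lt (List.mem_range.1 hi) (List.mem_range.1 hj)

theorem lt_of_mem_litRegs {a : Act} (ha : ∀ s ∈ a.2.2.2.1, s < k) {d : Bits} {w : ℕ}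
    (hw : w ∈ litRegs es.length val es a d) : w = 1 ∨ 5 ≤ w ∧ w < 5 + k * es.length := by
  unfold litRegs at hw
  split_ifs at hw
  · obtain ⟨_, -, rfl⟩ := List.mem_map.1 hw
    exact .inl rfl
  · obtain ⟨i, hi, hw⟩ := List.mem_flatMap.1 hw
    obtain ⟨p, hp, rfl⟩ := List.mem_map.1 hw
    exact .inr (slotReg_lt (ha i (List.mem_of_mem_take hi))
      (lt_length_of_mem_zipIdx (List.mem_filter.1 hp).1))

theorem arcs_good (hts : Bounded k ts) {a : Arc} (ha : a ∈ arcs k es.length val es ts) :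
    a.Good (5 + k * es.length) (numRegs k es.length) := by
  simp only [arcs, List.mem_flatMap] at ha
  obtain ⟨t, ht, x, hx, y, hy, ha⟩ := ha
  have hx := lt_length_of_mem_zipIdx hx
  have hy := lt_length_of_mem_zipIdx hy
  obtain ⟨hp, hq, hs⟩ := hts t ht
  unfold transArcs at ha
  have hn : ∀ (W : List ℕ) (b : Bool), (∀ w ∈ W, w = 1 ∨ 5 ≤ w ∧ w < 5 + k * es.length) →
      Arc.Good (5 + k * es.length) (numRegs k es.length)
        (W, b, nodeReg k es.length t.1 x.2, nodeReg k es.length t.2.1 y.2) := fun W b hW =>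
    ⟨fun w hw => by have := hW w hw; omega, le_nodeReg .., nodeReg_lt hp hx, le_nodeReg ..,
      nodeReg_lt hq hy⟩
  split_ifs at ha
  · rw [List.mem_singleton.1 ha]
    exact hn _ _ (by simp)
  · simp at ha
  · rw [List.mem_singleton.1 ha]
    exact hn _ _ (by simp)
  · rw [List.mem_singleton.1 ha]
    exact hn _ _ fun w hw => lt_of_mem_litRegs hs hw
  · simp at ha

theorem finalNodes_good {y : ℕ} (hy : y ∈ finalNodes k es.length es v) :
    5 + k * es.length ≤ y ∧ y < numRegs k es.length := by
  obtain ⟨x, hx, rfl⟩ := List.mem_map.1 hy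
  exact ⟨le_nodeReg .., nodeReg_lt (by omega) (lt_length_of_mem_zipIdx (List.mem_filter.1 hx).1)⟩

theorem evalProg_below (hts : Bounded k ts) (hes : es ≠ []) :
    ∀ i ∈ evalProg k val es ts v, i.Below (numRegs k es.length) :=
  reachProg_below (L := 5 + k * es.length) (fun _ hW _ hw => mem_slotRows hW hw)
    (fun _ ha => arcs_good hts ha) (by omega) (le_nodeReg ..)
    (nodeReg_lt (by omega) (List.length_pos_iff.2 hes)) fun _ hy => finalNodes_good hy

/-- The data values of the chosen edges. -/
def chosen (es : List Edge) (c : ℕ → ℕ) (i : ℕ) : Option Bits :=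
  if c i = 0 then none else (es[c i]?).map fun ed => ed.2.2.1

/-- Exactly the registers for the choices `c` are true. -/
def Chooses (k m : ℕ) (c : ℕ → ℕ) (u : ℕ → Bool) : Prop :=
  (∀ i < k, c i < m) ∧ ∀ r, u r = true ↔ ∃ i < k, r = slotReg m i (c i)

/-- Row `i` contains exactly one true register, so the disjunction over the edges with value `d`
says that the chosen edge carries `d`. Index `0` is left out, since it means that no value is
guessed. A free variable has a known value, and the comparison is decided when the circuit is built:
the disjunction is over register `1` or empty. -/
theorem any_litRegs {c : ℕ → ℕ} {u : ℕ → Bool} (hu : Chooses k es.length c u) {a : Act}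
    (ha : ∀ s ∈ a.2.2.2.1, s < k) (d : Bits) :
    (litRegs es.length val es a d).any (Function.update u 1 true) = true ↔
      refVal (chosen es c) val a = some d := by
  obtain ⟨b₁, b₂, b₃, slots, x⟩ := a
  dsimp only at ha
  cases slots with
  | nil =>
    simp only [litRegs, refVal, List.isEmpty_nil, if_true]
    cases lookupAll val x <;> simp [List.filter_cons]
  | cons i s =>
    simp only [litRegs, refVal, List.isEmpty_cons, Bool.false_eq_true, if_false, List.take_succ_cons,
      List.take_zero, List.flatMap_cons, List.flatMap_nil, List.append_nil, List.any_map,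
      List.any_eq_true, List.mem_filter, Function.comp_apply, chosen]
    have hi := ha i (by simp)
    constructor
    · rintro ⟨p, ⟨hp, hpd⟩, h⟩
      have hpl := lt_length_of_mem_zipIdx hp
      have h₅ := (slotReg_lt hi hpl).1
      rw [Function.update_of_ne (by omega), hu.2] at h
      obtain ⟨i', hi', h⟩ := h
      have h := mul_add_inj hpl (hu.1 i' hi') (Nat.add_left_cancel h)
      obtain ⟨rfl, hc⟩ := h
      rw [mem_zipIdx_iff, hc] at hp
      simp only [Bool.and_eq_true, Bool.not_eq_true', beq_eq_false_iff_ne, beq_iff_eq] at hpd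
      rw [if_neg (hc ▸ hpd.1), hp, Option.map_some, hpd.2]
    · intro h
      split_ifs at h with h₀
      obtain ⟨ed, hed, rfl⟩ := Option.map_eq_some_iff.1 h
      refine ⟨(ed, c i), ⟨mem_zipIdx_iff.2 hed, by simp [h₀]⟩, ?_⟩
      have h₅ := (slotReg_lt hi (hu.1 i hi)).1
      rw [Function.update_of_ne (by dsimp only; omega), hu.2]
      exact ⟨i, hi, rfl⟩

/-- Reading transitions and `ε` become arcs that are always present, the empty disjunction having
the required value false. Literals become arcs conditional on the guess, with the polarity as the
required value. -/
theorem arcStep_nodeReg {c : ℕ → ℕ} {u : ℕ → Bool} (hu : Chooses k es.length c u)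
    (hts : Bounded k ts) {r r' : ℕ} :
    ArcStep (Function.update u 1 true) (arcs k es.length val es ts) r r' ↔
      ∃ x y, r = nodeReg k es.length x.1 x.2 ∧ r' = nodeReg k es.length y.1 y.2 ∧
        Step (chosen es c) val es ts x y := by
  constructor
  · rintro ⟨a, ha, hp, rfl, rfl⟩
    simp only [arcs, List.mem_flatMap] at ha
    obtain ⟨t, ht, x, hx, y, hy, ha⟩ := ha
    rw [mem_zipIdx_iff] at hx hy
    refine ⟨(t.1, x.2), (t.2.1, y.2), ?_⟩
    unfold transArcs at ha
    split_ifs at ha with h₁ h₂ h₃ h₄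
    · rw [List.mem_singleton.1 ha]
      refine ⟨rfl, rfl, t, ht, x.1, y.1, hx, hy, rfl, rfl, ?_⟩
      simp only [Bool.and_eq_true, Bool.not_eq_true', beq_eq_false_iff_ne, beq_iff_eq] at h₂
      rw [Allowed, if_pos h₁]
      exact h₂
    · simp at ha
    · rw [List.mem_singleton.1 ha]
      refine ⟨rfl, rfl, t, ht, x.1, y.1, hx, hy, rfl, rfl, ?_⟩
      rw [Allowed, if_neg h₁]
      exact ⟨by simpa using h₃, .inl h₄⟩
    · rw [List.mem_singleton.1 ha] at hp ⊢
      refine ⟨rfl, rfl, t, ht, x.1, y.1, hx, hy, rfl, rfl, ?_⟩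
      rw [Allowed, if_neg h₁]
      refine ⟨by simpa using h₃, .inr ?_⟩
      rw [LitHolds, ← any_litRegs hu (hts t ht).2.2, show _ = _ from hp]
      simp [h₄]
    · simp at ha
  · rintro ⟨x, y, rfl, rfl, t, ht, ed, ed', hx, hy, h₁, h₂, hal⟩
    have key : ∀ a : Arc, a ∈ transArcs k es.length val es t (ed, x.2) (ed', y.2) →
        a.Present (Function.update u 1 true) ∧ a.2.2.1 = nodeReg k es.length x.1 x.2 ∧
          a.2.2.2 = nodeReg k es.length y.1 y.2 →
        ArcStep (Function.update u 1 true) (arcs k es.length val es ts)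
          (nodeReg k es.length x.1 x.2) (nodeReg k es.length y.1 y.2) := by
      refine fun a ha h => ⟨a, ?_, h⟩
      simp only [arcs, List.mem_flatMap]
      exact ⟨t, ht, (ed, x.2), mem_zipIdx_iff.2 hx, (ed', y.2), mem_zipIdx_iff.2 hy, ha⟩
    unfold Allowed at hal
    split_ifs at hal with h
    · refine key ([], false, nodeReg k es.length t.1 x.2, nodeReg k es.length t.2.1 y.2) ?_ ?_
      · rw [transArcs, if_pos h, if_pos]
        · simp
        · simp [hal]
      · rw [h₁, h₂]
        exact ⟨rfl, rfl, rfl⟩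
    · refine key (if t.2.2.1 then [] else litRegs es.length val es t.2.2 ed.2.2.1,
        !t.2.2.1 && t.2.2.2.2.1, nodeReg k es.length t.1 x.2, nodeReg k es.length t.2.1 y.2) ?_ ?_
      · rw [transArcs, if_neg h, if_pos]
        · simp
        · simp [hal]
      · rw [h₁, h₂]
        refine ⟨?_, rfl, rfl⟩
        unfold Arc.Present
        by_cases h₄ : t.2.2.1 = true
        · simp [h₄]
        · have h₅ := hal.2.resolve_left h₄
          rw [LitHolds, ← any_litRegs hu (hts t ht).2.2] at h₅
          simp only [h₄, Bool.not_false, Bool.true_and]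
          exact Bool.eq_iff_iff.2 h₅

theorem run_evalProg {c : ℕ → ℕ} {u : ℕ → Bool} (hu : Chooses k es.length c u)
    (hts : Bounded k ts) (hes : es ≠ []) :
    run (evalProg k val es ts v) u 4 = true ↔
      ∃ j ed, es[j]? = some ed ∧ ed.2.2.2 = v ∧
        ReflTransGen (Step (chosen es c) val es ts) (0, 0) (1, j) := by
  have hm := List.length_pos_iff.2 hes
  have h₀ : u 0 = false := by
    rw [← Bool.not_eq_true, hu.2]
    rintro ⟨i, hi, h⟩
    have := slotReg_lt hi (hu.1 i hi)
    omega
  have h₁ : ∀ W ∈ slotRows k es.length, W.any u = true := by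
    intro W hW
    obtain ⟨i, hi, rfl⟩ := List.mem_map.1 hW
    have hi := List.mem_range.1 hi
    exact List.any_eq_true.2 ⟨_, List.mem_map.2 ⟨c i, List.mem_range.2 (hu.1 i hi), rfl⟩,
      (hu.2 _).2 ⟨i, hi, rfl⟩⟩
  have h₂ : ∀ r, 5 + k * es.length ≤ r → u r = false := by
    intro r hr
    rw [← Bool.not_eq_true, hu.2]
    rintro ⟨i, hi, h⟩
    have := slotReg_lt hi (hu.1 i hi)
    omega
  rw [evalProg, run_reachProg (L := 5 + k * es.length) (fun _ hW _ hw => mem_slotRows hW hw)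
    (fun _ ha => arcs_good hts ha) (by omega) (le_nodeReg ..) (nodeReg_lt (by omega) hm)
    (fun _ hy => finalNodes_good hy) u fun _ _ => h₂]
  have hstep : ∀ {x y}, Step (chosen es c) val es ts x y → y.2 < es.length := by
    rintro x y ⟨t, ht, ed, ed', hx, hy, -⟩
    exact (List.getElem?_eq_some_iff.1 hy).1
  constructor
  · rintro ⟨-, -, y, hy, hr⟩
    have key : ∃ x : ℕ × ℕ, x.2 < es.length ∧ y = nodeReg k es.length x.1 x.2 ∧
        ReflTransGen (Step (chosen es c) val es ts) (0, 0) x := by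
      clear hy
      induction hr with
      | refl => exact ⟨(0, 0), hm, rfl, .refl⟩
      | tail _ h ih =>
        obtain ⟨x, hx, rfl, hr⟩ := ih
        obtain ⟨x', y', he, rfl, hs⟩ := (arcStep_nodeReg hu hts).1 h
        refine ⟨y', hstep hs, rfl, hr.tail ?_⟩
        obtain ⟨t, ht, ed, ed', hx', hrest⟩ := id hs
        have := mul_add_inj hx (List.getElem?_eq_some_iff.1 hx').1
          (Nat.add_left_cancel (Nat.add_left_cancel he))
        rwa [Prod.ext this.1 this.2]
    obtain ⟨x, hx, rfl, hr⟩ := key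
    obtain ⟨z, hz, he⟩ := List.mem_map.1 hy
    obtain ⟨hz, hv⟩ := List.mem_filter.1 hz
    have := mul_add_inj (lt_length_of_mem_zipIdx hz) hx
      (Nat.add_left_cancel (Nat.add_left_cancel he))
    refine ⟨z.2, z.1, mem_zipIdx_iff.1 hz, by simpa using hv, ?_⟩
    rwa [this.1, this.2]
  · rintro ⟨j, ed, hj, hv, hr⟩
    refine ⟨h₀, h₁, nodeReg k es.length 1 j, ?_, ?_⟩
    · exact List.mem_map.2 ⟨(ed, j), List.mem_filter.2 ⟨mem_zipIdx_iff.2 hj, by simpa using hv⟩,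
        rfl⟩
    · exact hr.lift (fun x => nodeReg k es.length x.1 x.2) fun x y h =>
        (arcStep_nodeReg hu hts).2 ⟨x, y, rfl, rfl, h⟩

/-- The circuit for `evalProg`. -/
def evalCircuit (k : ℕ) (val : List (Bits × Bits)) (es : List Edge) (ts : List Trans) (v : ℕ)
    (hts : Bounded k ts) (hes : es ≠ []) : Circuit :=
  progCircuit (numRegs k es.length) (evalProg k val es ts v) 4 (evalProg_below hts hes)
    (by unfold numRegs; omega)

theorem eval_evalCircuit (hts : Bounded k ts) (hes : es ≠ [])
    (a : Fin (numRegs k es.length) → Bool) :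
    (evalCircuit k val es ts v hts hes).eval a = run (evalProg k val es ts v)
      (fun r => if h : r < numRegs k es.length then a ⟨r, h⟩ else false) 4 :=
  eval_progCircuit _ _ a

/-- Rows are disjoint, so `k` nonempty rows already account for `k` true inputs. A satisfying
assignment of weight `k` thus has no others and is the indicator of a choice function; conversely
such an indicator has weight `k`. -/
theorem exists_weight_iff (hts : Bounded k ts) (hes : es ≠ []) :
    (∃ a, weight a = k ∧ (evalCircuit k val es ts v hts hes).eval a = true) ↔
      ∃ c : ℕ → ℕ, (∀ i < k, c i < es.length) ∧ ∃ j ed, es[j]? = some ed ∧ ed.2.2.2 = v ∧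
        ReflTransGen (Step (chosen es c) val es ts) (0, 0) (1, j) := by
  have hev : (∃ a, weight a = k ∧ (evalCircuit k val es ts v hts hes).eval a = true) ↔
      ∃ a : Fin (numRegs k es.length) → Bool, weight a = k ∧ run (evalProg k val es ts v)
        (fun r => if h : r < numRegs k es.length then a ⟨r, h⟩ else false) 4 = true :=
    ⟨fun ⟨a, h, h'⟩ => ⟨a, h, (eval_evalCircuit hts hes a).symm.trans h'⟩,
      fun ⟨a, h, h'⟩ => ⟨a, h, (eval_evalCircuit hts hes a).trans h'⟩⟩
  rw [hev]
  have hslot : ∀ i < k, ∀ j < es.length, slotReg es.length i j < numRegs k es.length := by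
    intro i hi j hj
    have := slotReg_lt hi hj
    unfold numRegs
    omega
  have hcard : ∀ (c : ℕ → ℕ) (hc : ∀ i < k, c i < es.length),
      (Finset.univ.image fun i : Fin k =>
        (⟨slotReg es.length i (c i), hslot i i.2 _ (hc i i.2)⟩ : Fin (numRegs k es.length))).card =
        k := by
    intro c hc
    rw [Finset.card_image_of_injective, Finset.card_univ, Fintype.card_fin]
    intro i i' h
    exact Fin.ext (mul_add_inj (hc i i.2) (hc i' i'.2)
      (Nat.add_left_cancel (Fin.mk.inj h))).1
  constructor
  · rintro ⟨a, ha, he⟩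
    set u : ℕ → Bool := fun r => if h : r < numRegs k es.length then a ⟨r, h⟩ else false with hu
    have hch : (∀ W ∈ slotRows k es.length, W.any u = true) →
        ∃ c, Chooses k es.length c u := by
      intro h
      have h₁ : ∀ i, ∃ j, i < k → j < es.length ∧ u (slotReg es.length i j) = true := by
        intro i
        by_cases hi : i < k
        · obtain ⟨w, hw, hu⟩ := List.any_eq_true.1
            (h _ (List.mem_map.2 ⟨i, List.mem_range.2 hi, rfl⟩))
          obtain ⟨j, hj, rfl⟩ := List.mem_map.1 hw
          exact ⟨j, fun _ => ⟨List.mem_range.1 hj, hu⟩⟩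
        · exact ⟨0, fun h => absurd h hi⟩
      choose c hc using h₁
      have hc' := fun i hi => (hc i hi).1
      refine ⟨c, hc', fun r => ⟨fun hr => ?_, ?_⟩⟩
      -- The chosen slots lie inside the set of true inputs and both have `k` elements, so they
      -- coincide. In particular all node registers are initially false.
      · have hsub := Finset.eq_of_subset_of_card_le (s := Finset.univ.image fun i : Fin k =>
          (⟨slotReg es.length i (c i), hslot i i.2 _ (hc' i i.2)⟩ : Fin (numRegs k es.length)))
          (t := Finset.univ.filter fun i => a i = true) (fun x hx => ?_)
          (by rw [hcard c hc']; exact ha.le)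
        · simp only [hu] at hr
          split_ifs at hr with hrN
          have hm : (⟨r, hrN⟩ : Fin (numRegs k es.length)) ∈
              Finset.univ.filter fun i => a i = true := by simpa using hr
          rw [← hsub] at hm
          obtain ⟨i, -, hi⟩ := Finset.mem_image.1 hm
          exact ⟨i, i.2, (Fin.mk.inj hi).symm⟩
        · obtain ⟨i, -, rfl⟩ := Finset.mem_image.1 hx
          have := (hc i i.2).2
          simp only [hu, hslot i i.2 _ (hc' i i.2), dif_pos] at this
          simpa using this
      · rintro ⟨i, hi, rfl⟩
        exact (hc i hi).2
    have hm := List.length_pos_iff.2 hes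
    have hrun := (run_reachProg (L := 5 + k * es.length) (fun _ hW _ hw => mem_slotRows hW hw)
      (fun _ ha => arcs_good hts ha) (by omega) (le_nodeReg ..) (nodeReg_lt (by omega) hm)
      (fun _ hy => finalNodes_good hy) u (fun _ h r hr => by
        obtain ⟨c, hc⟩ := hch h
        rw [← Bool.not_eq_true, hc.2]
        rintro ⟨i, hi, h⟩
        have := slotReg_lt hi (hc.1 i hi)
        omega)).1 he
    obtain ⟨c, hc⟩ := hch hrun.2.1
    exact ⟨c, hc.1, (run_evalProg hc hts hes).1 he⟩
  · rintro ⟨c, hc, h⟩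
    refine ⟨fun r : Fin (numRegs k es.length) => decide (∃ i < k, r.val = slotReg es.length i (c i)),
      ?_, ?_⟩
    · refine Eq.trans ?_ (hcard c hc)
      change (Finset.univ.filter _).card = _
      refine congrArg Finset.card (Finset.ext fun r => ?_)
      rw [Finset.mem_filter, Finset.mem_image]
      constructor
      · rintro ⟨-, h⟩
        obtain ⟨i, hi, h⟩ := of_decide_eq_true h
        exact ⟨⟨i, hi⟩, Finset.mem_univ _, Fin.ext h.symm⟩
      · rintro ⟨i, -, rfl⟩
        exact ⟨Finset.mem_univ _, decide_eq_true ⟨i, i.2, rfl⟩⟩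
    · refine (run_evalProg ⟨hc, fun r => ?_⟩ hts hes).2 h
      split_ifs with hr
      · simp
      · simp only [false_iff]
        rintro ⟨i, hi, rfl⟩
        exact hr (hslot i hi _ (hc i hi))

end EvalProg

end EvalReduction

namespace EvalReduction

open PolyTime DataQuery Relation

/-! ### Correctness of the reduction -/

def edgeOf {n : ℕ} (e : Fin n × ℕ × ℕ × Fin n) : Edge :=
  (e.1.val, e.2.1.bits, e.2.2.1.bits, e.2.2.2.val)

def bindingOf (p : ℕ × ℕ) : Bits × Bits := (p.1.bits, p.2.bits)

theorem head?_lookupAll (l : List (ℕ × ℕ)) (x : ℕ) :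
    (lookupAll (l.map bindingOf) x.bits).head? = (l.lookup x).map Nat.bits := by
  induction l with
  | nil => rfl
  | cons p l ih =>
    obtain ⟨y, d⟩ := p
    by_cases h : x = y
    · subst h
      simp [lookupAll, bindingOf]
    · have hb : ¬ y.bits = x.bits := fun hb => h (bits_injective hb).symm
      have hxy : (x == y) = false := by simpa using h
      rw [List.lookup_cons, hxy, ← ih]
      simp [lookupAll, bindingOf, hb]

theorem envOK_nil (σ : ℕ → Option ℕ) (l : List (ℕ × ℕ)) :
    EnvOK σ (l.map bindingOf) [] (fun x => l.lookup x) := fun x _ => head?_lookupAll l x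

theorem path_iff_edgePath {i : ℕ} {I : EvalInstance i} {u v : Fin I.numVertices}
    {w : List (ℕ × ℕ)} : I.graph.Path u w v ↔ EdgePath (I.edges.map edgeOf) u.val w v.val := by
  constructor
  · intro h
    induction h with
    | nil => rfl
    | cons h _ ih => exact ⟨_, List.mem_map.2 ⟨_, h, rfl⟩, ih⟩
  · intro h
    induction w generalizing u with
    | nil => rw [Fin.ext (show u.val = v.val from h)]; exact .nil v
    | cons x w ih =>
      obtain ⟨a, d⟩ := x
      obtain ⟨u', hm, h⟩ := h
      obtain ⟨⟨u₁, a₁, d₁, u₂⟩, he, heq⟩ := List.mem_map.1 hm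
      simp only [edgeOf, Prod.mk.injEq] at heq
      obtain ⟨h₁, h₂, h₃, rfl⟩ := heq
      obtain rfl := Fin.ext h₁
      obtain rfl := bits_injective h₂
      obtain rfl := bits_injective h₃
      exact .cons he (ih h)

theorem exists_edge_of_mem {es : List Edge} {u v : ℕ} {w : List (ℕ × ℕ)} (h : EdgePath es u w v)
    {x : ℕ × ℕ} (hx : x ∈ w) : ∃ ed ∈ es, ed.2.2.1 = x.2.bits := by
  induction w generalizing u with
  | nil => simp at hx
  | cons y w ih =>
    obtain ⟨u', hm, h⟩ := h
    rcases List.mem_cons.1 hx with rfl | hx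
    · exact ⟨_, hm, rfl⟩
    · exact ih h hx

/-- The edge list of an instance, together with an additional first element for its source. -/
def edgeList {i : ℕ} (I : EvalInstance i) : List Edge :=
  (0, [], [], I.source.val) :: I.edges.map edgeOf

/-- A guess of data values and a choice of edges are translated into each other. Level one is needed
only to find the guess; that a guessed word belongs to the language holds for every expression. -/
theorem mem_yes_iff (I : EvalInstance 1) : I ∈ (evalProblem 1).yes ↔
    ∃ c : ℕ → ℕ, (∀ i < I.query.size, c i < (edgeList I).length) ∧
      ∃ j ed, (edgeList I)[j]? = some ed ∧ ed.2.2.2 = I.target.val ∧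
        ReflTransGen (Step (chosen (edgeList I) c) (I.valuation.map bindingOf) (edgeList I)
          (queryTrans I.query [] 0 1 0)) (0, 0) (1, j) := by
  have hes : ∀ ed ∈ I.edges.map edgeOf, ∃ a d : ℕ, ed.2.1 = a.bits ∧ ed.2.2.1 = d.bits := by
    intro ed h
    obtain ⟨e, -, rfl⟩ := List.mem_map.1 h
    exact ⟨_, _, rfl, rfl⟩
  have hrun := fun σ => exists_run_iff (src := (0, [], [], I.source.val)) (e := I.query)
    (v := I.target.val) (envOK_nil σ I.valuation) hes rfl
  change (∃ w ∈ I.query.lang (fun x => I.valuation.lookup x), I.graph.Path I.source w I.target) ↔ _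
  simp only [path_iff_edgePath]
  constructor
  · rintro ⟨w, hw, hp⟩
    obtain ⟨σ, hg, hσ, hσw⟩ := exists_guess I.query_level _ 0 hw fun _ => none
    have hc : ∀ i, ∃ j, j < (edgeList I).length ∧
        (if j = 0 then none else ((edgeList I)[j]?).map fun ed => ed.2.2.1) =
          (σ i).map Nat.bits := by
      intro i
      rcases hσw i with h | ⟨x, hx, h⟩
      -- Slots without a guessed value select the fictitious edge.
      · exact ⟨0, by simp [edgeList], by simp [h]⟩
      · obtain ⟨ed, hm, hd⟩ := exists_edge_of_mem hp hx
        obtain ⟨j, hj, hje⟩ := List.getElem_of_mem hm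
        refine ⟨j + 1, by simpa [edgeList] using hj, ?_⟩
        rw [if_neg (by omega), edgeList, List.getElem?_cons_succ, List.getElem?_eq_getElem hj,
          hje, h]
        simp [hd]
    choose c hc using hc
    refine ⟨c, fun i _ => (hc i).1, ?_⟩
    have hch : chosen (edgeList I) c = fun i => (σ i).map Nat.bits := funext fun i => (hc i).2
    rw [hch]
    exact (hrun σ).1 ⟨w, hg, hp⟩
  · rintro ⟨c, -, h⟩
    have hc : ∀ i, ∃ d : Option ℕ, d.map Nat.bits = chosen (edgeList I) c i := by
      intro i
      unfold chosen
      split_ifs with h₀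
      · exact ⟨none, rfl⟩
      · obtain ⟨n, hn⟩ := Nat.exists_eq_succ_of_ne_zero h₀
        rw [hn, edgeList, List.getElem?_cons_succ, List.getElem?_map]
        cases h : I.edges[n]? with
        | none => exact ⟨none, rfl⟩
        | some e => exact ⟨some e.2.2.1, rfl⟩
    choose σ hσ using hc
    have hch : chosen (edgeList I) c = fun i => (σ i).map Nat.bits := funext fun i => (hσ i).symm
    rw [hch] at h
    obtain ⟨w, hw, hp⟩ := (hrun σ).2 h
    exact ⟨w, guessLang_le _ _ _ _ hw, hp⟩

/-- The circuit for an instance of the evaluation problem, together with the parameter. -/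
def reduction (I : EvalInstance 1) : Circuit × ℕ :=
  (evalCircuit I.query.size (I.valuation.map bindingOf) (edgeList I) (queryTrans I.query [] 0 1 0)
    I.target.val (bounded_queryTrans I.query) (List.cons_ne_nil _ _), I.query.size)

theorem mem_yes_iff_reduction (I : EvalInstance 1) :
    I ∈ (evalProblem 1).yes ↔ reduction I ∈ weightedCircuitSat.yes :=
  (mem_yes_iff I).trans (exists_weight_iff (bounded_queryTrans I.query) (List.cons_ne_nil _ _)).symm

end EvalReduction

namespace EvalReduction

open PolyTime DataQuery Relation

/-! ### The reduction is computable in polynomial time -/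

section Poly

variable {γ : Type} [Enc γ]

theorem poly_unaryCode {n : γ → ℕ} (hn : PolyFun n) : PolyFun fun x => unaryCode (n x) :=
  (hn.replicate (.const true)).append (.const [false])

theorem poly_slotReg {m i j : γ → ℕ} (hm : PolyFun m) (hi : PolyFun i) (hj : PolyFun j) :
    PolyFun fun x => slotReg (m x) (i x) (j x) :=
  (PolyFun.const 5).add ((hi.mul hm).add hj)

theorem poly_nodeReg {k m q j : γ → ℕ} (hk : PolyFun k) (hm : PolyFun m) (hq : PolyFun q)
    (hj : PolyFun j) : PolyFun fun x => nodeReg (k x) (m x) (q x) (j x) :=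
  (PolyFun.const 5).add ((hk.mul hm).add ((hq.mul hm).add hj))

theorem poly_numRegs {k m : γ → ℕ} (hk : PolyFun k) (hm : PolyFun m) :
    PolyFun fun x => numRegs (k x) (m x) :=
  (PolyFun.const 5).add ((hk.mul hm).add ((poly_two_mul_add_two hk).mul hm))

theorem poly_instr {op : Bool × Bool} {z x y : γ → ℕ} (hz : PolyFun z) (hx : PolyFun x)
    (hy : PolyFun y) : PolyFun fun g => ((op, z g, x g, y g) : Instr) :=
  (PolyFun.const op).pair (hz.pair (hx.pair hy))

theorem poly_checkAny {W : γ → List ℕ} (hW : PolyFun W) : PolyFun fun x => checkAny (W x) :=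
  (PolyFun.const _).cons ((hW.map (f := fun _ w => Instr.or 3 3 w)
    (poly_instr (.const 3) (.const 3) PolyFun.id.snd)).append (.const _))

theorem poly_relax : PolyFun relax :=
  (PolyFun.const _).cons ((PolyFun.id.fst.map (f := fun _ w => Instr.or 3 3 w)
    (poly_instr (.const 3) (.const 3) PolyFun.id.snd)).append
    ((PolyFun.ite PolyFun.id.snd.fst (.const []) (.const _)).append
      ((poly_instr (.const 3) (.const 3) PolyFun.id.snd.snd.fst).cons
        ((poly_instr PolyFun.id.snd.snd.snd PolyFun.id.snd.snd.snd (.const 3)).cons (.const [])))))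

theorem poly_rounds {n : γ → ℕ} {as : γ → List Arc} (hn : PolyFun n) (ha : PolyFun as) :
    PolyFun fun x => rounds (n x) (as x) := by
  have h : PolyFun fun x => relaxAll (as x) :=
    ha.flatMap (f := fun _ a => relax a) (poly_relax.comp PolyFun.id.snd)
  exact hn.range.flatMap (f := fun x _ => relaxAll (as x)) (h.comp PolyFun.id.fst)

theorem poly_reachProg {N s : γ → ℕ} {Ws : γ → List (List ℕ)} {as : γ → List Arc}
    {outs : γ → List ℕ} (hN : PolyFun N) (hW : PolyFun Ws) (ha : PolyFun as) (hs : PolyFun s)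
    (ho : PolyFun outs) : PolyFun fun x => reachProg (N x) (Ws x) (as x) (s x) (outs x) :=
  (PolyFun.const _).append ((hW.flatMap (f := fun _ W => checkAny W)
    (poly_checkAny PolyFun.id.snd)).append
    (((poly_instr hs (.const 1) (.const 1)).cons (.const [])).append ((poly_rounds hN ha).append
      ((PolyFun.const _).append ((ho.map (f := fun _ y => Instr.or 4 4 y)
        (poly_instr (.const 4) (.const 4) PolyFun.id.snd)).append (.const _))))))

theorem poly_litRegs {m : γ → ℕ} {val : γ → List (Bits × Bits)} {es : γ → List Edge} {a : γ → Act}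
    {d : γ → Bits} (hm : PolyFun m) (hv : PolyFun val) (he : PolyFun es) (ha : PolyFun a)
    (hd : PolyFun d) : PolyFun fun x => litRegs (m x) (val x) (es x) (a x) (d x) := by
  have hs := ha.snd.snd.snd.fst
  refine PolyFun.ite hs.isEmpty ?_ ?_
  · refine PolyFun.map (f := fun _ _ => 1) (PolyFun.filter (f := fun x d' => d' == d x)
      (PolyFun.takeOne (poly_lookupAll hv ha.snd.snd.snd.snd)) ?_) (.const 1)
    exact PolyFun.beqBits PolyFun.id.snd (hd.comp PolyFun.id.fst)
  · refine PolyFun.flatMap (f := fun x i =>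
      ((es x).zipIdx.filter fun p => !(p.2 == 0) && p.1.2.2.1 == d x).map fun p =>
        slotReg (m x) i p.2) hs.takeOne ?_
    refine PolyFun.map (f := fun (x : γ × ℕ) (p : Edge × ℕ) => slotReg (m x.1) x.2 p.2)
      (PolyFun.filter (f := fun (x : γ × ℕ) (p : Edge × ℕ) => !(p.2 == 0) && p.1.2.2.1 == d x.1)
        (he.comp PolyFun.id.fst).zipIdx ?_) ?_
    · exact (PolyFun.id.snd.snd.beqNat (.const 0)).not.and
        (PolyFun.id.snd.fst.snd.snd.fst.beqBits (hd.comp PolyFun.id.fst.fst))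
    · exact poly_slotReg (hm.comp PolyFun.id.fst.fst) PolyFun.id.fst.snd PolyFun.id.snd.snd

theorem poly_transArcs {k m : γ → ℕ} {val : γ → List (Bits × Bits)} {es : γ → List Edge}
    {t : γ → Trans} {x y : γ → Edge × ℕ} (hk : PolyFun k) (hm : PolyFun m) (hv : PolyFun val)
    (he : PolyFun es) (ht : PolyFun t) (hx : PolyFun x) (hy : PolyFun y) :
    PolyFun fun g => transArcs (k g) (m g) (val g) (es g) (t g) (x g) (y g) := by
  have hn := poly_nodeReg hk hm ht.fst hx.snd
  have hn' := poly_nodeReg hk hm ht.snd.fst hy.snd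
  refine PolyFun.ite ht.snd.snd.snd.fst (PolyFun.ite ((hy.snd.beqNat (.const 0)).not.and
    ((hy.fst.fst.beqNat hx.fst.snd.snd.snd).and
      (hy.fst.snd.fst.beqBits ht.snd.snd.snd.snd.snd.snd))) ?_ (.const []))
    (PolyFun.ite (hx.snd.beqNat hy.snd) ?_ (.const []))
  · exact ((PolyFun.const []).pair ((PolyFun.const false).pair (hn.pair hn'))).cons (.const [])
  · exact ((PolyFun.ite ht.snd.snd.fst (.const [])
      (poly_litRegs hm hv he ht.snd.snd hx.fst.snd.snd.fst)).pair
      ((ht.snd.snd.fst.not.and ht.snd.snd.snd.snd.fst).pair (hn.pair hn'))).cons (.const [])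

theorem poly_arcs {k m : γ → ℕ} {val : γ → List (Bits × Bits)} {es : γ → List Edge}
    {ts : γ → List Trans} (hk : PolyFun k) (hm : PolyFun m) (hv : PolyFun val) (he : PolyFun es)
    (ht : PolyFun ts) : PolyFun fun g => arcs (k g) (m g) (val g) (es g) (ts g) := by
  refine PolyFun.flatMap (f := fun g t => (es g).zipIdx.flatMap fun x => (es g).zipIdx.flatMap
    fun y => transArcs (k g) (m g) (val g) (es g) t x y) ht ?_
  refine PolyFun.flatMap (f := fun (g : γ × Trans) x => (es g.1).zipIdx.flatMap
    fun y => transArcs (k g.1) (m g.1) (val g.1) (es g.1) g.2 x y)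
    (he.comp PolyFun.id.fst).zipIdx ?_
  refine PolyFun.flatMap (f := fun (g : (γ × Trans) × Edge × ℕ) y =>
    transArcs (k g.1.1) (m g.1.1) (val g.1.1) (es g.1.1) g.1.2 g.2 y)
    (he.comp PolyFun.id.fst.fst).zipIdx ?_
  have hf : PolyFun fun g : ((γ × Trans) × Edge × ℕ) × Edge × ℕ => g.1.1.1 := PolyFun.id.fst.fst.fst
  exact poly_transArcs (hk.comp hf) (hm.comp hf) (hv.comp hf) (he.comp hf) PolyFun.id.fst.fst.snd
    PolyFun.id.fst.snd PolyFun.id.snd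

theorem poly_evalProg {k v : γ → ℕ} {val : γ → List (Bits × Bits)} {es : γ → List Edge}
    {ts : γ → List Trans} (hk : PolyFun k) (hval : PolyFun val) (he : PolyFun es)
    (ht : PolyFun ts) (hv : PolyFun v) :
    PolyFun fun g => evalProg (k g) (val g) (es g) (ts g) (v g) := by
  have hm := he.length
  refine poly_reachProg (poly_numRegs hk hm) ?_ (poly_arcs hk hm hval he ht)
    (poly_nodeReg hk hm (.const 0) (.const 0)) ?_
  · refine PolyFun.map (f := fun g i => (List.range (es g).length).map fun j =>
      slotReg (es g).length i j) hk.range ?_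
    refine PolyFun.map (f := fun (g : γ × ℕ) j => slotReg (es g.1).length g.2 j)
      (hm.comp PolyFun.id.fst).range ?_
    exact poly_slotReg (hm.comp PolyFun.id.fst.fst) PolyFun.id.fst.snd PolyFun.id.snd
  · refine PolyFun.map (f := fun g (x : Edge × ℕ) => nodeReg (k g) (es g).length 1 x.2)
      (PolyFun.filter (f := fun g (x : Edge × ℕ) => x.1.2.2.2 == v g) he.zipIdx ?_) ?_
    · exact PolyFun.id.snd.fst.snd.snd.snd.beqNat (hv.comp PolyFun.id.fst)
    · exact poly_nodeReg (hk.comp PolyFun.id.fst) (hm.comp PolyFun.id.fst) (.const 1)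
        PolyFun.id.snd.snd

theorem listCode_eq_flatMap {α : Type} (c : α → Bits) (l : List α) :
    listCode c l = (l.flatMap fun a => true :: c a) ++ [false] := by
  induction l with
  | nil => rfl
  | cons a l ih => simp [listCode, ih]

theorem gateCode_gateOf (op : Bool × Bool) (i j : ℕ) : gateCode (gateOf op i j) =
    if op.1 then [false, false] ++ unaryCode i
    else if op.2 then [false, true] ++ (unaryCode i ++ unaryCode j)
    else [true, false] ++ (unaryCode i ++ unaryCode j) := by
  unfold gateOf
  split_ifs <;> rfl

theorem poly_gateCode {op : γ → Bool × Bool} {i j : γ → ℕ} (ho : PolyFun op) (hi : PolyFun i)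
    (hj : PolyFun j) : PolyFun fun x => gateCode (gateOf (op x) (i x) (j x)) := by
  simp only [gateCode_gateOf]
  exact PolyFun.ite ho.fst ((PolyFun.const _).append (poly_unaryCode hi)) (PolyFun.ite ho.snd
    ((PolyFun.const _).append ((poly_unaryCode hi).append (poly_unaryCode hj)))
    ((PolyFun.const _).append ((poly_unaryCode hi).append (poly_unaryCode hj))))

/-- The code of the gate for register `r` in the list of gates for an instruction. -/
def instrGateCode (b r : ℕ) (s : Instr) : Bits :=
  if r == s.2.1 then gateCode (gateOf s.1 (b + s.2.2.1) (b + s.2.2.2))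
  else gateCode (gateOf (false, false) (b + r) (b + r))

/-- The code of each gate is written inside the two loops, so that gates themselves need no
representation as trees. -/
theorem listCode_progGates (N : ℕ) (prog : List Instr) :
    listCode gateCode (progGates N prog 0) = (prog.zipIdx.flatMap fun s =>
      (List.range N).flatMap fun r => true :: instrGateCode (s.2 * N) r s.1) ++ [false] := by
  simp only [listCode_eq_flatMap, progGates, instrGates, List.flatMap_assoc, List.flatMap_map,
    instrGateCode, apply_ite gateCode]
  rfl

theorem poly_listCode_progGates {N : γ → ℕ} {prog : γ → List Instr} (hN : PolyFun N)
    (hp : PolyFun prog) : PolyFun fun x => listCode gateCode (progGates (N x) (prog x) 0) := by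
  simp only [listCode_progGates]
  refine PolyFun.append ?_ (.const _)
  refine PolyFun.flatMap (f := fun x (s : Instr × ℕ) => (List.range (N x)).flatMap fun r =>
    true :: instrGateCode (s.2 * N x) r s.1) hp.zipIdx ?_
  refine PolyFun.flatMap (f := fun (x : γ × Instr × ℕ) r =>
    true :: instrGateCode (x.2.2 * N x.1) r x.2.1) (hN.comp PolyFun.id.fst).range ?_
  refine (PolyFun.const true).cons ?_
  have hr : PolyFun fun x : (γ × Instr × ℕ) × ℕ => x.2 := PolyFun.id.snd
  have hs : PolyFun fun x : (γ × Instr × ℕ) × ℕ => x.1.2.1 := PolyFun.id.fst.snd.fst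
  have hb : PolyFun fun x : (γ × Instr × ℕ) × ℕ => x.1.2.2 * N x.1.1 :=
    PolyFun.id.fst.snd.snd.mul (hN.comp PolyFun.id.fst.fst)
  exact PolyFun.ite (hr.beqNat hs.snd.fst)
    (poly_gateCode hs.fst (hb.add hs.snd.snd.fst) (hb.add hs.snd.snd.snd))
    (poly_gateCode (.const _) (hb.add hr) (hb.add hr))

/-- What has to be written on the tape as the result of the reduction. -/
def resultCode (k : ℕ) (val : List (Bits × Bits)) (es : List Edge) (ts : List Trans) (v : ℕ) :
    Bits :=
  unaryCode k ++ (unaryCode (numRegs k es.length) ++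
    (listCode gateCode (progGates (numRegs k es.length) (evalProg k val es ts v) 0) ++
      unaryCode ((evalProg k val es ts v).length * numRegs k es.length + 4)))

theorem poly_resultCode {k v : γ → ℕ} {val : γ → List (Bits × Bits)} {es : γ → List Edge}
    {ts : γ → List Trans} (hk : PolyFun k) (hval : PolyFun val) (he : PolyFun es)
    (ht : PolyFun ts) (hv : PolyFun v) :
    PolyFun fun g => resultCode (k g) (val g) (es g) (ts g) (v g) := by
  have hN := poly_numRegs hk he.length
  have hp := poly_evalProg hk hval he ht hv
  exact (poly_unaryCode hk).append ((poly_unaryCode hN).append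
    ((poly_listCode_progGates hN hp).append (poly_unaryCode ((hp.length.mul hN).add (.const 4)))))

end Poly

/-- The reduction as a function on strings. -/
def tapeReduction (s : Bits) : Bits :=
  let k := parseUnary s
  let n := parseUnary k.2
  let es := parseList parseEdge n.2
  let ts := translate es.2
  let val := parseList parseBinding ts.2
  let u := parseUnary val.2
  let v := parseUnary u.2
  resultCode k.1 val.1 ((0, [], [], u.1) :: es.1) ts.1 v.1

theorem poly_tapeReduction : PolyFun tapeReduction := by
  have hk := poly_parseUnary
  have hn := poly_parseUnary.comp hk.snd
  have he := (poly_parseList poly_parseEdge sz_snd_parseEdge_le).comp hn.snd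
  have ht := poly_translate.comp he.snd
  have hval := (poly_parseList poly_parseBinding sz_snd_parseBinding_le).comp ht.snd
  have hu := poly_parseUnary.comp hval.snd
  have hv := poly_parseUnary.comp hu.snd
  exact poly_resultCode hk.fst hval.fst (((PolyFun.const 0).pair ((PolyFun.const []).pair
    ((PolyFun.const []).pair hu.fst))).cons he.fst) ht.fst hv.fst

/-- Each parser inverts the corresponding code and leaves the rest of the tape to the next one. The
parameter is read off the tape, where it precedes the instance. -/
theorem tapeReduction_tape (I : EvalInstance 1) :
    tapeReduction ((evalProblem 1).tape I) = weightedCircuitSat.tape (reduction I) := by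
  have h₁ := fun r => parseList_listCode (item := parseEdge) (c := edgeCode (n := I.numVertices))
    (g := edgeOf) parseEdge_edgeCode I.edges r
  have h₂ := fun r => parseList_listCode (item := parseBinding) (c := bindingCode)
    (g := bindingOf) parseBinding_bindingCode I.valuation r
  have h₃ := fun n => parseUnary_unaryCode n []
  simp only [List.append_nil] at h₃
  change tapeReduction (unaryCode I.query.size ++ I.code) = unaryCode (reduction I).2 ++
    (reduction I).1.code
  simp only [tapeReduction, EvalInstance.code, parseUnary_unaryCode, h₁, translate_queryCode, h₂,
    h₃]
  rfl

theorem le_length_code (I : EvalInstance 1) :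
    3 ≤ I.code.length ∧ I.query.size ≤ I.code.length := by
  have h := query_size_le I.query
  have h₁ : 1 ≤ I.query.size := by cases I.query <;> simp [REWB.size] <;> omega
  simp only [EvalInstance.code, List.length_append, unaryCode, List.length_replicate,
    List.length_singleton]
  omega

theorem outputsWithin_reduction : ∃ (M : Turing.TM2ComputableAux Bool Bool) (f : ℕ → ℕ) (c : ℕ),
    Computable f ∧ ∀ I : EvalInstance 1, OutputsWithin M ((evalProblem 1).tape I)
      (weightedCircuitSat.tape (reduction I))
      (f ((evalProblem 1).param I) * ((evalProblem 1).encode I).length ^ c) := by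
  obtain ⟨M, e, h⟩ := poly_tapeReduction.outputsWithin
  -- The time bound is polynomial in the length of the tape, which includes the parameter in unary.
  -- The parameter is at most the length of the instance's code, and that length is at least `3`, so
  -- the tape length plus two is at most its square and no factor depending on the parameter is
  -- needed.
  refine ⟨M, fun _ => 1, 2 * e, Computable.const 1, fun I => ?_⟩
  have h₁ := h ((evalProblem 1).tape I)
  rw [tapeReduction_tape] at h₁
  have h₂ := le_length_code I
  have h₃ : ((evalProblem 1).tape I).length + 2 ≤ I.code.length ^ 2 := by
    change (unaryCode I.query.size ++ I.code).length + 2 ≤ _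
    simp only [unaryCode, List.length_append, List.length_replicate, List.length_singleton]
    nlinarith
  obtain ⟨t, ht⟩ := h₁
  exact ⟨t, ht.trans (by
    rw [one_mul, pow_mul]
    exact Nat.pow_le_pow_left h₃ e)⟩

end EvalReduction

theorem mainTheorem7 : DataQuery.evalProblem 1 ∈ DataQuery.WP :=
  ⟨EvalReduction.reduction, EvalReduction.mem_yes_iff_reduction,
    ⟨id, Computable.id, fun _ => le_rfl⟩, EvalReduction.outputsWithin_reduction⟩
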